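/- Let $n\ge 1$. For $1<p<\infty$ let $A_p$ be the class of weights $w$ on $\mathbb R^n$ (non-negative, locally integrable, not a.e. zero) with $$[w]_{A_p}=\sup_Q\Big(\frac1{|Q|}\int_Q w\,dx\Big)\Big(\frac1{|Q|}\int_Q w^{1-p'}\,dx\Big)^{p-1}<\infty,\qquad \frac1p+\frac1{p'}=1,$$ where $Q$ runs over all cubes with sides parallel to the coordinate axes. Let $\Delta$ be the collection of dyadic cubes $\prod_{i=1}^n[2^km_i,2^k(m_i+1))$ with $k,m_1,\dots,m_n\in\mathbb Z$, and for $Q\in\Delta$ let $\hat Q\in\Delta$ be its dyadic parent, the dyadic cube containing $Q$ with twice its side length. For a real-valued locally integrable function $f$ the dyadic square function is $$S_df(x)=\Big(\sum_{Q\in\Delta}(f_Q-f_{\hat Q})^2\chi_Q(x)\Big)^{1/2},\qquad f_Q=\frac1{|Q|}\int_Q f\,dx.$$ 1. For every $1<p<\infty$ there is a finite constant $c$, depending only on $n$ and $p$, such that for all $w\in A_p$ and all $f\in L^p(w)$ $$\|S_df\|_{L^p(w)}\le c\,[w]_{A_p}^{\max\{\frac12,\frac1{p-1}\}}\,\|f\|_{L^p(w)}.$$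 2. The exponent is sharp: for every $1<p<\infty$ and every real $\beta<\max\{\frac12,\frac1{p-1}\}$ there is no finite constant $c$ such that $\|S_df\|_{L^p(w)}\le c\,[w]_{A_p}^{\beta}\|f\|_{L^p(w)}$ for all $w\in A_p$ and all $f\in L^p(w)$. 3. The endpoint orders of $S_d$ are $\alpha_{S_d}=1$ and $\gamma_{S_d}=\frac12$, where, with $\|T\|_{L^p(\mathbb R^n)}$ the least $C\in[0,\infty]$ such that $\|Tf\|_{L^p}\le C\|f\|_{L^p}$ for all $f\in L^p(\mathbb R^n)$, $$\alpha_T=\sup\Big\{\alpha\ge0:\ \forall\varepsilon>0,\ \limsup_{p\to1^+}(p-1)^{\alpha-\varepsilon}\|T\|_{L^p(\mathbb R^n)}=\infty\Big\},\qquad \gamma_T=\sup\Big\{\gamma\ge0:\ \forall\varepsilon>0,\ \limsup_{p\to\infty}\frac{\|T\|_{L^p(\mathbb R^n)}}{p^{\gamma-\varepsilon}}=\infty\Big\}.$$ -/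

import Mathlib

open MeasureTheory Filter Topology
open scoped NNReal ENNReal

noncomputable section

namespace SquareDyadic

/-- The closed axis-parallel cube in `ℝⁿ` with lower corner `a` and side length `h`. -/
def cube {n : ℕ} (a : Fin n → ℝ) (h : ℝ) : Set (Fin n → ℝ) :=
  Set.Icc a (fun i => a i + h)

/-- The Muckenhoupt constant `[w]_{A_p}`, the supremum over all cubes `Q` of
`(⨍_Q w) (⨍_Q w^{1-p'})^{p-1}`, as an extended nonnegative number
(`w^{1-p'} = ∞` where `w = 0`). -/
def apConst {n : ℕ} (p : ℝ) (w : (Fin n → ℝ) → ℝ) : ℝ≥0∞ :=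
  ⨆ (a : Fin n → ℝ) (h : ℝ) (_ : 0 < h),
    laverage (volume.restrict (cube a h)) (fun y => ENNReal.ofReal (w y)) *
      laverage (volume.restrict (cube a h))
        (fun y => ENNReal.ofReal (w y) ^ (1 - p.conjExponent)) ^ (p - 1)

/-- `w` is an `A_p` weight: a nonnegative, locally integrable function, not almost everywhere
zero, with finite Muckenhoupt constant. -/
structure IsApWeight {n : ℕ} (p : ℝ) (w : (Fin n → ℝ) → ℝ) : Prop where
  nonneg : ∀ x, 0 ≤ w x
  locallyIntegrable : LocallyIntegrable w volume
  not_ae_zero : ¬ w =ᵐ[volume] 0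
  apConst_lt_top : apConst p w < ∞

/-- The measure `w dx`. -/
def weightMeasure {n : ℕ} (w : (Fin n → ℝ) → ℝ) : Measure (Fin n → ℝ) :=
  volume.withDensity fun x => ENNReal.ofReal (w x)

/-- The dyadic cube `∏ᵢ [2ᵏ mᵢ, 2ᵏ (mᵢ + 1))`. -/
def dyadicCube {n : ℕ} (k : ℤ) (m : Fin n → ℤ) : Set (Fin n → ℝ) :=
  {x | ∀ i, (2 : ℝ) ^ k * m i ≤ x i ∧ x i < (2 : ℝ) ^ k * (m i + 1)}

/-- The dyadic parent of `dyadicCube k m`: the dyadic cube of twice the side length containing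
it, whose position is `⌊mᵢ / 2⌋` in each coordinate (integer division by `2` rounds down). -/
def dyadicParent {n : ℕ} (k : ℤ) (m : Fin n → ℤ) : Set (Fin n → ℝ) :=
  dyadicCube (k + 1) fun i => m i / 2

theorem dyadicCube_subset_dyadicParent {n : ℕ} (k : ℤ) (m : Fin n → ℤ) :
    dyadicCube k m ⊆ dyadicParent k m := by
  intro x hx i
  have hk : (0 : ℝ) < 2 ^ k := by positivity
  have h1 : (2 : ℝ) * ((m i / 2 : ℤ) : ℝ) ≤ m i := by
    have : 2 * (m i / 2) ≤ m i := by omega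
    exact_mod_cast this
  have h2 : (m i : ℝ) + 1 ≤ 2 * (((m i / 2 : ℤ) : ℝ) + 1) := by
    have : m i + 1 ≤ 2 * (m i / 2 + 1) := by omega
    exact_mod_cast this
  obtain ⟨h3, h4⟩ := hx i
  rw [zpow_add_one₀ (by norm_num : (2 : ℝ) ≠ 0)]
  constructor <;> nlinarith

/-- The dyadic square function `S_d f (x) = (∑_Q (f_Q - f_Q̂)² χ_Q(x))^{1/2}`, the sum running
over all dyadic cubes `Q`, with `Q̂` the dyadic parent of `Q`; its values may be infinite. -/
def dyadicSquare {n : ℕ} (f : (Fin n → ℝ) → ℝ) (x : Fin n → ℝ) : ℝ≥0∞ :=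
  (∑' q : ℤ × (Fin n → ℤ), (dyadicCube q.1 q.2).indicator
    (fun _ => ENNReal.ofReal
      (((⨍ y in dyadicCube q.1 q.2, f y) - ⨍ y in dyadicParent q.1 q.2, f y) ^ 2)) x) ^ (1 / 2 : ℝ)

/-- The weighted inequality `‖T f‖_{L^p(w)} ≤ c [w]_{A_p}^β ‖f‖_{L^p(w)}` for all `w ∈ A_p` and
all `f ∈ L^p(w)`, with a finite constant `c` independent of `w` and `f`. -/
def WeightedBound {n : ℕ} (T : ((Fin n → ℝ) → ℝ) → (Fin n → ℝ) → ℝ≥0∞) (p β : ℝ) : Prop :=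
  ∃ c : ℝ≥0, ∀ w : (Fin n → ℝ) → ℝ, IsApWeight p w →
    ∀ f : (Fin n → ℝ) → ℝ, MemLp f (ENNReal.ofReal p) (weightMeasure w) →
      eLpNorm (T f) (ENNReal.ofReal p) (weightMeasure w) ≤
        c * apConst p w ^ β * eLpNorm f (ENNReal.ofReal p) (weightMeasure w)

/-- The norm `‖T‖_{L^p(ℝⁿ)}`: the least `C ∈ [0, ∞]` with `‖T f‖_p ≤ C ‖f‖_p` for all
`f ∈ L^p(ℝⁿ)`. -/
def lpOpNorm {n : ℕ} (T : ((Fin n → ℝ) → ℝ) → (Fin n → ℝ) → ℝ≥0∞) (p : ℝ) : ℝ≥0∞ :=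
  sInf {C : ℝ≥0∞ | ∀ f : (Fin n → ℝ) → ℝ, MemLp f (ENNReal.ofReal p) volume →
    eLpNorm (T f) (ENNReal.ofReal p) volume ≤ C * eLpNorm f (ENNReal.ofReal p) volume}

/-- The endpoint order at `p = 1`: the supremum in `[0, ∞]` of the `α ≥ 0` such that, for every
`ε > 0`, the upper limit of `(p - 1)^{α - ε} ‖T‖_{L^p}` as `p → 1⁺` is infinite. -/
def endpointOrderOne {n : ℕ} (T : ((Fin n → ℝ) → ℝ) → (Fin n → ℝ) → ℝ≥0∞) : ℝ≥0∞ :=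
  ⨆ α ∈ {α : ℝ≥0 | ∀ ε : ℝ, 0 < ε →
    limsup (fun p : ℝ => ENNReal.ofReal ((p - 1) ^ ((α : ℝ) - ε)) * lpOpNorm T p) (𝓝[>] 1) = ∞},
    (α : ℝ≥0∞)

/-- The endpoint order at `p = ∞`: the supremum in `[0, ∞]` of the `γ ≥ 0` such that, for every
`ε > 0`, the upper limit of `‖T‖_{L^p} / p^{γ - ε}` as `p → ∞` is infinite. -/
def endpointOrderTop {n : ℕ} (T : ((Fin n → ℝ) → ℝ) → (Fin n → ℝ) → ℝ≥0∞) : ℝ≥0∞ :=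
  ⨆ γ ∈ {γ : ℝ≥0 | ∀ ε : ℝ, 0 < ε →
    limsup (fun p : ℝ => lpOpNorm T p / ENNReal.ofReal (p ^ ((γ : ℝ) - ε))) atTop = ∞},
    (γ : ℝ≥0∞)

end SquareDyadic

end

/-! The upper bound is a sparse domination of `S_d` raised to a power `r ≤ 2`. Starting from a cube
`Q`, descend through the generations and stop once the mean of `|f|` exceeds 4 times its value on
`Q`, or the accumulated squares exceed 32 times the square of that value. The stopped part fills at
most half of `Q` (`volume_stopped_le`). Since `t ↦ t ^ (r / 2)` is subadditive, the sum can be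
restarted on each stopped child at a cost comparable to the `r`-th power of the mean on `Q`. This is
iterated directly under the integral (`lintegral_squareSum_le`), so no sparse family is constructed:
a bound of the mean to the power `r`, times `∫_Q G`, by `K ∫_E H` for all `E ⊆ Q` of at least half
the volume passes to the square sums.

For a weight `w` put `σ = w^{1-p'}` and `f = φσ` up to sign. The function `S_d^r` is tested in
`L^{p/r}(w)` against its own power. The resulting form is controlled by the dyadic maximal operators
with respect to `σ` and to `w`, whose norms do not depend on the measure
(`lintegral_dyadicMaximal_rpow_le`). The `A_p` condition serves mainly to replace the masses of `Q`
by those of `E` (`testing_arithmetic`), at the price `[w]^a` with `a = max(1, r/(p-1))`. Taking the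
root of order `r` gives the exponent `max(1/r, 1/(p-1))`. Here `r < p` is needed, so `r = 2` serves
`p > 2`; for `p ≤ 2` the choice `r = 1` loses nothing because `1/(p-1) ≥ 1`. With both weights equal
to 1 the same argument bounds the norm by a multiple of `(C p/r)^{1/r} p'`, of order `1/(p-1)` near
1 and `p^{1/2}` near infinity.

Sharpness comes from two functions of one coordinate, cut off to the unit cube. For `|x_i|^{δ-1}` a
single martingale jump already gives `S_d f ≥ f/(5δ)`; this is paired with the weight
`|x_i|^{(1-δ)(p-1)}`, whose constant is at most `(4/δ)^{p-1}`. For the sign alternating between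
dyadic shells, each of the first `k` jumps has size `2/3` where `x_i < 2^{-k}`, so `S_d f` is at
least `(4k/9)^{1/2}` there; the weight `|x_i|^{-(1-1/k)}` has constant at most `4k` and puts half of
its unit-cube mass on that set. Without a weight the same functions give both lower endpoint orders.
-/

namespace SquareDyadic

/-! ### Geometry of dyadic cubes -/

/-- The position of the dyadic cube of side length `2 ^ k` that contains `x`. -/
noncomputable def cubeIndex {n : ℕ} (k : ℤ) (x : Fin n → ℝ) : Fin n → ℤ := fun i => ⌊x i / 2 ^ k⌋

theorem mem_dyadicCube_iff {n : ℕ} {k : ℤ} {m : Fin n → ℤ} {x : Fin n → ℝ} :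
    x ∈ dyadicCube k m ↔ cubeIndex k x = m := by
  have hk : (0 : ℝ) < 2 ^ k := by positivity
  simp only [dyadicCube, Set.mem_ofPred_eq, cubeIndex, funext_iff, Int.floor_eq_iff, le_div_iff₀ hk,
    div_lt_iff₀ hk, mul_comm]

theorem mem_dyadicCube_cubeIndex {n : ℕ} (k : ℤ) (x : Fin n → ℝ) :
    x ∈ dyadicCube k (cubeIndex k x) := mem_dyadicCube_iff.2 rfl

theorem measurable_cubeIndex {n : ℕ} (k : ℤ) : Measurable (cubeIndex (n := n) k) := by
  unfold cubeIndex
  exact measurable_pi_lambda _ fun i => Int.measurable_floor.comp ((measurable_pi_apply i).div_const _)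

theorem measurableSet_dyadicCube {n : ℕ} (k : ℤ) (m : Fin n → ℤ) :
    MeasurableSet (dyadicCube k m) := by
  have : dyadicCube k m = cubeIndex k ⁻¹' {m} := by ext x; simp [mem_dyadicCube_iff]
  rw [this]
  exact measurable_cubeIndex k (MeasurableSet.singleton m)

theorem dyadicCube_eq_pi {n : ℕ} (k : ℤ) (m : Fin n → ℤ) :
    dyadicCube k m =
      Set.univ.pi fun i => Set.Ico ((2 : ℝ) ^ k * m i) ((2 : ℝ) ^ k * (m i + 1)) := by
  ext x; simp [dyadicCube, Set.mem_pi]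

/-- The volume of the dyadic cubes of side length `2 ^ k`. -/
noncomputable def cubeVol (n : ℕ) (k : ℤ) : ℝ := ((2 : ℝ) ^ k) ^ n

theorem cubeVol_pos (n : ℕ) (k : ℤ) : 0 < cubeVol n k := by unfold cubeVol; positivity

theorem cubeVol_eq (n : ℕ) (k : ℤ) : cubeVol n k = 2 ^ n * cubeVol n (k - 1) := by
  have : (2 : ℝ) ^ k = 2 * 2 ^ (k - 1) := by
    rw [mul_comm, ← zpow_add_one₀ (by norm_num : (2 : ℝ) ≠ 0)]; simp
  rw [cubeVol, cubeVol, this, mul_pow]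

theorem volume_dyadicCube {n : ℕ} (k : ℤ) (m : Fin n → ℤ) :
    volume (dyadicCube k m) = ENNReal.ofReal (cubeVol n k) := by
  have hk : (0 : ℝ) < 2 ^ k := by positivity
  rw [dyadicCube_eq_pi, Real.volume_pi_Ico]
  have : ∀ i, (2 : ℝ) ^ k * (m i + 1) - 2 ^ k * m i = 2 ^ k := fun i => by ring
  simp [this, cubeVol, ENNReal.ofReal_pow hk.le]

theorem volume_real_dyadicCube {n : ℕ} (k : ℤ) (m : Fin n → ℤ) :
    volume.real (dyadicCube k m) = cubeVol n k := by
  rw [Measure.real, volume_dyadicCube, ENNReal.toReal_ofReal (cubeVol_pos n k).le]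

theorem volume_dyadicCube_ne_top {n : ℕ} (k : ℤ) (m : Fin n → ℤ) :
    volume (dyadicCube k m) ≠ ∞ := by
  rw [volume_dyadicCube]; exact ENNReal.ofReal_ne_top

theorem volume_dyadicCube_ne_zero {n : ℕ} (k : ℤ) (m : Fin n → ℤ) :
    volume (dyadicCube k m) ≠ 0 := by
  rw [volume_dyadicCube]; simpa using cubeVol_pos n k

/-- The positions of the `2 ^ n` dyadic children of a dyadic cube. -/
def childIndex {n : ℕ} (m : Fin n → ℤ) (e : Fin n → Fin 2) : Fin n → ℤ := fun i => 2 * m i + (e i : ℕ)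

theorem childIndex_div_two {n : ℕ} (m : Fin n → ℤ) (e : Fin n → Fin 2) :
    (fun i => childIndex m e i / 2) = m := by
  funext i
  have := (e i).isLt
  simp only [childIndex]; omega

theorem childIndex_injective {n : ℕ} (m : Fin n → ℤ) : Function.Injective (childIndex m) := by
  intro e e' h
  funext i
  have := congrFun h i
  simp only [childIndex] at this
  exact Fin.ext (by omega)

theorem dyadicCube_childIndex_subset {n : ℕ} (k : ℤ) (m : Fin n → ℤ) (e : Fin n → Fin 2) :
    dyadicCube (k - 1) (childIndex m e) ⊆ dyadicCube k m := by
  have := dyadicCube_subset_dyadicParent (k - 1) (childIndex m e)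
  rwa [dyadicParent, childIndex_div_two, sub_add_cancel] at this

theorem cubeIndex_succ {n : ℕ} (k : ℤ) (x : Fin n → ℝ) :
    cubeIndex (k + 1) x = fun i => cubeIndex k x i / 2 :=
  mem_dyadicCube_iff.1 (dyadicCube_subset_dyadicParent k _ (mem_dyadicCube_cubeIndex k x))

theorem dyadicCube_eq_iUnion {n : ℕ} (k : ℤ) (m : Fin n → ℤ) :
    dyadicCube k m = ⋃ e, dyadicCube (k - 1) (childIndex m e) := by
  refine Set.Subset.antisymm (fun x hx => ?_)
    (Set.iUnion_subset fun e => dyadicCube_childIndex_subset k m e)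
  rw [mem_dyadicCube_iff] at hx
  have h := cubeIndex_succ (k - 1) x
  rw [sub_add_cancel, hx] at h
  rw [Set.mem_iUnion]
  refine ⟨fun i => ⟨(cubeIndex (k - 1) x i % 2).toNat, by omega⟩, ?_⟩
  rw [mem_dyadicCube_iff]
  funext i
  have := congrFun h i
  simp only [childIndex]
  omega

theorem pairwise_disjoint_dyadicCube {n : ℕ} (k : ℤ) :
    Pairwise (Function.onFun Disjoint (dyadicCube (n := n) k)) := by
  intro m m' h
  refine Set.disjoint_left.2 fun x hx hx' => h ?_
  rw [mem_dyadicCube_iff] at hx hx'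
  exact hx ▸ hx'

theorem pairwise_disjoint_children {n : ℕ} (k : ℤ) (m : Fin n → ℤ) :
    Pairwise (Function.onFun Disjoint fun e => dyadicCube (k - 1) (childIndex m e)) :=
  fun _ _ h => pairwise_disjoint_dyadicCube (k - 1) fun h' => h (childIndex_injective m h')

theorem setLIntegral_dyadicCube_eq_sum {n : ℕ} (μ : Measure (Fin n → ℝ)) (k : ℤ) (m : Fin n → ℤ)
    (F : (Fin n → ℝ) → ℝ≥0∞) :
    ∫⁻ x in dyadicCube k m, F x ∂μ = ∑ e, ∫⁻ x in dyadicCube (k - 1) (childIndex m e), F x ∂μ := by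
  rw [dyadicCube_eq_iUnion k m, lintegral_iUnion (fun e => measurableSet_dyadicCube _ _)
    (pairwise_disjoint_children k m), tsum_fintype]

theorem measure_dyadicCube_eq_sum {n : ℕ} (μ : Measure (Fin n → ℝ)) (k : ℤ) (m : Fin n → ℤ) :
    μ (dyadicCube k m) = ∑ e, μ (dyadicCube (k - 1) (childIndex m e)) := by
  simpa using setLIntegral_dyadicCube_eq_sum μ k m 1

theorem iUnion_dyadicCube {n : ℕ} (k : ℤ) : ⋃ m, dyadicCube (n := n) k m = Set.univ :=
  Set.eq_univ_of_forall fun x => Set.mem_iUnion.2 ⟨_, mem_dyadicCube_cubeIndex k x⟩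

theorem lintegral_eq_tsum_dyadicCube {n : ℕ} (μ : Measure (Fin n → ℝ)) (k : ℤ)
    (F : (Fin n → ℝ) → ℝ≥0∞) : ∫⁻ x, F x ∂μ = ∑' m, ∫⁻ x in dyadicCube k m, F x ∂μ := by
  rw [← lintegral_iUnion (fun m => measurableSet_dyadicCube _ _) (pairwise_disjoint_dyadicCube k),
    iUnion_dyadicCube, Measure.restrict_univ]

end SquareDyadic

namespace SquareDyadic

/-! ### Square sums of dyadic martingales and stopping -/

/-- A family of numbers indexed by the dyadic cubes, each the mean of its children. -/
def IsDyadicMartingale {n : ℕ} (a : ℤ → (Fin n → ℤ) → ℝ) : Prop :=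
  ∀ k m, ∑ e, a (k - 1) (childIndex m e) = 2 ^ n * a k m

/-- The square of the martingale difference at `x` from level `k` to level `k - 1`. -/
noncomputable def sqIncrement {n : ℕ} (a : ℤ → (Fin n → ℤ) → ℝ) (k : ℤ) (x : Fin n → ℝ) : ℝ :=
  (a (k - 1) (cubeIndex (k - 1) x) - a k (cubeIndex k x)) ^ 2

/-- The sum of the squares of the first `d` martingale differences below level `k`. -/
noncomputable def squareSum {n : ℕ} (a : ℤ → (Fin n → ℤ) → ℝ) : ℕ → ℤ → (Fin n → ℝ) → ℝ
  | 0, _, _ => 0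
  | d + 1, k, x => sqIncrement a k x + squareSum a d (k - 1) x

/-- Within `d` generations below level `k`, the majorant exceeds `L` or the square sum, started
at `s`, exceeds `Λ`. -/
def Stopped {n : ℕ} (a A : ℤ → (Fin n → ℤ) → ℝ) (L Λ : ℝ) : ℕ → ℤ → ℝ → (Fin n → ℝ) → Prop
  | 0, _, _, _ => False
  | d + 1, k, s, x => L < A (k - 1) (cubeIndex (k - 1) x) ∨ Λ < s + sqIncrement a k x ∨
      Stopped a A L Λ d (k - 1) (s + sqIncrement a k x) x

variable {n : ℕ} {a A : ℤ → (Fin n → ℤ) → ℝ}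

theorem sqIncrement_nonneg (k : ℤ) (x : Fin n → ℝ) : 0 ≤ sqIncrement a k x := sq_nonneg _

theorem squareSum_nonneg (d : ℕ) (k : ℤ) (x : Fin n → ℝ) : 0 ≤ squareSum a d k x := by
  induction d generalizing k with
  | zero => exact le_rfl
  | succ d ih => exact add_nonneg (sqIncrement_nonneg k x) (ih (k - 1))

theorem measurable_comp_cubeIndex {β : Type*} [MeasurableSpace β] (g : (Fin n → ℤ) → β) (k : ℤ) :
    Measurable fun x => g (cubeIndex k x) :=
  (measurable_of_countable g).comp (measurable_cubeIndex k)

theorem measurable_sqIncrement (k : ℤ) : Measurable (sqIncrement a k) :=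
  ((measurable_comp_cubeIndex (a (k - 1)) (k - 1)).sub
    (measurable_comp_cubeIndex (a k) k)).pow_const 2

theorem measurable_squareSum (d : ℕ) (k : ℤ) : Measurable (squareSum a d k) := by
  induction d generalizing k with
  | zero => exact measurable_const
  | succ d ih => exact (measurable_sqIncrement k).add (ih (k - 1))

theorem measurableSet_stopped (L Λ : ℝ) (d : ℕ) (k : ℤ) {s : (Fin n → ℝ) → ℝ} (hs : Measurable s) :
    MeasurableSet {x | Stopped a A L Λ d k (s x) x} := by
  induction d generalizing k s with
  | zero => exact MeasurableSet.empty
  | succ d ih =>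
    have hs' : Measurable fun x => s x + sqIncrement a k x := hs.add (measurable_sqIncrement k)
    exact (measurableSet_lt measurable_const (measurable_comp_cubeIndex (A (k - 1)) (k - 1))).union
      ((measurableSet_lt measurable_const hs').union (ih (k - 1) hs'))

theorem cubeIndex_of_mem_child {k : ℤ} {m : Fin n → ℤ} {e : Fin n → Fin 2} {x : Fin n → ℝ}
    (hx : x ∈ dyadicCube (k - 1) (childIndex m e)) :
    cubeIndex (k - 1) x = childIndex m e ∧ cubeIndex k x = m :=
  ⟨mem_dyadicCube_iff.1 hx, mem_dyadicCube_iff.1 (dyadicCube_childIndex_subset k m e hx)⟩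

theorem sqIncrement_of_mem_child {k : ℤ} {m : Fin n → ℤ} {e : Fin n → Fin 2} {x : Fin n → ℝ}
    (hx : x ∈ dyadicCube (k - 1) (childIndex m e)) :
    sqIncrement a k x = (a (k - 1) (childIndex m e) - a k m) ^ 2 := by
  obtain ⟨h1, h2⟩ := cubeIndex_of_mem_child hx
  rw [sqIncrement, h1, h2]

theorem volume_real_inter_eq_sum (k : ℤ) (m : Fin n → ℤ) (S : Set (Fin n → ℝ)) :
    volume.real (dyadicCube k m ∩ S) =
      ∑ e, volume.real (dyadicCube (k - 1) (childIndex m e) ∩ S) := by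
  have h := measure_dyadicCube_eq_sum (volume.restrict S) k m
  simp only [Measure.restrict_apply (measurableSet_dyadicCube _ _)] at h
  rw [Measure.real, h, ENNReal.toReal_sum]
  · rfl
  · exact fun e _ => measure_ne_top_of_subset Set.inter_subset_left (volume_dyadicCube_ne_top _ _)

/-- Each child carries at most the whole sum over its siblings. This limits the overshoot of the
majorant at a stopping step. -/
theorem IsDyadicMartingale.child_le (hA : IsDyadicMartingale A) (h0 : ∀ k m, 0 ≤ A k m)
    (k : ℤ) (m : Fin n → ℤ) (e : Fin n → Fin 2) :
    A (k - 1) (childIndex m e) ≤ 2 ^ n * A k m := by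
  rw [← hA k m]
  exact Finset.single_le_sum (f := fun e => A (k - 1) (childIndex m e)) (fun e _ => h0 _ _)
    (Finset.mem_univ e)

/-- The bookkeeping inequality behind the weak type estimate for the square function. -/
theorem volume_stopped_aux (ha : IsDyadicMartingale a) (hA : IsDyadicMartingale A)
    (haA : ∀ k m, |a k m| ≤ A k m) {L Λ : ℝ} (hL : 0 < L) (hΛ : 0 < Λ) (d : ℕ) :
    ∀ (k : ℤ) (m : Fin n → ℤ) (s : ℝ), A k m ≤ L → 0 ≤ s → s ≤ Λ →
      Λ * volume.real (dyadicCube k m ∩ {x | Stopped a A L Λ d k s x}) ≤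
        cubeVol n k * (s + (Λ / L ^ 2 + 2) * L * A k m - a k m ^ 2) := by
  have hsq : ∀ k m, A k m ≤ L → a k m ^ 2 ≤ L * A k m := by
    intro k m h
    have := haA k m
    rw [← sq_abs]
    nlinarith [abs_nonneg (a k m)]
  have hA0 : ∀ k m, 0 ≤ A k m := fun k m => (abs_nonneg _).trans (haA k m)
  have hC : Λ / L ^ 2 * L * L = Λ := by field_simp
  have hC0 : 0 ≤ Λ / L ^ 2 * L := by positivity
  -- The bracket on the right is a Bellman function: when `s` grows by the squared increments its
  -- mean over the children is unchanged. It is non-negative while `A ≤ L`, and whenever stopping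
  -- occurs its terms pay for `Λ`.
  induction d with
  | zero =>
    intro k m s h hs0 hsΛ
    simp only [Stopped, Set.ofPred_false, Set.inter_empty, measureReal_empty, mul_zero]
    refine mul_nonneg (cubeVol_pos n k).le ?_
    have h1 := hsq k m h
    have h2 := mul_nonneg hC0 (hA0 k m)
    have h3 := mul_nonneg hL.le (hA0 k m)
    nlinarith
  | succ d ih =>
    intro k m s h hs0 hsΛ
    -- Here `(c - a)² - c²` is expanded to `-2ca + a²`, linear in the child value `c`, so the
    -- martingale property turns its mean into `-a²`.
    have key : ∀ e : Fin n → Fin 2, Λ * volume.real (dyadicCube (k - 1) (childIndex m e) ∩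
        {x | Stopped a A L Λ (d + 1) k s x}) ≤ cubeVol n (k - 1) *
          (s + (Λ / L ^ 2 + 2) * L * A (k - 1) (childIndex m e)
            - 2 * a (k - 1) (childIndex m e) * a k m + a k m ^ 2) := by
      intro e
      set c := a (k - 1) (childIndex m e)
      set B := A (k - 1) (childIndex m e) with hB
      have hV := cubeVol_pos n (k - 1)
      have hcB : |c| ≤ B := haA _ _
      have hB0 : 0 ≤ B := hA0 _ _
      by_cases hbad : L < B ∨ Λ < s + (c - a k m) ^ 2
      · have h1 : volume.real (dyadicCube (k - 1) (childIndex m e) ∩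
            {x | Stopped a A L Λ (d + 1) k s x}) ≤ cubeVol n (k - 1) := by
          rw [← volume_real_dyadicCube (k - 1) (childIndex m e)]
          exact measureReal_mono Set.inter_subset_left (volume_dyadicCube_ne_top _ _)
        refine (mul_le_mul_of_nonneg_left h1 hΛ.le).trans ?_
        rw [mul_comm]
        refine mul_le_mul_of_nonneg_left ?_ hV.le
        -- If the majorant passes `L`, the term `(Λ/L) B` pays for `Λ` and `2LB` pays for the cross
        -- term `2ca`. Otherwise the running sum has passed `Λ`, and the surplus `c²` is at most
        -- `LB`.
        by_cases hLB : L < B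
        · have h2 : Λ ≤ Λ / L ^ 2 * L * B := by
            calc Λ = Λ / L ^ 2 * L * L := hC.symm
              _ ≤ _ := mul_le_mul_of_nonneg_left hLB.le hC0
          have h3 : c * a k m ≤ B * L := by
            calc c * a k m ≤ |c| * |a k m| := by rw [← abs_mul]; exact le_abs_self _
              _ ≤ B * L := mul_le_mul hcB ((haA k m).trans h) (abs_nonneg _) hB0
          nlinarith [sq_nonneg (a k m)]
        · have h2 := hbad.resolve_left hLB
          have h3 := hsq (k - 1) (childIndex m e) (not_lt.1 hLB)
          have h4 := mul_nonneg hC0 hB0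
          have h5 := mul_nonneg hL.le hB0
          have h3' : c ^ 2 ≤ L * B := h3
          nlinarith
      · push Not at hbad
        have h1 : dyadicCube (k - 1) (childIndex m e) ∩ {x | Stopped a A L Λ (d + 1) k s x} =
            dyadicCube (k - 1) (childIndex m e) ∩
              {x | Stopped a A L Λ d (k - 1) (s + (c - a k m) ^ 2) x} := by
          ext x
          refine and_congr_right fun hx => ?_
          simp only [Set.mem_ofPred_eq, Stopped, sqIncrement_of_mem_child hx,
            (cubeIndex_of_mem_child hx).1]
          simp only [← hB, not_lt.2 hbad.1, false_or]
          exact or_iff_right (not_lt.2 hbad.2)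
        rw [h1]
        refine (ih (k - 1) _ _ hbad.1 (by positivity) hbad.2).trans
          (mul_le_mul_of_nonneg_left (le_of_eq ?_) hV.le)
        ring
    rw [volume_real_inter_eq_sum, Finset.mul_sum]
    refine (Finset.sum_le_sum fun e _ => key e).trans (le_of_eq ?_)
    have e1 := ha k m
    have e2 := hA k m
    rw [← Finset.mul_sum, Finset.sum_add_distrib, Finset.sum_sub_distrib, Finset.sum_add_distrib,
      ← Finset.mul_sum, ← Finset.sum_mul, ← Finset.mul_sum, e1, e2, cubeVol_eq n k]
    simp
    ring

/-- The stopped part of a cube is at most half of the cube. -/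
theorem volume_stopped_le (ha : IsDyadicMartingale a) (hA : IsDyadicMartingale A)
    (haA : ∀ k m, |a k m| ≤ A k m) {k : ℤ} {m : Fin n → ℤ} (h : 0 < A k m) (d : ℕ) :
    volume.real (dyadicCube k m ∩ {x | Stopped a A (4 * A k m) (32 * A k m ^ 2) d k 0 x}) ≤
      cubeVol n k / 2 := by
  -- For these thresholds the coefficient is `(2 + 2) · 4 · A² = 16 A² = Λ/2`, hence the one half.
  have := volume_stopped_aux ha hA haA (L := 4 * A k m) (Λ := 32 * A k m ^ 2) (by positivity)
    (by positivity) d k m 0 (by linarith) le_rfl (by positivity)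
  have h2 : (32 * A k m ^ 2 / (4 * A k m) ^ 2 + 2) * (4 * A k m) * A k m = 16 * A k m ^ 2 := by
    field_simp; norm_num
  rw [h2] at this
  have hV := cubeVol_pos n k
  have h3 : cubeVol n k * (0 + 16 * A k m ^ 2 - a k m ^ 2) ≤ 32 * A k m ^ 2 * (cubeVol n k / 2) := by
    nlinarith [mul_nonneg hV.le (sq_nonneg (a k m))]
  exact le_of_mul_le_mul_left (this.trans h3) (by positivity)

end SquareDyadic

namespace SquareDyadic

/-! ### Sparse domination in integrated form -/

variable {n : ℕ} {a A : ℤ → (Fin n → ℤ) → ℝ}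

/-- A non-negative martingale vanishing on a cube vanishes on all its descendants. This is the
degenerate case in which the stopping thresholds would be zero. -/
theorem squareSum_eq_zero (hA : IsDyadicMartingale A) (haA : ∀ k m, |a k m| ≤ A k m) (d : ℕ) :
    ∀ (k : ℤ) (m : Fin n → ℤ), A k m = 0 → ∀ x ∈ dyadicCube k m, squareSum a d k x = 0 := by
  have hA0 : ∀ k m, 0 ≤ A k m := fun k m => (abs_nonneg _).trans (haA k m)
  have ha0 : ∀ k m, A k m = 0 → a k m = 0 := fun k m h =>
    abs_eq_zero.1 (le_antisymm (h ▸ haA k m) (abs_nonneg _))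
  induction d with
  | zero => intros; rfl
  | succ d ih =>
    intro k m h x hx
    rw [dyadicCube_eq_iUnion, Set.mem_iUnion] at hx
    obtain ⟨e, hx⟩ := hx
    have hc : A (k - 1) (childIndex m e) = 0 :=
      le_antisymm (by simpa [h] using hA.child_le hA0 k m e) (hA0 _ _)
    rw [squareSum, ih _ _ hc x hx, sqIncrement_of_mem_child hx, ha0 _ _ hc, ha0 _ _ h]
    norm_num

/-- The dimensional constant of the sparse domination. -/
noncomputable def domConst (n : ℕ) : ℝ := 32 + 16 * (2 ^ n + 1) ^ 2

theorem one_le_domConst (n : ℕ) : 1 ≤ domConst n := by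
  unfold domConst; nlinarith [sq_nonneg ((2 : ℝ) ^ n + 1)]

theorem ofReal_rpow_le_domConst {r t l : ℝ} (hr0 : 0 < r) (hr2 : r ≤ 2) (hl : 0 ≤ l)
    (h : t ≤ domConst n * l ^ 2) :
    ENNReal.ofReal t ^ (r / 2) ≤ ENNReal.ofReal (domConst n) * ENNReal.ofReal l ^ r := by
  have hC := one_le_domConst n
  calc ENNReal.ofReal t ^ (r / 2) ≤ ENNReal.ofReal (domConst n * l ^ 2) ^ (r / 2) := by gcongr
    _ = ENNReal.ofReal (domConst n) ^ (r / 2) * ENNReal.ofReal l ^ r := by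
        rw [ENNReal.ofReal_mul (by linarith), ENNReal.mul_rpow_of_nonneg _ _ (by positivity),
          ENNReal.ofReal_pow hl, ← ENNReal.rpow_natCast, ← ENNReal.rpow_mul]
        congr 2; push_cast; ring
    _ ≤ ENNReal.ofReal (domConst n) ^ (1 : ℝ) * ENNReal.ofReal l ^ r := by
        gcongr
        · rw [← ENNReal.ofReal_one]; exact ENNReal.ofReal_le_ofReal hC
        · linarith
    _ = _ := by rw [ENNReal.rpow_one]

variable {r : ℝ} {G H : (Fin n → ℝ) → ℝ≥0∞} {K : ℝ≥0∞}

/-- Until stopping, the accumulated sum costs only a multiple of `l²`. On a child where stopping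
occurs, the sum is split there and the remaining generations are handed to `hd`; these children make
up the stopped set, over which `H` is charged. -/
theorem lintegral_squareSum_stopped_le (hA : IsDyadicMartingale A)
    (haA : ∀ k m, |a k m| ≤ A k m) (hr0 : 0 < r) (hr2 : r ≤ 2) (hG : Measurable G)
    {l : ℝ} (hl : 0 < l) (d : ℕ)
    (hd : ∀ d' < d, ∀ k m, ∫⁻ x in dyadicCube k m, ENNReal.ofReal (squareSum a d' k x) ^ (r / 2) * G x
      ≤ ENNReal.ofReal (domConst n) * K * ∫⁻ x in dyadicCube k m, H x) :
    ∀ (k : ℤ) (m : Fin n → ℤ) (s : ℝ), A k m ≤ 4 * l → 0 ≤ s → s ≤ 32 * l ^ 2 →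
      ∫⁻ x in dyadicCube k m, ENNReal.ofReal (s + squareSum a d k x) ^ (r / 2) * G x ≤
        ENNReal.ofReal (domConst n) * ENNReal.ofReal l ^ r * (∫⁻ x in dyadicCube k m, G x) +
        ENNReal.ofReal (domConst n) * K *
          ∫⁻ x in dyadicCube k m ∩ {x | Stopped a A (4 * l) (32 * l ^ 2) d k s x}, H x := by
  have hA0 : ∀ k m, 0 ≤ A k m := fun k m => (abs_nonneg _).trans (haA k m)
  induction d with
  | zero =>
    intro k m s h hs0 hs
    simp only [squareSum, add_zero]
    rw [lintegral_const_mul _ hG]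
    refine le_add_right ?_
    gcongr
    refine ofReal_rpow_le_domConst hr0 hr2 hl.le (hs.trans ?_)
    unfold domConst
    nlinarith [mul_nonneg (sq_nonneg ((2 : ℝ) ^ n + 1)) (sq_nonneg l)]
  | succ d ih =>
    intro k m s h hs0 hs
    have ih' := ih fun d' hd' => hd d' (hd'.trans d.lt_succ_self)
    set S := {x | Stopped a A (4 * l) (32 * l ^ 2) (d + 1) k s x} with hS
    have hSm : MeasurableSet S := measurableSet_stopped _ _ (d + 1) k measurable_const
    have hsplit : ∫⁻ x in dyadicCube k m ∩ S, H x =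
        ∑ e, ∫⁻ x in dyadicCube (k - 1) (childIndex m e) ∩ S, H x := by
      have := setLIntegral_dyadicCube_eq_sum (volume.restrict S) k m H
      simpa only [Measure.restrict_restrict (measurableSet_dyadicCube _ _)] using this
    rw [hsplit, setLIntegral_dyadicCube_eq_sum _ k m, setLIntegral_dyadicCube_eq_sum _ k m G,
      Finset.mul_sum, Finset.mul_sum, ← Finset.sum_add_distrib]
    refine Finset.sum_le_sum fun e _ => ?_
    set c := a (k - 1) (childIndex m e) with hc
    set B := A (k - 1) (childIndex m e) with hB
    have hint : ∫⁻ x in dyadicCube (k - 1) (childIndex m e),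
          ENNReal.ofReal (s + squareSum a (d + 1) k x) ^ (r / 2) * G x =
        ∫⁻ x in dyadicCube (k - 1) (childIndex m e),
          ENNReal.ofReal (s + (c - a k m) ^ 2 + squareSum a d (k - 1) x) ^ (r / 2) * G x := by
      refine setLIntegral_congr_fun (measurableSet_dyadicCube _ _) fun x hx => ?_
      simp only [squareSum, sqIncrement_of_mem_child hx, add_assoc, hc]
    rw [hint]
    by_cases hbad : 4 * l < B ∨ 32 * l ^ 2 < s + (c - a k m) ^ 2
    · have hsub : dyadicCube (k - 1) (childIndex m e) ∩ S = dyadicCube (k - 1) (childIndex m e) := by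
        refine Set.inter_eq_left.2 fun x hx => ?_
        simp only [hS, Set.mem_ofPred_eq, Stopped, sqIncrement_of_mem_child hx,
          (cubeIndex_of_mem_child hx).1]
        exact hbad.elim Or.inl fun h => Or.inr (Or.inl h)
      rw [hsub]
      -- This fixes `domConst`: 32 for the sum before the stopping step, and `(4(2 ^ n + 1))²` for
      -- the last jump, since the child mean may be `2 ^ n` times that of its parent.
      have h1 : s + (c - a k m) ^ 2 ≤ domConst n * l ^ 2 := by
        have h2 : |c| ≤ 2 ^ n * (4 * l) :=
          (haA _ _).trans ((hA.child_le hA0 k m e).trans (by gcongr))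
        have h3 : |a k m| ≤ 4 * l := (haA _ _).trans h
        have h4 : |c - a k m| ≤ (2 ^ n + 1) * (4 * l) := (abs_sub _ _).trans (by linarith)
        have h5 : (c - a k m) ^ 2 ≤ ((2 ^ n + 1) * (4 * l)) ^ 2 := by
          rw [← sq_abs (c - a k m)]; gcongr
        unfold domConst; linarith
      calc _ ≤ ∫⁻ x in dyadicCube (k - 1) (childIndex m e),
            (ENNReal.ofReal (domConst n) * ENNReal.ofReal l ^ r * G x +
              ENNReal.ofReal (squareSum a d (k - 1) x) ^ (r / 2) * G x) := by
            refine lintegral_mono fun x => ?_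
            rw [← add_mul]
            gcongr
            rw [ENNReal.ofReal_add (by positivity) (squareSum_nonneg _ _ _)]
            -- Subadditivity of `t ^ (r / 2)`; this is where `r ≤ 2` is essential.
            refine (ENNReal.rpow_add_le_add_rpow _ _ (by positivity) (by linarith)).trans ?_
            gcongr
            exact ofReal_rpow_le_domConst hr0 hr2 hl.le h1
        _ = _ := by
            rw [lintegral_add_left (hG.const_mul _), lintegral_const_mul _ hG]
        _ ≤ _ := by gcongr; exact hd d d.lt_succ_self _ _
    · push Not at hbad
      have h1 : dyadicCube (k - 1) (childIndex m e) ∩ S = dyadicCube (k - 1) (childIndex m e) ∩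
          {x | Stopped a A (4 * l) (32 * l ^ 2) d (k - 1) (s + (c - a k m) ^ 2) x} := by
        ext x
        refine and_congr_right fun hx => ?_
        simp only [hS, Set.mem_ofPred_eq, Stopped, sqIncrement_of_mem_child hx,
          (cubeIndex_of_mem_child hx).1]
        simp only [← hB, not_lt.2 hbad.1, false_or]
        exact or_iff_right (not_lt.2 hbad.2)
      rw [h1]
      exact ih' (k - 1) _ _ hbad.1 (by positivity) hbad.2

/-- A weighted sparse estimate on cubes implies the corresponding estimate for the square sums. -/
theorem lintegral_squareSum_le (ha : IsDyadicMartingale a) (hA : IsDyadicMartingale A)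
    (haA : ∀ k m, |a k m| ≤ A k m) (hr0 : 0 < r) (hr2 : r ≤ 2) (hG : Measurable G)
    (hK : ∀ k m E, MeasurableSet E → E ⊆ dyadicCube k m → volume (dyadicCube k m) ≤ 2 * volume E →
      ENNReal.ofReal (A k m) ^ r * (∫⁻ x in dyadicCube k m, G x) ≤ K * ∫⁻ x in E, H x) (d : ℕ) :
    ∀ (k : ℤ) (m : Fin n → ℤ),
      ∫⁻ x in dyadicCube k m, ENNReal.ofReal (squareSum a d k x) ^ (r / 2) * G x ≤
        ENNReal.ofReal (domConst n) * K * ∫⁻ x in dyadicCube k m, H x := by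
  induction d using Nat.strong_induction_on with
  | _ d hd =>
  intro k m
  have hA0 : ∀ k m, 0 ≤ A k m := fun k m => (abs_nonneg _).trans (haA k m)
  rcases (hA0 k m).eq_or_lt with h0 | h0
  · rw [setLIntegral_congr_fun (g := 0) (measurableSet_dyadicCube k m)]
    · simp
    · intro x hx
      simp [squareSum_eq_zero hA haA d k m h0.symm x hx, hr0]
  · have h1 := lintegral_squareSum_stopped_le hA haA hr0 hr2 hG h0 d hd k m 0 (by linarith) le_rfl
      (by positivity)
    simp only [zero_add] at h1
    refine h1.trans ?_
    set S := {x | Stopped a A (4 * A k m) (32 * A k m ^ 2) d k 0 x}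
    have hS : MeasurableSet S := measurableSet_stopped _ _ d k measurable_const
    have hvol := volume_stopped_le ha hA haA h0 d
    have hE : volume (dyadicCube k m) ≤ 2 * volume (dyadicCube k m \ S) := by
      have hfin : volume (dyadicCube k m ∩ S) ≠ ∞ :=
        measure_ne_top_of_subset Set.inter_subset_left (volume_dyadicCube_ne_top _ _)
      have h2 : volume (dyadicCube k m ∩ S) ≤ volume (dyadicCube k m) / 2 := by
        rw [volume_dyadicCube, ← ENNReal.ofReal_toReal hfin, ← ENNReal.ofReal_ofNat,
          ← ENNReal.ofReal_div_of_pos (by norm_num)]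
        exact ENNReal.ofReal_le_ofReal hvol
      have h3 := measure_inter_add_sdiff (μ := volume) (dyadicCube k m) hS
      have h4 : volume (dyadicCube k m) / 2 ≤ volume (dyadicCube k m \ S) := by
        have h5 : volume (dyadicCube k m) / 2 + volume (dyadicCube k m) / 2 ≤
            volume (dyadicCube k m) / 2 + volume (dyadicCube k m \ S) := by
          rw [ENNReal.add_halves]; exact h3.symm.le.trans (by gcongr)
        exact (ENNReal.add_le_add_iff_left
          (ENNReal.div_ne_top (volume_dyadicCube_ne_top _ _) (by norm_num))).1 h5
      calc _ = 2 * (volume (dyadicCube k m) / 2) := by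
            rw [ENNReal.mul_div_cancel (by norm_num) (by norm_num)]
        _ ≤ _ := by gcongr
    -- The set `E` is the unstopped part, disjoint from the set charged by the restarts. The two
    -- integrals of `H` therefore add up to the one over the cube, and the constant does not grow
    -- with the depth.
    have h2 := hK k m _ ((measurableSet_dyadicCube k m).diff hS) Set.sdiff_subset hE
    rw [← lintegral_inter_add_sdiff H (dyadicCube k m) hS, mul_add, add_comm, mul_assoc, mul_assoc,
      mul_assoc]
    gcongr

end SquareDyadic

namespace SquareDyadic

/-! ### The dyadic maximal function -/

variable {n : ℕ}

/-- The mean of `φ` over a dyadic cube with respect to `μ`. -/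
noncomputable def dyadicAvg (μ : Measure (Fin n → ℝ)) (φ : (Fin n → ℝ) → ℝ≥0∞) (k : ℤ)
    (m : Fin n → ℤ) : ℝ≥0∞ :=
  (∫⁻ x in dyadicCube k m, φ x ∂μ) / μ (dyadicCube k m)

/-- The maximal function over the dyadic cubes at the levels `k, k - 1, …, k - d`. -/
noncomputable def truncMaximal (μ : Measure (Fin n → ℝ)) (φ : (Fin n → ℝ) → ℝ≥0∞) :
    ℕ → ℤ → (Fin n → ℝ) → ℝ≥0∞
  | 0, k, x => dyadicAvg μ φ k (cubeIndex k x)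
  | d + 1, k, x => max (dyadicAvg μ φ k (cubeIndex k x)) (truncMaximal μ φ d (k - 1) x)

/-- The dyadic maximal function with respect to `μ`. -/
noncomputable def dyadicMaximal (μ : Measure (Fin n → ℝ)) (φ : (Fin n → ℝ) → ℝ≥0∞)
    (x : Fin n → ℝ) : ℝ≥0∞ :=
  ⨆ k, dyadicAvg μ φ k (cubeIndex k x)

variable {μ : Measure (Fin n → ℝ)} {φ : (Fin n → ℝ) → ℝ≥0∞}

theorem dyadicAvg_le_truncMaximal (d : ℕ) (k : ℤ) (x : Fin n → ℝ) :
    dyadicAvg μ φ k (cubeIndex k x) ≤ truncMaximal μ φ d k x := by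
  cases d with
  | zero => exact le_rfl
  | succ d => exact le_max_left _ _

theorem truncMaximal_le_succ (d : ℕ) (k : ℤ) (x : Fin n → ℝ) :
    truncMaximal μ φ d k x ≤ truncMaximal μ φ (d + 1) k x := by
  induction d generalizing k with
  | zero => exact le_max_left _ _
  | succ d ih => exact max_le_max le_rfl (ih (k - 1))

theorem truncMaximal_pred_le (d : ℕ) (k : ℤ) (x : Fin n → ℝ) :
    truncMaximal μ φ d (k - 1) x ≤ truncMaximal μ φ (d + 1) k x := le_max_right _ _

/-- The window consists of the levels from `N` down to `-N` and grows at both ends. -/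
theorem monotone_truncMaximal (x : Fin n → ℝ) :
    Monotone fun N : ℕ => truncMaximal μ φ (2 * N) N x := by
  refine monotone_nat_of_le_succ fun N => ?_
  have h := (truncMaximal_le_succ (μ := μ) (φ := φ) (2 * N) N x).trans
    (by simpa using truncMaximal_pred_le (μ := μ) (φ := φ) (2 * N + 1) (N + 1) x)
  simpa [mul_add] using h

theorem dyadicAvg_sub_le_truncMaximal (j d : ℕ) (hj : j ≤ d) (k : ℤ) (x : Fin n → ℝ) :
    dyadicAvg μ φ (k - j) (cubeIndex (k - j) x) ≤ truncMaximal μ φ d k x := by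
  induction j generalizing d k with
  | zero => simpa using dyadicAvg_le_truncMaximal d k x
  | succ j ih =>
    obtain ⟨d, rfl⟩ : ∃ d', d = d' + 1 := ⟨d - 1, by omega⟩
    have := (ih d (by omega) (k - 1)).trans (truncMaximal_pred_le d k x)
    rwa [show k - 1 - (j : ℤ) = k - ((j + 1 : ℕ) : ℤ) by push_cast; ring] at this

theorem dyadicMaximal_le_iSup (x : Fin n → ℝ) :
    dyadicMaximal μ φ x ≤ ⨆ N : ℕ, truncMaximal μ φ (2 * N) N x := by
  refine iSup_le fun k => le_iSup_of_le k.natAbs ?_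
  have := dyadicAvg_sub_le_truncMaximal (μ := μ) (φ := φ) (k.natAbs - k).toNat (2 * k.natAbs)
    (by omega) k.natAbs x
  rwa [show (k.natAbs : ℤ) - ((k.natAbs - k).toNat : ℤ) = k by omega] at this

theorem measurable_truncMaximal (d : ℕ) (k : ℤ) : Measurable (truncMaximal μ φ d k) := by
  induction d generalizing k with
  | zero => exact measurable_comp_cubeIndex (dyadicAvg μ φ k) k
  | succ d ih => exact (measurable_comp_cubeIndex (dyadicAvg μ φ k) k).max (ih (k - 1))

theorem measurable_dyadicMaximal : Measurable (dyadicMaximal μ φ) :=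
  .iSup fun k => measurable_comp_cubeIndex (dyadicAvg μ φ k) k

theorem dyadicAvg_mul_measure (hμ : ∀ k m, μ (dyadicCube k m) ≠ ∞) (k : ℤ) (m : Fin n → ℤ) :
    dyadicAvg μ φ k m * μ (dyadicCube k m) = ∫⁻ x in dyadicCube k m, φ x ∂μ := by
  refine ENNReal.div_mul_cancel' (fun h => ?_) fun h => absurd h (hμ k m)
  rw [Measure.restrict_eq_zero.2 h, lintegral_zero_measure]

theorem dyadicAvg_le_dyadicMaximal {k : ℤ} {m : Fin n → ℤ} {x : Fin n → ℝ}
    (hx : x ∈ dyadicCube k m) : dyadicAvg μ φ k m ≤ dyadicMaximal μ φ x := by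
  rw [← mem_dyadicCube_iff.1 hx]
  exact le_iSup (fun k => dyadicAvg μ φ k (cubeIndex k x)) k

variable {q q' : ℝ}

theorem young_rpow_sub_one (hq : q.HolderConjugate q') (t x : ℝ≥0∞) :
    t ^ (q - 1) * x ≤ t ^ q / ENNReal.ofReal q' + x ^ q / ENNReal.ofReal q := by
  have := ENNReal.young_inequality (t ^ (q - 1)) x hq.symm
  rwa [← ENNReal.rpow_mul, hq.sub_one_mul_conj] at this

/-- Young's inequality together with `1 + q'/q = q'`. It measures the effect of raising the running
maximum from `t` to `x` in the Bellman induction. -/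
theorem add_mul_rpow_le (hq : q.HolderConjugate q') (t x : ℝ≥0∞) :
    x ^ q + ENNReal.ofReal q' * t ^ (q - 1) * x ≤
      t ^ q + ENNReal.ofReal q' * x ^ (q - 1) * x := by
  have hq0 := hq.pos
  have hq0' := hq.symm.pos
  have h1 : x ^ (q - 1) * x = x ^ q := by
    conv_lhs => rw [← ENNReal.rpow_one x, ← ENNReal.rpow_mul, one_mul,
      ← ENNReal.rpow_add_of_nonneg _ _ (by linarith [hq.lt]) zero_le_one]
    congr 1; ring
  have h2 : 1 + ENNReal.ofReal q' / ENNReal.ofReal q = ENNReal.ofReal q' := by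
    rw [← ENNReal.ofReal_div_of_pos hq0, ← ENNReal.ofReal_one,
      ← ENNReal.ofReal_add zero_le_one (by positivity)]
    congr 1
    have := hq.mul_eq_add
    field_simp
    linarith
  rw [mul_assoc, mul_assoc, h1]
  calc _ ≤ x ^ q + ENNReal.ofReal q' * (t ^ q / ENNReal.ofReal q' + x ^ q / ENNReal.ofReal q) := by
        gcongr; exact young_rpow_sub_one hq t x
    _ = t ^ q + (1 + ENNReal.ofReal q' / ENNReal.ofReal q) * x ^ q := by
        rw [mul_add, ENNReal.mul_div_cancel (by simpa using hq0') ENNReal.ofReal_ne_top, add_mul,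
          one_mul, ENNReal.mul_comm_div, add_left_comm]
    _ = _ := by rw [h2]

/-- The Bellman type inequality behind the maximal inequality. -/
theorem lintegral_truncMaximal_aux (hq : q.HolderConjugate q')
    (hμ : ∀ k m, μ (dyadicCube k m) ≠ ∞) (hφ : Measurable φ)
    (hint : ∀ k m, ∫⁻ x in dyadicCube k m, φ x ∂μ ≠ ∞) (d : ℕ) :
    ∀ (k : ℤ) (m : Fin n → ℤ) (t : ℝ≥0∞), t ≠ ∞ → dyadicAvg μ φ k m ≤ t →
      (∫⁻ x in dyadicCube k m, max t (truncMaximal μ φ d k x) ^ q ∂μ) / ENNReal.ofReal q +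
        ENNReal.ofReal q' * t ^ (q - 1) * (∫⁻ x in dyadicCube k m, φ x ∂μ) ≤
      (∫⁻ x in dyadicCube k m, (ENNReal.ofReal q' * φ x) ^ q ∂μ) / ENNReal.ofReal q +
        t ^ q * μ (dyadicCube k m) := by
  have hq0 := hq.pos
  have hq0' := hq.symm.pos
  have hq1 : 0 ≤ q - 1 := by linarith [hq.lt]
  induction d with
  | zero =>
    intro k m t ht hle
    have h1 : ∫⁻ x in dyadicCube k m, max t (truncMaximal μ φ 0 k x) ^ q ∂μ =
        ∫⁻ x in dyadicCube k m, t ^ q ∂μ := by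
      refine setLIntegral_congr_fun (measurableSet_dyadicCube k m) fun x hx => ?_
      simp only [truncMaximal, mem_dyadicCube_iff.1 hx, max_eq_left hle]
    rw [h1, setLIntegral_const, ← lintegral_const_mul _ hφ, div_eq_mul_inv, mul_right_comm,
      ← setLIntegral_const, ← setLIntegral_const, ← lintegral_add_left measurable_const,
      div_eq_mul_inv, ← lintegral_mul_const _ (by fun_prop), ← lintegral_add_right _ measurable_const]
    refine lintegral_mono fun x => ?_
    have h2 := young_rpow_sub_one hq t (ENNReal.ofReal q' * φ x)
    have h3 : t ^ q / ENNReal.ofReal q + t ^ q / ENNReal.ofReal q' = t ^ q := by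
      rw [div_eq_mul_inv, div_eq_mul_inv, ← mul_add, hq.inv_add_inv_ennreal, mul_one]
    calc _ = t ^ q / ENNReal.ofReal q + t ^ (q - 1) * (ENNReal.ofReal q' * φ x) := by
          rw [div_eq_mul_inv]; ring
      _ ≤ t ^ q / ENNReal.ofReal q + (t ^ q / ENNReal.ofReal q' +
            (ENNReal.ofReal q' * φ x) ^ q / ENNReal.ofReal q) := by gcongr
      _ = _ := by rw [← add_assoc, h3, add_comm, div_eq_mul_inv]
  | succ d ih =>
    intro k m t ht hle
    rw [setLIntegral_dyadicCube_eq_sum μ k m, setLIntegral_dyadicCube_eq_sum μ k m φ,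
      setLIntegral_dyadicCube_eq_sum μ k m, measure_dyadicCube_eq_sum μ k m, Finset.mul_sum,
      Finset.mul_sum, div_eq_mul_inv, div_eq_mul_inv, Finset.sum_mul, Finset.sum_mul,
      ← Finset.sum_add_distrib, ← Finset.sum_add_distrib]
    refine Finset.sum_le_sum fun e _ => ?_
    set c := dyadicCube (k - 1) (childIndex m e) with hc
    set y := dyadicAvg μ φ (k - 1) (childIndex m e) with hy
    have hyc : y * μ c = ∫⁻ x in c, φ x ∂μ := dyadicAvg_mul_measure hμ _ _
    rcases eq_or_ne (μ c) 0 with h0 | h0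
    · have : μ.restrict c = 0 := Measure.restrict_eq_zero.2 h0
      simp [this]
    have hyt : y ≠ ∞ := by
      rw [hy, dyadicAvg]
      exact ENNReal.div_ne_top (hint _ _) h0
    have h1 : ∫⁻ x in c, max t (truncMaximal μ φ (d + 1) k x) ^ q ∂μ =
        ∫⁻ x in c, max (max t y) (truncMaximal μ φ d (k - 1) x) ^ q ∂μ := by
      refine setLIntegral_congr_fun (measurableSet_dyadicCube _ _) fun x hx => ?_
      obtain ⟨e1, e2⟩ := cubeIndex_of_mem_child hx
      have h2 := dyadicAvg_le_truncMaximal (μ := μ) (φ := φ) d (k - 1) x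
      rw [e1] at h2
      simp only [truncMaximal, e2]
      rw [← max_assoc, max_eq_left hle, max_assoc, max_eq_right h2]
    rw [h1]
    have hI := ih (k - 1) (childIndex m e) (max t y) (by simp [ht, hyt]) (le_max_right _ _)
    -- If the child's mean `y` exceeds the running maximum `t`, the maximum is updated before the
    -- induction hypothesis is applied; the terms in `t` are exchanged for terms in `y`, at no loss.
    have h2 : max t y ^ q * μ c + ENNReal.ofReal q' * t ^ (q - 1) * ∫⁻ x in c, φ x ∂μ ≤
        t ^ q * μ c + ENNReal.ofReal q' * max t y ^ (q - 1) * ∫⁻ x in c, φ x ∂μ := by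
      rcases le_total y t with h | h
      · rw [max_eq_left h]
      · rw [max_eq_right h, ← hyc, ← mul_assoc, ← mul_assoc, ← add_mul, ← add_mul]
        exact mul_le_mul' (add_mul_rpow_le hq t y) le_rfl
    -- The inequality is proved with this term added to both sides and then cancelled, which in
    -- `ℝ≥0∞` requires finiteness.
    have hfin : ENNReal.ofReal q' * max t y ^ (q - 1) * ∫⁻ x in c, φ x ∂μ ≠ ∞ :=
      ENNReal.mul_ne_top (ENNReal.mul_ne_top ENNReal.ofReal_ne_top
        (ENNReal.rpow_ne_top_of_nonneg hq1 (by simp [ht, hyt]))) (hint _ _)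
    refine (ENNReal.add_le_add_iff_right hfin).1 ?_
    rw [div_eq_mul_inv, div_eq_mul_inv] at hI
    calc _ = ((∫⁻ x in c, max (max t y) (truncMaximal μ φ d (k - 1) x) ^ q ∂μ) *
            (ENNReal.ofReal q)⁻¹ + ENNReal.ofReal q' * max t y ^ (q - 1) * ∫⁻ x in c, φ x ∂μ) +
            ENNReal.ofReal q' * t ^ (q - 1) * ∫⁻ x in c, φ x ∂μ := by rw [add_right_comm]
      _ ≤ _ := add_le_add_left hI _
      _ ≤ _ := by
        rw [add_assoc, add_assoc]
        exact add_le_add_right h2 _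

theorem lintegral_truncMaximal_rpow_le (hq : q.HolderConjugate q')
    (hμ : ∀ k m, μ (dyadicCube k m) ≠ ∞) (hφ : Measurable φ)
    (hint : ∀ k m, ∫⁻ x in dyadicCube k m, φ x ∂μ ≠ ∞) (d : ℕ) (k : ℤ) :
    ∫⁻ x, truncMaximal μ φ d k x ^ q ∂μ ≤ ENNReal.ofReal q' ^ q * ∫⁻ x, φ x ^ q ∂μ := by
  have hq0 := hq.pos
  have hq1 : 0 ≤ q - 1 := by linarith [hq.lt]
  rw [← lintegral_const_mul _ (by fun_prop), lintegral_eq_tsum_dyadicCube μ k,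
    lintegral_eq_tsum_dyadicCube μ k fun x => _ * _]
  refine ENNReal.tsum_le_tsum fun m => ?_
  rcases eq_or_ne (μ (dyadicCube k m)) 0 with h0 | h0
  · simp [Measure.restrict_eq_zero.2 h0]
  set y := dyadicAvg μ φ k m with hy
  have hyt : y ≠ ∞ := ENNReal.div_ne_top (hint _ _) h0
  have h := lintegral_truncMaximal_aux hq hμ hφ hint d k m y hyt le_rfl
  have hyc : y * μ (dyadicCube k m) = ∫⁻ x in dyadicCube k m, φ x ∂μ := dyadicAvg_mul_measure hμ _ _
  -- Starting with `t` equal to the mean of the top cube, the two extra terms compare favourably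
  -- because `q' ≥ 1`, and they drop out.
  have h1 : y ^ q * μ (dyadicCube k m) ≤
      ENNReal.ofReal q' * y ^ (q - 1) * ∫⁻ x in dyadicCube k m, φ x ∂μ := by
    have h2 : y ^ q = y ^ (q - 1) * y := by
      conv_rhs => rw [← ENNReal.rpow_one y, ← ENNReal.rpow_mul, one_mul,
        ← ENNReal.rpow_add_of_nonneg _ _ hq1 zero_le_one]
      congr 1; ring
    rw [← hyc, h2, mul_assoc, mul_assoc]
    refine le_mul_of_one_le_left zero_le ?_
    rw [← ENNReal.ofReal_one]
    exact ENNReal.ofReal_le_ofReal hq.symm.lt.le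
  have hfin : ENNReal.ofReal q' * y ^ (q - 1) * ∫⁻ x in dyadicCube k m, φ x ∂μ ≠ ∞ :=
    ENNReal.mul_ne_top (ENNReal.mul_ne_top ENNReal.ofReal_ne_top
      (ENNReal.rpow_ne_top_of_nonneg hq1 hyt)) (hint _ _)
  have h3 := (ENNReal.add_le_add_iff_right hfin).1 (h.trans (add_le_add_right h1 _))
  have h4 := (ENNReal.div_le_iff (by simpa using hq0) ENNReal.ofReal_ne_top).1 h3
  rw [ENNReal.div_mul_cancel (by simpa using hq0) ENNReal.ofReal_ne_top] at h4
  calc _ ≤ _ := lintegral_mono fun x => by gcongr; exact le_max_right _ _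
    _ ≤ _ := h4
    _ = _ := by simp only [ENNReal.mul_rpow_of_nonneg _ _ hq0.le]

/-- The dyadic maximal inequality with the sharp constant. -/
theorem lintegral_dyadicMaximal_rpow_le (hq : q.HolderConjugate q')
    (hμ : ∀ k m, μ (dyadicCube k m) ≠ ∞) (hφ : Measurable φ) :
    ∫⁻ x, dyadicMaximal μ φ x ^ q ∂μ ≤ ENNReal.ofReal q' ^ q * ∫⁻ x, φ x ^ q ∂μ := by
  have hq0 := hq.pos
  rcases eq_or_ne (∫⁻ x, φ x ^ q ∂μ) ∞ with htop | htop
  · rw [htop, ENNReal.mul_top]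
    · exact le_top
    · simpa [ENNReal.rpow_eq_zero_iff, hq0, hq0.not_gt] using hq.symm.pos
  -- Integrability on cubes follows from `φ ≤ 1 + φ ^ q`.
  have hint : ∀ k m, ∫⁻ x in dyadicCube k m, φ x ∂μ ≠ ∞ := by
    intro k m
    refine ne_top_of_le_ne_top (ENNReal.add_ne_top.2 ⟨hμ k m, htop⟩) ?_
    calc _ ≤ ∫⁻ x in dyadicCube k m, (1 + φ x ^ q) ∂μ := by
          refine lintegral_mono fun x => ?_
          rcases le_total (φ x) 1 with h | h
          · exact le_add_right h
          · refine le_add_left ?_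
            conv_lhs => rw [← ENNReal.rpow_one (φ x)]
            exact ENNReal.rpow_le_rpow_of_exponent_le h hq.lt.le
      _ = μ (dyadicCube k m) + ∫⁻ x in dyadicCube k m, φ x ^ q ∂μ := by
          rw [lintegral_add_left measurable_const]; simp
      _ ≤ _ := by gcongr; exact Measure.restrict_le_self
  calc _ ≤ ∫⁻ x, ⨆ N : ℕ, truncMaximal μ φ (2 * N) N x ^ q ∂μ := by
        refine lintegral_mono fun x => ?_
        exact (ENNReal.rpow_le_rpow (dyadicMaximal_le_iSup x) hq0.le).trans_eq
          ((ENNReal.orderIsoRpow q hq0).map_iSup _)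
    _ = ⨆ N : ℕ, ∫⁻ x, truncMaximal μ φ (2 * N) N x ^ q ∂μ :=
        lintegral_iSup (fun N => (measurable_truncMaximal _ _).pow_const q)
          fun M N h x => ENNReal.rpow_le_rpow (monotone_truncMaximal x h) hq0.le
    _ ≤ _ := iSup_le fun N => lintegral_truncMaximal_rpow_le hq hμ hφ hint _ _

end SquareDyadic

namespace SquareDyadic

/-! ### The dyadic square function as a limit of square sums -/

variable {n : ℕ}

/-- The mean of `f` over a dyadic cube. -/
noncomputable def cubeMean (f : (Fin n → ℝ) → ℝ) (k : ℤ) (m : Fin n → ℤ) : ℝ :=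
  ⨍ y in dyadicCube k m, f y

theorem cubeMean_eq (f : (Fin n → ℝ) → ℝ) (k : ℤ) (m : Fin n → ℤ) :
    cubeMean f k m = (cubeVol n k)⁻¹ * ∫ y in dyadicCube k m, f y := by
  rw [cubeMean, setAverage_eq, volume_real_dyadicCube, smul_eq_mul]

theorem isDyadicMartingale_cubeMean {f : (Fin n → ℝ) → ℝ}
    (hf : ∀ k m, IntegrableOn f (dyadicCube k m)) : IsDyadicMartingale (cubeMean f) := by
  intro k m
  have h : ∫ y in dyadicCube k m, f y = ∑ e, ∫ y in dyadicCube (k - 1) (childIndex m e), f y := by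
    rw [dyadicCube_eq_iUnion k m, integral_iUnion_fintype (fun e => measurableSet_dyadicCube _ _)
      (pairwise_disjoint_children k m) fun e => hf _ _]
  have h1 := (cubeVol_pos n (k - 1)).ne'
  simp only [cubeMean_eq]
  rw [← Finset.mul_sum, ← h, cubeVol_eq n k]
  field_simp

theorem abs_cubeMean_le (f : (Fin n → ℝ) → ℝ) (k : ℤ) (m : Fin n → ℤ) :
    |cubeMean f k m| ≤ cubeMean (fun x => |f x|) k m := by
  rw [cubeMean_eq, cubeMean_eq, abs_mul, abs_of_pos (inv_pos.2 (cubeVol_pos n k))]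
  exact mul_le_mul_of_nonneg_left (abs_integral_le_integral_abs) (inv_pos.2 (cubeVol_pos n k)).le

/-- Exactly one cube of each level contains `x`. The shift by one arises because the definition
indexes a difference by the child, while `sqIncrement` indexes it by the parent. -/
theorem dyadicSquare_eq_tsum (f : (Fin n → ℝ) → ℝ) (x : Fin n → ℝ) :
    dyadicSquare f x = (∑' k : ℤ, ENNReal.ofReal (sqIncrement (cubeMean f) k x)) ^ (1 / 2 : ℝ) := by
  rw [dyadicSquare, ENNReal.tsum_prod', ← (Equiv.addRight (1 : ℤ)).tsum_eq fun k =>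
    ENNReal.ofReal (sqIncrement (cubeMean f) k x)]
  congr 2
  funext k
  rw [tsum_eq_single (cubeIndex k x)]
  · rw [Set.indicator_of_mem (mem_dyadicCube_cubeIndex k x), Equiv.coe_addRight, sqIncrement,
      add_sub_cancel_right, dyadicParent, ← cubeIndex_succ]
    rfl
  · intro m hm
    exact Set.indicator_of_notMem (fun h => hm (mem_dyadicCube_iff.1 h).symm) _

theorem sum_sqIncrement (a : ℤ → (Fin n → ℤ) → ℝ) (x : Fin n → ℝ) (d : ℕ) (k : ℤ) :
    ∑ j ∈ Finset.Ioc (k - d) k, ENNReal.ofReal (sqIncrement a j x) =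
      ENNReal.ofReal (squareSum a d k x) := by
  induction d generalizing k with
  | zero => simp [squareSum]
  | succ d ih =>
    have : Finset.Ioc (k - (d + 1 : ℕ)) k = insert k (Finset.Ioc (k - 1 - d) (k - 1)) := by
      ext j; simp only [Finset.mem_Ioc, Finset.mem_insert]; push_cast; omega
    rw [this, Finset.sum_insert (by simp), ih, squareSum,
      ENNReal.ofReal_add (sqIncrement_nonneg k x) (squareSum_nonneg _ _ _)]

theorem squareSum_two_mul_eq_sum (a : ℤ → (Fin n → ℤ) → ℝ) (x : Fin n → ℝ) (N : ℕ) :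
    ENNReal.ofReal (squareSum a (2 * N) N x) =
      ∑ j ∈ Finset.Ioc (-(N : ℤ)) N, ENNReal.ofReal (sqIncrement a j x) := by
  rw [← sum_sqIncrement]
  congr 2
  push_cast; ring

theorem monotone_squareSum (a : ℤ → (Fin n → ℤ) → ℝ) (x : Fin n → ℝ) :
    Monotone fun N : ℕ => ENNReal.ofReal (squareSum a (2 * N) N x) := by
  intro M N h
  simp only [squareSum_two_mul_eq_sum]
  exact Finset.sum_le_sum_of_subset (Finset.Ioc_subset_Ioc (by omega) (by omega))

theorem tsum_sqIncrement (a : ℤ → (Fin n → ℤ) → ℝ) (x : Fin n → ℝ) :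
    ∑' k, ENNReal.ofReal (sqIncrement a k x) =
      ⨆ N : ℕ, ENNReal.ofReal (squareSum a (2 * N) N x) := by
  simp only [squareSum_two_mul_eq_sum]
  refine ENNReal.tsum_eq_iSup_sum' (fun N : ℕ => Finset.Ioc (-(N : ℤ)) N) fun t =>
    ⟨(∑ j ∈ t, j.natAbs) + 1, fun j hj => ?_⟩
  have := Finset.single_le_sum (f := fun j : ℤ => j.natAbs) (fun _ _ => Nat.zero_le _) hj
  simp only [Finset.mem_Ioc] at this ⊢
  omega

theorem dyadicSquare_rpow (f : (Fin n → ℝ) → ℝ) {p : ℝ} (hp : 0 < p) (x : Fin n → ℝ) :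
    dyadicSquare f x ^ p =
      ⨆ N : ℕ, ENNReal.ofReal (squareSum (cubeMean f) (2 * N) N x) ^ (p / 2) := by
  rw [dyadicSquare_eq_tsum, ← ENNReal.rpow_mul, tsum_sqIncrement, one_div_mul_eq_div]
  exact (ENNReal.orderIsoRpow (p / 2) (by positivity)).map_iSup _

theorem lintegral_dyadicSquare_rpow (f : (Fin n → ℝ) → ℝ) {p : ℝ} (hp : 0 < p)
    (μ : Measure (Fin n → ℝ)) :
    ∫⁻ x, dyadicSquare f x ^ p ∂μ =
      ⨆ N : ℕ, ∫⁻ x, ENNReal.ofReal (squareSum (cubeMean f) (2 * N) N x) ^ (p / 2) ∂μ := by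
  simp only [dyadicSquare_rpow f hp]
  refine lintegral_iSup (fun N => ?_) fun M N h x => ?_
  · exact (measurable_squareSum _ _).ennreal_ofReal.pow_const _
  · exact ENNReal.rpow_le_rpow (monotone_squareSum _ x h) (by positivity)

/-- Finitely many generations below a cube involve finitely many values. This supplies the a priori
finiteness needed to absorb a term into the left-hand side. -/
theorem exists_squareSum_le (a : ℤ → (Fin n → ℤ) → ℝ) (d : ℕ) :
    ∀ (k : ℤ) (m : Fin n → ℤ), ∃ C, ∀ x ∈ dyadicCube k m, squareSum a d k x ≤ C := by
  induction d with
  | zero => exact fun k m => ⟨0, fun x _ => le_rfl⟩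
  | succ d ih =>
    intro k m
    choose C hC using fun e => ih (k - 1) (childIndex m e)
    refine ⟨∑ e, |(a (k - 1) (childIndex m e) - a k m) ^ 2 + C e|, fun x hx => ?_⟩
    rw [dyadicCube_eq_iUnion, Set.mem_iUnion] at hx
    obtain ⟨e, hx⟩ := hx
    rw [squareSum, sqIncrement_of_mem_child hx]
    calc _ ≤ |(a (k - 1) (childIndex m e) - a k m) ^ 2 + C e| :=
          (add_le_add_right (hC e x hx) _).trans (le_abs_self _)
      _ ≤ _ := Finset.single_le_sum (f := fun e => |(a (k - 1) (childIndex m e) - a k m) ^ 2 + C e|)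
          (fun _ _ => abs_nonneg _) (Finset.mem_univ e)

/-! ### The two weight estimate under a testing condition -/

theorem rpow_mul_rpow_le_add {s s' : ℝ} (hs : s.HolderConjugate s') (b c : ℝ≥0∞) :
    b ^ (1 / s) * c ^ (1 / s') ≤ b + c := by
  have h1 := hs.pos
  have h2 := hs.symm.pos
  calc b ^ (1 / s) * c ^ (1 / s') ≤ (b + c) ^ (1 / s) * (b + c) ^ (1 / s') := by
        gcongr
        · exact le_self_add
        · exact le_add_self
    _ = b + c := by
        rw [← ENNReal.rpow_add_of_nonneg _ _ (by positivity) (by positivity), one_div, one_div,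
          hs.inv_add_inv_eq_one, ENNReal.rpow_one]

/-- The scale `l` is chosen so that the term in `Z` on the right equals half of the left-hand side.
It is then absorbed, which is legitimate as `Z` is finite. -/
theorem le_of_forall_scaled_le {s s' : ℝ} (hs : s.HolderConjugate s') {Z K D B : ℝ≥0∞}
    (hZ : Z ≠ ∞) (hK0 : K ≠ 0) (hK : K ≠ ∞) (hD0 : D ≠ 0) (hD : D ≠ ∞)
    (h : ∀ l : ℝ≥0∞, l ≠ 0 → l ≠ ∞ → l * Z ≤ K * (B + D ^ s' * l ^ s' * Z)) :
    Z ≤ (2 * K * D) ^ s * B := by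
  have h1 := hs.pos
  have h2 := hs.symm.pos
  have hs1 : 0 < s - 1 := by linarith [hs.lt]
  set b := 2 * K * D ^ s' with hb
  have hDs0 : D ^ s' ≠ 0 := by simp [ENNReal.rpow_eq_zero_iff, hD0, hD]
  have hDs : D ^ s' ≠ ∞ := ENNReal.rpow_ne_top_of_nonneg h2.le hD
  have hb0 : b ≠ 0 := by simp [hb, hK0, hDs0]
  have hbt : b ≠ ∞ := ENNReal.mul_ne_top (ENNReal.mul_ne_top (by simp) hK) hDs
  -- This solves `K D^{s'} l^{s'} = l/2`, because `(s - 1)(s' - 1) = 1`.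
  set l := b ^ (-(s - 1)) with hl
  have hl0 : l ≠ 0 := by simp [hl, ENNReal.rpow_eq_zero_iff, hb0, hbt]
  have hlt : l ≠ ∞ := by simp [hl, ENNReal.rpow_eq_top_iff, hb0, hbt]
  have hls : l ^ s' = l * b⁻¹ := by
    have e1 : -(s - 1) * s' = -(s - 1) + -1 := by
      have := hs.sub_one_mul_conj
      linarith
    rw [hl, ← ENNReal.rpow_mul, e1, ENNReal.rpow_add _ _ hb0 hbt, ENNReal.rpow_neg_one]
  have h3 := h l hl0 hlt
  have h4 : K * (B + D ^ s' * l ^ s' * Z) = K * B + l * Z / 2 := by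
    have e2 : K * D ^ s' * b⁻¹ = 2⁻¹ := by
      rw [hb, mul_assoc 2, ENNReal.mul_inv (by simp) (by simp), mul_left_comm,
        ENNReal.mul_inv_cancel (by simp [hK0, hDs0]) (ENNReal.mul_ne_top hK hDs), mul_one]
    rw [hls, mul_add]
    congr 1
    calc _ = (K * D ^ s' * b⁻¹) * (l * Z) := by ring
      _ = _ := by rw [e2, div_eq_mul_inv, mul_comm]
  rw [h4] at h3
  have hlZ : l * Z / 2 ≠ ∞ := ENNReal.div_ne_top (ENNReal.mul_ne_top hlt hZ) (by simp)
  have h5 : l * Z / 2 ≤ K * B := by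
    refine (ENNReal.add_le_add_iff_right hlZ).1 ?_
    rwa [ENNReal.add_halves]
  have h6 : l * Z ≤ 2 * K * B := by
    rw [ENNReal.div_le_iff (by simp) (by simp)] at h5
    calc _ ≤ _ := h5
      _ = _ := by ring
  calc Z = l⁻¹ * (l * Z) := by rw [← mul_assoc, ENNReal.inv_mul_cancel hl0 hlt, one_mul]
    _ ≤ l⁻¹ * (2 * K * B) := by gcongr
    _ = _ := by
      have e3 : l⁻¹ = (2 * K) ^ (s - 1) * D ^ s := by
        rw [hl, ENNReal.rpow_neg, inv_inv, hb, ENNReal.mul_rpow_of_nonneg _ _ hs1.le,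
          ← ENNReal.rpow_mul, mul_comm s', hs.sub_one_mul_conj]
      have e4 : (2 * K) ^ s = (2 * K) ^ (s - 1) * (2 * K) := by
        conv_rhs => rw [← ENNReal.rpow_one (2 * K), ← ENNReal.rpow_mul, one_mul,
          ← ENNReal.rpow_add_of_nonneg _ _ hs1.le zero_le_one, sub_add_cancel]
      rw [e3, ENNReal.mul_rpow_of_nonneg _ _ h1.le, e4]
      ring

end SquareDyadic

/-! ### From the testing condition to the two weight estimate -/

namespace SquareDyadic

variable {n : ℕ}

/-- The testing estimate on a cube in terms of the dyadic maximal functions. -/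
theorem cubeMean_rpow_mul_le {p r s s' : ℝ} (hr : 0 < r) (hp : 0 < p) (hs : s.HolderConjugate s')
    (hsr : s = p / r) {u σ φ g : (Fin n → ℝ) → ℝ≥0∞} (hu : Measurable u) (hσ : Measurable σ)
    (hφ : Measurable φ) (hg : Measurable g)
    (huQ : ∀ k m, ∫⁻ x in dyadicCube k m, u x ≠ ∞) (hσQ : ∀ k m, ∫⁻ x in dyadicCube k m, σ x ≠ ∞)
    {K : ℝ≥0∞} {f : (Fin n → ℝ) → ℝ} (hf : ∀ k m, IntegrableOn f (dyadicCube k m))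
    (hfφ : ∀ᵐ x, ENNReal.ofReal |f x| = φ x * σ x) {k : ℤ} {m : Fin n → ℤ} {E : Set (Fin n → ℝ)}
    (hEQ : E ⊆ dyadicCube k m)
    (htest : (∫⁻ x in dyadicCube k m, σ x) ^ r * (∫⁻ x in dyadicCube k m, u x) ≤
      K * volume (dyadicCube k m) ^ r *
        ((∫⁻ x in E, σ x) ^ (1 / s) * (∫⁻ x in E, u x) ^ (1 / s'))) :
    ENNReal.ofReal (cubeMean (fun x => |f x|) k m) ^ r * (∫⁻ x in dyadicCube k m, g x * u x) ≤
      K * ∫⁻ x in E, (σ x * dyadicMaximal (volume.withDensity σ) φ x ^ p +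
        u x * dyadicMaximal (volume.withDensity u) g x ^ s') := by
  have hs0 := hs.pos
  have hs0' := hs.symm.pos
  set Q := dyadicCube k m with hQ
  have hQm : MeasurableSet Q := measurableSet_dyadicCube k m
  have hμ : ∀ {v : (Fin n → ℝ) → ℝ≥0∞}, (∀ k m, ∫⁻ x in dyadicCube k m, v x ≠ ∞) →
      ∀ k m, volume.withDensity v (dyadicCube k m) ≠ ∞ := fun {v} hv k m => by
    rw [withDensity_apply _ (measurableSet_dyadicCube k m)]; exact hv k m
  -- The mean of `|f|` is `X σ(Q)/|Q|` and `∫_Q g u` is `Y u(Q)`. So `htest` acts on masses alone,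
  -- and afterwards `X` and `Y` are at most the respective maximal functions at every point of `E`.
  set X := dyadicAvg (volume.withDensity σ) φ k m with hX
  set Y := dyadicAvg (volume.withDensity u) g k m with hY
  have hXQ : X * (∫⁻ x in Q, σ x) = ∫⁻ x in Q, φ x * σ x := by
    rw [← withDensity_apply _ hQm, hX, dyadicAvg_mul_measure (hμ hσQ),
      setLIntegral_withDensity_eq_setLIntegral_mul _ hσ hφ hQm]
    simp only [Pi.mul_apply, mul_comm, hQ]
  have hYQ : Y * (∫⁻ x in Q, u x) = ∫⁻ x in Q, g x * u x := by
    rw [← withDensity_apply _ hQm, hY, dyadicAvg_mul_measure (hμ huQ),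
      setLIntegral_withDensity_eq_setLIntegral_mul _ hu hg hQm]
    simp only [Pi.mul_apply, mul_comm, hQ]
  have hA : ENNReal.ofReal (cubeMean (fun x => |f x|) k m) =
      (volume Q)⁻¹ * (X * (∫⁻ x in Q, σ x)) := by
    rw [cubeMean_eq, ENNReal.ofReal_mul (inv_pos.2 (cubeVol_pos n k)).le,
      ofReal_integral_eq_lintegral_ofReal (hf k m).abs (ae_of_all _ fun x => abs_nonneg _),
      ENNReal.ofReal_inv_of_pos (cubeVol_pos n k), ← volume_dyadicCube k m, hXQ,
      setLIntegral_congr_fun_ae hQm (hfφ.mono fun x hx _ => hx)]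
  have hV0 : volume Q ^ r ≠ 0 := by
    simp [ENNReal.rpow_eq_zero_iff, hQ, volume_dyadicCube_ne_zero, volume_dyadicCube_ne_top]
  have hVt : volume Q ^ r ≠ ∞ :=
    ENNReal.rpow_ne_top_of_nonneg hr.le (volume_dyadicCube_ne_top k m)
  have hXr : X ^ r = (X ^ p) ^ (1 / s) := by
    rw [← ENNReal.rpow_mul, hsr]; congr 1; field_simp
  have hYr : Y = (Y ^ s') ^ (1 / s') := by
    rw [← ENNReal.rpow_mul, mul_one_div_cancel hs0'.ne', ENNReal.rpow_one]
  rw [hA, ← hYQ, ENNReal.mul_rpow_of_nonneg _ _ hr.le, ENNReal.mul_rpow_of_nonneg _ _ hr.le,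
    ENNReal.inv_rpow]
  calc _ = (volume Q ^ r)⁻¹ * (X ^ r * Y) * ((∫⁻ x in Q, σ x) ^ r * (∫⁻ x in Q, u x)) := by ring
    _ ≤ (volume Q ^ r)⁻¹ * (X ^ r * Y) * (K * volume Q ^ r *
        ((∫⁻ x in E, σ x) ^ (1 / s) * (∫⁻ x in E, u x) ^ (1 / s'))) := by gcongr
    _ = ((volume Q ^ r)⁻¹ * volume Q ^ r) * K * ((X ^ r * (∫⁻ x in E, σ x) ^ (1 / s)) *
        (Y * (∫⁻ x in E, u x) ^ (1 / s'))) := by ring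
    _ = K * ((X ^ p * (∫⁻ x in E, σ x)) ^ (1 / s) * (Y ^ s' * (∫⁻ x in E, u x)) ^ (1 / s')) := by
        rw [ENNReal.inv_mul_cancel hV0 hVt, one_mul, hXr]
        nth_rewrite 1 [hYr]
        rw [ENNReal.mul_rpow_of_nonneg _ _ (by positivity),
          ENNReal.mul_rpow_of_nonneg _ _ (by positivity)]
    _ ≤ K * (X ^ p * (∫⁻ x in E, σ x) + Y ^ s' * (∫⁻ x in E, u x)) := by
        gcongr; exact rpow_mul_rpow_le_add hs _ _
    _ = K * ∫⁻ x in E, (X ^ p * σ x + Y ^ s' * u x) := by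
        rw [lintegral_add_left (hσ.const_mul _), lintegral_const_mul _ hσ, lintegral_const_mul _ hu]
    _ ≤ _ := by
        gcongr K * ?_
        refine setLIntegral_mono ?_ fun x hx => ?_
        · exact (hσ.mul (measurable_dyadicMaximal.pow_const _)).add
            (hu.mul (measurable_dyadicMaximal.pow_const _))
        · rw [mul_comm (σ x), mul_comm (u x)]
          gcongr
          · exact dyadicAvg_le_dyadicMaximal (hEQ hx)
          · exact dyadicAvg_le_dyadicMaximal (hEQ hx)

/-- A two weight estimate for the dyadic square function under a testing condition. -/
theorem lintegral_dyadicSquare_rpow_le {p p' r s s' : ℝ} (hr : 0 < r) (hr2 : r ≤ 2)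
    (hp : p.HolderConjugate p') (hs : s.HolderConjugate s') (hsr : s = p / r)
    {u σ φ : (Fin n → ℝ) → ℝ≥0∞} (hu : Measurable u) (hσ : Measurable σ) (hφ : Measurable φ)
    (huQ : ∀ k m, ∫⁻ x in dyadicCube k m, u x ≠ ∞) (hσQ : ∀ k m, ∫⁻ x in dyadicCube k m, σ x ≠ ∞)
    {K : ℝ≥0∞} (hK0 : K ≠ 0) (hK : K ≠ ∞) {f : (Fin n → ℝ) → ℝ}
    (hf : ∀ k m, IntegrableOn f (dyadicCube k m)) (hfφ : ∀ᵐ x, ENNReal.ofReal |f x| = φ x * σ x)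
    (htest : ∀ k m E, MeasurableSet E → E ⊆ dyadicCube k m →
      volume (dyadicCube k m) ≤ 2 * volume E →
      (∫⁻ x in dyadicCube k m, σ x) ^ r * (∫⁻ x in dyadicCube k m, u x) ≤
        K * volume (dyadicCube k m) ^ r *
          ((∫⁻ x in E, σ x) ^ (1 / s) * (∫⁻ x in E, u x) ^ (1 / s'))) :
    ∫⁻ x, dyadicSquare f x ^ p ∂volume.withDensity u ≤
      (2 * (ENNReal.ofReal (domConst n) * K) * ENNReal.ofReal s) ^ s *
        (ENNReal.ofReal p' ^ p * ∫⁻ x, φ x ^ p ∂volume.withDensity σ) := by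
  have hs0 := hs.pos
  have hs0' := hs.symm.pos
  have hs1 : 0 < s - 1 := by linarith [hs.lt]
  have hp0 := hp.pos
  have hμ : ∀ {v : (Fin n → ℝ) → ℝ≥0∞}, (∀ k m, ∫⁻ x in dyadicCube k m, v x ≠ ∞) →
      ∀ k m, volume.withDensity v (dyadicCube k m) ≠ ∞ := fun {v} hv k m => by
    rw [withDensity_apply _ (measurableSet_dyadicCube k m)]; exact hv k m
  have hC : ENNReal.ofReal (domConst n) ≠ 0 := by
    simpa using zero_lt_one.trans_le (one_le_domConst n)
  rw [lintegral_dyadicSquare_rpow f hp0]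
  refine iSup_le fun N => ?_
  refine le_trans ?_ (mul_le_mul_right (lintegral_dyadicMaximal_rpow_le hp (hμ hσQ) hφ) _)
  set a := cubeMean f with ha
  generalize 2 * N = d
  generalize (N : ℤ) = k
  have hmeas : Measurable fun x => ENNReal.ofReal (squareSum a d k x) :=
    (measurable_squareSum _ _).ennreal_ofReal
  rw [← lintegral_const_mul _ (measurable_dyadicMaximal.pow_const _),
    lintegral_eq_tsum_dyadicCube _ k, lintegral_eq_tsum_dyadicCube (volume.withDensity σ) k]
  refine ENNReal.tsum_le_tsum fun m => ?_
  rw [lintegral_const_mul _ (measurable_dyadicMaximal.pow_const _)]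
  set Q := dyadicCube k m with hQ
  have hQm : MeasurableSet Q := measurableSet_dyadicCube k m
  obtain ⟨C, hCb⟩ := exists_squareSum_le a d k m
  refine le_of_forall_scaled_le hs ?_ (mul_ne_zero hC hK0) (ENNReal.mul_ne_top (by simp) hK)
    (by simpa using hs0) (by simp) fun l hl0 hl => ?_
  · refine ne_top_of_le_ne_top (ENNReal.mul_ne_top (ENNReal.rpow_ne_top_of_nonneg
      (y := p / 2) (by positivity) (ENNReal.ofReal_ne_top (r := C))) (hμ huQ k m)) ?_
    rw [← setLIntegral_const]
    refine setLIntegral_mono measurable_const fun x hx => ?_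
    gcongr
    exact hCb x hx
  set T : (Fin n → ℝ) → ℝ≥0∞ := fun x => ENNReal.ofReal (squareSum a d k x) ^ (r / 2) with hT
  have hTm : Measurable T := hmeas.pow_const _
  have hTs : ∀ x, ENNReal.ofReal (squareSum a d k x) ^ (p / 2) = T x ^ s := fun x => by
    rw [hT, ← ENNReal.rpow_mul, hsr]; congr 1; field_simp
  -- The test function extremal in the duality of `L^s` and `L^{s'}` is a multiple of `T ^ (s - 1)`,
  -- so `∫ T g u` reproduces `l ∫ T ^ s u`. The free scale `l` is optimised in
  -- `le_of_forall_scaled_le`.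
  set g : (Fin n → ℝ) → ℝ≥0∞ := Q.indicator fun x => l * T x ^ (s - 1) with hg
  have hgm : Measurable g := ((hTm.pow_const _).const_mul _).indicator hQm
  have hdom := lintegral_squareSum_le (isDyadicMartingale_cubeMean hf)
    (isDyadicMartingale_cubeMean fun k m => (hf k m).abs) (abs_cubeMean_le f) hr hr2
    (G := fun x => g x * u x) (hgm.mul hu)
    (fun k m E hE hEQ hvol => cubeMean_rpow_mul_le hr hp0 hs hsr hu hσ hφ hgm huQ hσQ hf hfφ hEQ
      (htest k m E hE hEQ hvol)) d k m
  have hleft : ∫⁻ x in Q, ENNReal.ofReal (squareSum a d k x) ^ (r / 2) * (g x * u x) =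
      l * ∫⁻ x in Q, ENNReal.ofReal (squareSum a d k x) ^ (p / 2) ∂volume.withDensity u := by
    rw [setLIntegral_withDensity_eq_setLIntegral_mul _ hu (hmeas.pow_const _) hQm,
      ← lintegral_const_mul _ (hu.mul (hmeas.pow_const _))]
    refine setLIntegral_congr_fun hQm fun x hx => ?_
    simp only [hg, Set.indicator_of_mem hx, Pi.mul_apply, hTs]
    have : T x ^ s = T x * T x ^ (s - 1) := by
      conv_rhs => enter [1]; rw [← ENNReal.rpow_one (T x)]
      rw [← ENNReal.rpow_add_of_nonneg _ _ zero_le_one hs1.le]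
      congr 1; ring
    rw [this]
    ring
  have hright : ∫⁻ x in Q, (σ x * dyadicMaximal (volume.withDensity σ) φ x ^ p +
        u x * dyadicMaximal (volume.withDensity u) g x ^ s') ≤
      (∫⁻ x in Q, dyadicMaximal (volume.withDensity σ) φ x ^ p ∂volume.withDensity σ) +
        ENNReal.ofReal s ^ s' * l ^ s' *
          ∫⁻ x in Q, ENNReal.ofReal (squareSum a d k x) ^ (p / 2) ∂volume.withDensity u := by
    have hm : Measurable fun x => σ x * dyadicMaximal (volume.withDensity σ) φ x ^ p :=
      hσ.mul (measurable_dyadicMaximal.pow_const _)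
    rw [lintegral_add_left hm,
      setLIntegral_withDensity_eq_setLIntegral_mul _ hσ (measurable_dyadicMaximal.pow_const _) hQm]
    refine add_le_add le_rfl ?_
    calc _ ≤ ∫⁻ x, u x * dyadicMaximal (volume.withDensity u) g x ^ s' := setLIntegral_le_lintegral _ _
      _ = ∫⁻ x, dyadicMaximal (volume.withDensity u) g x ^ s' ∂volume.withDensity u := by
          rw [lintegral_withDensity_eq_lintegral_mul _ hu (measurable_dyadicMaximal.pow_const _)]
          rfl
      _ ≤ ENNReal.ofReal s ^ s' * ∫⁻ x, g x ^ s' ∂volume.withDensity u :=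
          lintegral_dyadicMaximal_rpow_le hs.symm (hμ huQ) hgm
      _ = _ := by
          rw [mul_assoc, ← lintegral_const_mul _ (hmeas.pow_const _), ← lintegral_indicator hQm]
          congr 2
          funext x
          by_cases hx : x ∈ Q
          · rw [hg, Set.indicator_of_mem hx, Set.indicator_of_mem hx,
              ENNReal.mul_rpow_of_nonneg _ _ hs0'.le, ← ENNReal.rpow_mul, hs.sub_one_mul_conj, hTs]
          · rw [hg, Set.indicator_of_notMem hx, Set.indicator_of_notMem hx,
              ENNReal.zero_rpow_of_pos hs0']
  rw [hleft] at hdom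
  exact hdom.trans (mul_le_mul_right hright _)

end SquareDyadic

namespace SquareDyadic

/-! ### Muckenhoupt weights satisfy the testing condition -/

variable {n : ℕ}

theorem IsApWeight.exists_density {p : ℝ} {w : (Fin n → ℝ) → ℝ} (hw : IsApWeight p w) :
    ∃ u : (Fin n → ℝ) → ℝ≥0∞, Measurable u ∧ (∀ x, u x ≠ ∞) ∧
      (fun x => ENNReal.ofReal (w x)) =ᵐ[volume] u := by
  have h := hw.locallyIntegrable.aestronglyMeasurable
  exact ⟨fun x => ENNReal.ofReal (h.mk w x), h.stronglyMeasurable_mk.measurable.ennreal_ofReal,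
    fun x => ENNReal.ofReal_ne_top, h.ae_eq_mk.mono fun x hx => by simp only [hx]⟩

theorem mul_rpow_le_apConst {p : ℝ} {w : (Fin n → ℝ) → ℝ} {u : (Fin n → ℝ) → ℝ≥0∞}
    (hwu : (fun x => ENNReal.ofReal (w x)) =ᵐ[volume] u) (a : Fin n → ℝ) {h : ℝ} (hh : 0 < h) :
    (∫⁻ x in cube a h, u x) / volume (cube a h) *
      ((∫⁻ x in cube a h, u x ^ (1 - p.conjExponent)) / volume (cube a h)) ^ (p - 1) ≤
      apConst p w := by
  have h1 : ∫⁻ x in cube a h, u x = ∫⁻ x in cube a h, ENNReal.ofReal (w x) :=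
    lintegral_congr_ae (ae_restrict_of_ae (hwu.mono fun x hx => hx.symm))
  have h2 : ∫⁻ x in cube a h, u x ^ (1 - p.conjExponent) =
      ∫⁻ x in cube a h, ENNReal.ofReal (w x) ^ (1 - p.conjExponent) :=
    lintegral_congr_ae (ae_restrict_of_ae (hwu.mono fun x hx => by simp only [← hx]))
  rw [h1, h2, ← setLAverage_eq, ← setLAverage_eq]
  exact le_iSup₂_of_le a h (le_iSup_of_le hh le_rfl)

theorem dyadicCube_ae_eq_cube (k : ℤ) (m : Fin n → ℤ) :
    dyadicCube k m =ᵐ[volume] cube (fun i => (2 : ℝ) ^ k * m i) (2 ^ k) := by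
  have h : cube (fun i => (2 : ℝ) ^ k * m i) (2 ^ k) =
      Set.Icc (fun i => (2 : ℝ) ^ k * m i) fun i => (2 : ℝ) ^ k * (m i + 1) := by
    simp only [cube, mul_add, mul_one]
  rw [dyadicCube_eq_pi, h]
  exact Measure.univ_pi_Ico_ae_eq_Icc

theorem mul_rpow_le_apConst_dyadicCube {p : ℝ} {w : (Fin n → ℝ) → ℝ} {u : (Fin n → ℝ) → ℝ≥0∞}
    (hwu : (fun x => ENNReal.ofReal (w x)) =ᵐ[volume] u) (k : ℤ) (m : Fin n → ℤ) :
    (∫⁻ x in dyadicCube k m, u x) / volume (dyadicCube k m) *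
      ((∫⁻ x in dyadicCube k m, u x ^ (1 - p.conjExponent)) / volume (dyadicCube k m)) ^ (p - 1) ≤
      apConst p w := by
  have hk : (0 : ℝ) < 2 ^ k := by positivity
  rw [Measure.restrict_congr_set (dyadicCube_ae_eq_cube k m),
    measure_congr (dyadicCube_ae_eq_cube k m)]
  exact mul_rpow_le_apConst hwu _ hk

/-- The cube of side length `2 N` centred at the origin. -/
def centredCube (n N : ℕ) : Set (Fin n → ℝ) := cube (fun _ => -(N : ℝ)) (2 * N)

theorem mem_centredCube {N : ℕ} {x : Fin n → ℝ} : x ∈ centredCube n N ↔ ‖x‖ ≤ N := by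
  rw [centredCube, cube, Set.mem_Icc, pi_norm_le_iff_of_nonneg N.cast_nonneg]
  simp only [Pi.le_def, Real.norm_eq_abs, abs_le]
  refine ⟨fun h i => ⟨h.1 i, by linarith [h.2 i]⟩, fun h => ⟨fun i => (h i).1, fun i => by
    linarith [(h i).2]⟩⟩

theorem exists_dyadicCube_subset_centredCube (k : ℤ) (m : Fin n → ℤ) :
    ∃ N : ℕ, dyadicCube k m ⊆ centredCube n N := by
  obtain ⟨N, hN⟩ := exists_nat_ge (‖fun i => (2 : ℝ) ^ k * m i‖ + 2 ^ k)
  have hk : (0 : ℝ) < 2 ^ k := by positivity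
  refine ⟨N, fun x hx => mem_centredCube.2 ((pi_norm_le_iff_of_nonneg N.cast_nonneg).2 fun i => ?_)⟩
  have h1 := norm_le_pi_norm (fun i => (2 : ℝ) ^ k * m i) i
  obtain ⟨h2, h3⟩ := hx i
  rw [Real.norm_eq_abs, abs_le] at h1 ⊢
  constructor <;> linarith

theorem isCompact_centredCube (N : ℕ) : IsCompact (centredCube n N) := isCompact_Icc

theorem iUnion_centredCube : ⋃ N, centredCube n N = Set.univ := by
  refine Set.eq_univ_of_forall fun x => Set.mem_iUnion.2 ?_
  obtain ⟨N, hN⟩ := exists_nat_ge ‖x‖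
  exact ⟨N, mem_centredCube.2 hN⟩

theorem centredCube_mono {M N : ℕ} (h : M ≤ N) : centredCube n M ⊆ centredCube n N := fun _ hx =>
  mem_centredCube.2 ((mem_centredCube.1 hx).trans (by exact_mod_cast h))

section

variable {p : ℝ} {w : (Fin n → ℝ) → ℝ} {u : (Fin n → ℝ) → ℝ≥0∞}

theorem IsApWeight.lintegral_dyadicCube_ne_top (hw : IsApWeight p w)
    (hwu : (fun x => ENNReal.ofReal (w x)) =ᵐ[volume] u) (k : ℤ) (m : Fin n → ℤ) :
    ∫⁻ x in dyadicCube k m, u x ≠ ∞ := by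
  obtain ⟨N, hN⟩ := exists_dyadicCube_subset_centredCube k m
  have h1 : IntegrableOn w (dyadicCube k m) :=
    (hw.locallyIntegrable.integrableOn_isCompact (isCompact_centredCube N)).mono_set hN
  rw [← lintegral_congr_ae (ae_restrict_of_ae hwu)]
  exact ((lintegral_mono fun x => Real.ofReal_le_enorm _).trans_lt h1.2).ne

/-- On a cube where `w` vanishes the `A_p` product reads `0 · ∞ = 0` and says nothing. The centred
cubes are therefore enlarged until they have positive `w`-mass, where finiteness of the product
bounds the dual mass. -/
theorem IsApWeight.exists_lintegral_conj_ne_top (hp : 1 < p) (hw : IsApWeight p w)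
    (hu : Measurable u) (hwu : (fun x => ENNReal.ofReal (w x)) =ᵐ[volume] u) :
    ∃ N₀ : ℕ, ∀ N ≥ N₀, ∫⁻ x in centredCube n N, u x ^ (1 - p.conjExponent) ≠ ∞ := by
  have hne : ∃ N₀ : ℕ, ∫⁻ x in centredCube n N₀, u x ≠ 0 := by
    by_contra! hcon
    refine hw.not_ae_zero ?_
    have h1 : ∀ᵐ x ∂volume.restrict (⋃ N, centredCube n N), u x = 0 :=
      (ae_restrict_iUnion_iff _ _).2 fun N => (lintegral_eq_zero_iff hu).1 (hcon N)
    rw [iUnion_centredCube, Measure.restrict_univ] at h1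
    filter_upwards [h1, hwu] with x hx hx'
    rw [hx, ENNReal.ofReal_eq_zero] at hx'
    exact le_antisymm hx' (hw.nonneg x)
  obtain ⟨N₀, hN₀⟩ := hne
  refine ⟨N₀ + 1, fun N hN htop => ?_⟩
  have hN0 : (0 : ℝ) < 2 * N := by
    have : (1 : ℝ) ≤ N := by exact_mod_cast (by omega : 1 ≤ N)
    linarith
  have h := mul_rpow_le_apConst (p := p) hwu (fun _ : Fin n => -(N : ℝ)) hN0
  have hvol : volume (centredCube n N) ≠ ∞ := (isCompact_centredCube N).measure_ne_top
  have hN' : ∫⁻ x in centredCube n N, u x ≠ 0 := fun h0 => hN₀ <|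
    le_antisymm ((lintegral_mono_set (centredCube_mono (by omega))).trans h0.le) zero_le
  change (∫⁻ x in centredCube n N, u x) / volume (centredCube n N) *
    ((∫⁻ x in centredCube n N, u x ^ (1 - p.conjExponent)) / volume (centredCube n N)) ^ (p - 1)
      ≤ _ at h
  rw [htop, ENNReal.top_div_of_ne_top hvol, ENNReal.top_rpow_of_pos (by linarith),
    ENNReal.mul_top (ENNReal.div_ne_zero.2 ⟨hN', hvol⟩)] at h
  exact absurd hw.apConst_lt_top (not_lt.2 h)

theorem IsApWeight.lintegral_conj_dyadicCube_ne_top (hp : 1 < p) (hw : IsApWeight p w)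
    (hu : Measurable u) (hwu : (fun x => ENNReal.ofReal (w x)) =ᵐ[volume] u) (k : ℤ)
    (m : Fin n → ℤ) : ∫⁻ x in dyadicCube k m, u x ^ (1 - p.conjExponent) ≠ ∞ := by
  obtain ⟨N₀, hN₀⟩ := hw.exists_lintegral_conj_ne_top hp hu hwu
  obtain ⟨N, hN⟩ := exists_dyadicCube_subset_centredCube k m
  exact ne_top_of_le_ne_top (hN₀ (max N N₀) (le_max_right _ _))
    (lintegral_mono_set (hN.trans (centredCube_mono (le_max_left _ _))))

/-- The dual weight is infinite wherever `u` vanishes, but it is integrable on every unit dyadic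
cube. -/
theorem IsApWeight.ae_ne_zero (hp : 1 < p) (hw : IsApWeight p w)
    (hu : Measurable u) (hwu : (fun x => ENNReal.ofReal (w x)) =ᵐ[volume] u) :
    ∀ᵐ x, u x ≠ 0 := by
  have hp' : 1 - p.conjExponent < 0 := by
    linarith [(Real.HolderConjugate.conjExponent hp).symm.lt]
  have h1 : ∀ᵐ x ∂volume.restrict (⋃ m, dyadicCube (n := n) 0 m), u x ≠ 0 := by
    refine (ae_restrict_iUnion_iff _ _).2 fun m => ?_
    filter_upwards [ae_lt_top (hu.pow_const _)
      (hw.lintegral_conj_dyadicCube_ne_top hp hu hwu 0 m)] with x hx h0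
    rw [h0, ENNReal.zero_rpow_of_neg hp'] at hx
    exact lt_irrefl _ hx
  rwa [iUnion_dyadicCube, Measure.restrict_univ] at h1

/-- Hölder's inequality for a weight and its conjugate weight. -/
theorem volume_le_rpow_mul_rpow (hp : 1 < p) (hu : Measurable u) (hu0 : ∀ᵐ x, u x ≠ 0)
    (hut : ∀ x, u x ≠ ∞) (E : Set (Fin n → ℝ)) :
    volume E ≤ (∫⁻ x in E, u x) ^ (1 / p) *
      (∫⁻ x in E, u x ^ (1 - p.conjExponent)) ^ (1 / p.conjExponent) := by
  have hq := Real.HolderConjugate.conjExponent hp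
  have hp0 := hq.pos
  have hq0 := hq.symm.pos
  have h := ENNReal.lintegral_mul_le_Lp_mul_Lq (volume.restrict E) hq
    (f := fun x => u x ^ (1 / p)) (g := fun x => u x ^ (-(1 / p))) (by fun_prop) (by fun_prop)
  have h1 : ∫⁻ x in E, ((fun x => u x ^ (1 / p)) * fun x => u x ^ (-(1 / p))) x = volume E := by
    rw [← setLIntegral_one]
    refine lintegral_congr_ae (ae_restrict_of_ae (hu0.mono fun x hx => ?_))
    simp only [Pi.mul_apply]
    rw [← ENNReal.rpow_add _ _ hx (hut x), add_neg_cancel, ENNReal.rpow_zero]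
  have h2 : -(1 / p) * p.conjExponent = 1 - p.conjExponent := by
    have := hq.mul_eq_add
    field_simp
    linarith
  simp only [← ENNReal.rpow_mul, one_div_mul_cancel hp0.ne', ENNReal.rpow_one, h2] at h
  rwa [h1] at h

end

/-- The arithmetic behind the testing condition. -/
theorem testing_arithmetic {p r a WQ SQ V B wE sE v : ℝ} (hp : 1 < p) (hr : 0 < r)
    (ha : a = max 1 (r / (p - 1))) (hwE : 0 < wE) (hsE : 0 < sE) (hv : 0 < v) (hV : 0 < V)
    (hB : 0 < B) (hw : wE ≤ WQ) (hs : sE ≤ SQ) (hVv : V ≤ 2 * v)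
    (hE : v ≤ wE ^ (1 / p) * sE ^ (1 - 1 / p)) (hA : WQ / V * (SQ / V) ^ (p - 1) ≤ B) :
    SQ ^ r * WQ ≤ 2 ^ (p * a) * B ^ a * V ^ r * (sE ^ (r / p) * wE ^ (1 - r / p)) := by
  have hWQ := hwE.trans_le hw
  have hSQ := hsE.trans_le hs
  have l2 : 0 < Real.log 2 := Real.log_pos (by norm_num)
  have hp1 : 0 < p - 1 := by linarith
  have hp0 : 0 < p := by linarith
  rw [← Real.log_le_log_iff (by positivity) (by positivity)] at hE hA ⊢ hVv hw hs
  rw [Real.log_mul (by positivity) (by positivity), Real.log_rpow (by positivity)] at hE hA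
  rw [Real.log_div (by positivity) (by positivity),
    Real.log_div (by positivity) (by positivity)] at hA
  rw [Real.log_rpow (by positivity)] at hE
  rw [Real.log_mul (by norm_num) hv.ne'] at hVv
  rw [Real.log_mul (by positivity) (by positivity), Real.log_mul (by positivity) (by positivity),
    Real.log_mul (by positivity) (by positivity), Real.log_mul (by positivity) (by positivity),
    Real.log_mul (by positivity) (by positivity), Real.log_rpow (by positivity),
    Real.log_rpow (by positivity), Real.log_rpow (by positivity), Real.log_rpow (by positivity),
    Real.log_rpow (by positivity), Real.log_rpow (by positivity)]
  generalize Real.log WQ = lw at *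
  generalize Real.log SQ = ls at *
  generalize Real.log V = lV at *
  generalize Real.log B = b at *
  generalize Real.log wE = lwE at *
  generalize Real.log sE = lsE at *
  generalize Real.log v = lv at *
  generalize Real.log 2 = L at *
  have ha1 : 1 ≤ a := ha ▸ le_max_left _ _
  have hra : r / (p - 1) ≤ a := ha ▸ le_max_right _ _
  have hra' : r ≤ a * (p - 1) := (div_le_iff₀ hp1).1 hra
  have hpa : 0 ≤ p * a - r := by nlinarith
  -- In logarithms the claim is a non-negative combination of the hypotheses. The coefficients `a -
  -- 1` and `a(p - 1) - r` are non-negative exactly when `a ≥ max(1, r/(p - 1))`, which determines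
  -- the power of the weight constant.
  have k1 := mul_le_mul_of_nonneg_left hA (by linarith : 0 ≤ a)
  have k2 := mul_le_mul_of_nonneg_left hw (by linarith : 0 ≤ a - 1)
  have k3 := mul_le_mul_of_nonneg_left hs (by linarith : 0 ≤ a * (p - 1) - r)
  have k4 := mul_le_mul_of_nonneg_left hVv hpa
  have k5 := mul_le_mul_of_nonneg_left hE hpa
  have k6 : (p * a - r) * (1 / p * lwE + (1 - 1 / p) * lsE) =
      (a - r / p) * lwE + (a * (p - 1) - r + r / p) * lsE := by
    field_simp
    ring
  rw [k6] at k5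
  have k7 := mul_nonneg hr.le l2.le
  linarith

end SquareDyadic

namespace SquareDyadic

/-! ### Upper bounds -/

variable {n : ℕ}

theorem eLpNorm_dyadicSquare_eq (f : (Fin n → ℝ) → ℝ) {p : ℝ} (hp : 0 < p)
    (μ : Measure (Fin n → ℝ)) : eLpNorm (dyadicSquare f) (ENNReal.ofReal p) μ =
      (∫⁻ x, dyadicSquare f x ^ p ∂μ) ^ (1 / p) := by
  rw [eLpNorm_eq_lintegral_rpow_enorm_toReal (by simpa using hp) ENNReal.ofReal_ne_top,
    ENNReal.toReal_ofReal hp.le]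
  simp only [enorm_eq_self]

theorem eLpNorm_real_eq (f : (Fin n → ℝ) → ℝ) {p : ℝ} (hp : 0 < p)
    (μ : Measure (Fin n → ℝ)) : eLpNorm f (ENNReal.ofReal p) μ =
      (∫⁻ x, ENNReal.ofReal |f x| ^ p ∂μ) ^ (1 / p) := by
  rw [eLpNorm_eq_lintegral_rpow_enorm_toReal (by simpa using hp) ENNReal.ofReal_ne_top,
    ENNReal.toReal_ofReal hp.le]
  simp only [Real.enorm_eq_ofReal_abs]

theorem cubeMean_congr {f g : (Fin n → ℝ) → ℝ} (h : f =ᵐ[volume] g) : cubeMean f = cubeMean g := by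
  funext k m
  rw [cubeMean_eq, cubeMean_eq, integral_congr_ae (ae_restrict_of_ae h)]

theorem dyadicSquare_congr {f g : (Fin n → ℝ) → ℝ} (h : f =ᵐ[volume] g) :
    dyadicSquare f = dyadicSquare g := by
  funext x
  rw [dyadicSquare_eq_tsum, dyadicSquare_eq_tsum, cubeMean_congr h]

/-- Compared with `lintegral_dyadicSquare_rpow_le`, local integrability of `f` is deduced rather
than assumed, from `φσ ≤ σ + σ φ ^ p`. -/
theorem eLpNorm_dyadicSquare_le_of_testing {p p' r s s' : ℝ} (hr : 0 < r) (hr2 : r ≤ 2)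
    (hp : p.HolderConjugate p') (hs : s.HolderConjugate s') (hsr : s = p / r)
    {u σ φ : (Fin n → ℝ) → ℝ≥0∞} (hu : Measurable u) (hσ : Measurable σ) (hφ : Measurable φ)
    (huQ : ∀ k m, ∫⁻ x in dyadicCube k m, u x ≠ ∞) (hσQ : ∀ k m, ∫⁻ x in dyadicCube k m, σ x ≠ ∞)
    {K : ℝ≥0∞} (hK0 : K ≠ 0) (hK : K ≠ ∞) {f : (Fin n → ℝ) → ℝ}
    (hf : AEStronglyMeasurable f volume) (hfφ : ∀ᵐ x, ENNReal.ofReal |f x| = φ x * σ x)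
    (hint : ∫⁻ x, φ x ^ p ∂volume.withDensity σ ≠ ∞)
    (htest : ∀ k m E, MeasurableSet E → E ⊆ dyadicCube k m →
      volume (dyadicCube k m) ≤ 2 * volume E →
      (∫⁻ x in dyadicCube k m, σ x) ^ r * (∫⁻ x in dyadicCube k m, u x) ≤
        K * volume (dyadicCube k m) ^ r *
          ((∫⁻ x in E, σ x) ^ (1 / s) * (∫⁻ x in E, u x) ^ (1 / s'))) :
    eLpNorm (dyadicSquare f) (ENNReal.ofReal p) (volume.withDensity u) ≤
      (2 * (ENNReal.ofReal (domConst n) * K) * ENNReal.ofReal s) ^ (1 / r) *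
        ENNReal.ofReal p' * (∫⁻ x, φ x ^ p ∂volume.withDensity σ) ^ (1 / p) := by
  have hp0 := hp.pos
  have hfi : ∀ k m, IntegrableOn f (dyadicCube k m) := by
    intro k m
    refine ⟨hf.restrict, ?_⟩
    rw [hasFiniteIntegral_iff_enorm]
    refine lt_of_le_of_lt ?_ (ENNReal.add_lt_top.2 ⟨(hσQ k m).lt_top, hint.lt_top⟩)
    calc ∫⁻ x in dyadicCube k m, ‖f x‖ₑ = ∫⁻ x in dyadicCube k m, φ x * σ x := by
          refine lintegral_congr_ae (ae_restrict_of_ae (hfφ.mono fun x hx => ?_))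
          simp only [Real.enorm_eq_ofReal_abs, hx]
      _ ≤ ∫⁻ x in dyadicCube k m, (σ x + σ x * φ x ^ p) := by
          refine lintegral_mono fun x => ?_
          rcases le_total (φ x) 1 with h | h
          · exact le_add_right (mul_le_of_le_one_left zero_le h)
          · refine le_add_left ?_
            rw [mul_comm]
            gcongr
            conv_lhs => rw [← ENNReal.rpow_one (φ x)]
            exact ENNReal.rpow_le_rpow_of_exponent_le h hp.lt.le
      _ = (∫⁻ x in dyadicCube k m, σ x) + ∫⁻ x in dyadicCube k m, σ x * φ x ^ p :=
          lintegral_add_left hσ _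
      _ ≤ _ := by
          rw [lintegral_withDensity_eq_lintegral_mul _ hσ (hφ.pow_const _)]
          exact add_le_add le_rfl (setLIntegral_le_lintegral _ _)
  rw [eLpNorm_dyadicSquare_eq f hp0]
  refine (ENNReal.rpow_le_rpow (lintegral_dyadicSquare_rpow_le hr hr2 hp hs hsr hu hσ hφ huQ hσQ
    hK0 hK hfi hfφ htest) (by positivity)).trans (le_of_eq ?_)
  rw [ENNReal.mul_rpow_of_nonneg (z := 1 / p) _ _ (by positivity),
    ENNReal.mul_rpow_of_nonneg (z := 1 / p) _ _ (by positivity),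
    ← ENNReal.rpow_mul, ← ENNReal.rpow_mul, mul_one_div_cancel hp0.ne', ENNReal.rpow_one,
    show s * (1 / p) = 1 / r by rw [hsr]; field_simp]
  exact (mul_assoc _ _ _).symm

/-- Both weights are 1, and the testing condition is `|Q| ≤ 2|E|`, so `K = 2`. The dependence on `p`
is kept explicit for the endpoint orders. -/
theorem eLpNorm_dyadicSquare_le_volume {p p' r s s' : ℝ} (hr : 0 < r) (hr2 : r ≤ 2)
    (hp : p.HolderConjugate p') (hs : s.HolderConjugate s') (hsr : s = p / r)
    {f : (Fin n → ℝ) → ℝ} (hf : MemLp f (ENNReal.ofReal p) volume) :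
    eLpNorm (dyadicSquare f) (ENNReal.ofReal p) volume ≤
      (ENNReal.ofReal (4 * domConst n * s) ^ (1 / r) * ENNReal.ofReal p') *
        eLpNorm f (ENNReal.ofReal p) volume := by
  have hp0 := hp.pos
  have h1 : (volume : Measure (Fin n → ℝ)).withDensity (fun _ => 1) = volume := withDensity_one
  set g := hf.1.mk f with hg
  have hfg : f =ᵐ[volume] g := hf.1.ae_eq_mk
  have hgm : Measurable g := hf.1.stronglyMeasurable_mk.measurable
  have hN := eLpNorm_real_eq g hp0 volume
  have hfin : ∫⁻ x, ENNReal.ofReal |g x| ^ p ≠ ∞ := by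
    have := (eLpNorm_congr_ae hfg).symm.trans_lt hf.2
    rw [hN] at this
    intro htop
    rw [htop, ENNReal.top_rpow_of_pos (by positivity)] at this
    exact lt_irrefl _ this
  have h := eLpNorm_dyadicSquare_le_of_testing (K := 2) (f := g) hr hr2 hp hs hsr
    (u := fun _ => 1) (σ := fun _ => 1) (φ := fun x => ENNReal.ofReal |g x|) measurable_const
    measurable_const (by fun_prop) (by simp [volume_dyadicCube_ne_top])
    (by simp [volume_dyadicCube_ne_top]) (by simp) (by simp) hgm.aestronglyMeasurable (by simp)
    (by rwa [h1]) fun k m E hE hEQ hvol => by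
      rw [setLIntegral_one, setLIntegral_one, ← ENNReal.rpow_add_of_nonneg _ _
        (one_div_nonneg.2 hs.pos.le) (one_div_nonneg.2 hs.symm.pos.le), one_div, one_div,
        hs.inv_add_inv_eq_one, ENNReal.rpow_one, mul_comm 2, mul_assoc]
      gcongr
  rw [h1] at h
  rw [dyadicSquare_congr hfg, eLpNorm_congr_ae hfg, hN]
  convert h using 4
  have := one_le_domConst n
  rw [ENNReal.ofReal_mul (by linarith), ENNReal.ofReal_mul (by norm_num), ENNReal.ofReal_ofNat]
  ring

/-! ### Weighted bounds for Muckenhoupt weights -/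

section

variable {p : ℝ} {w : (Fin n → ℝ) → ℝ} {u : (Fin n → ℝ) → ℝ≥0∞}

/-- Hölder on `E` and the `A_p` product on the cube feed `testing_arithmetic`, once all masses are
known to be positive and finite. Positivity of the constant is recorded because the testing constant
has to be non-zero. -/
theorem IsApWeight.testing (hp : 1 < p) (hw : IsApWeight p w) (hu : Measurable u)
    (hut : ∀ x, u x ≠ ∞) (hwu : (fun x => ENNReal.ofReal (w x)) =ᵐ[volume] u) {r a : ℝ}
    (hr : 0 < r) (hrp : r ≤ p) (ha : a = max 1 (r / (p - 1))) {k : ℤ} {m : Fin n → ℤ}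
    {E : Set (Fin n → ℝ)} (hEQ : E ⊆ dyadicCube k m)
    (hvol : volume (dyadicCube k m) ≤ 2 * volume E) :
    0 < apConst p w ∧
    (∫⁻ x in dyadicCube k m, u x ^ (1 - p.conjExponent)) ^ r * (∫⁻ x in dyadicCube k m, u x) ≤
      ENNReal.ofReal (2 ^ (p * a)) * apConst p w ^ a * volume (dyadicCube k m) ^ r *
        ((∫⁻ x in E, u x ^ (1 - p.conjExponent)) ^ (r / p) * (∫⁻ x in E, u x) ^ (1 - r / p)) := by
  have hq := Real.HolderConjugate.conjExponent hp
  have hp0 := hq.pos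
  have ha0 : 0 < a := ha ▸ lt_max_of_lt_left one_pos
  have hrp' : 0 ≤ 1 - r / p := sub_nonneg.2 ((div_le_one hp0).2 hrp)
  have hA := mul_rpow_le_apConst_dyadicCube (p := p) hwu k m
  have hH := volume_le_rpow_mul_rpow hp hu (hw.ae_ne_zero hp hu hwu) hut E
  have huQ := hw.lintegral_dyadicCube_ne_top hwu k m
  have hsQ := hw.lintegral_conj_dyadicCube_ne_top hp hu hwu k m
  have huE : ∫⁻ x in E, u x ≤ ∫⁻ x in dyadicCube k m, u x := lintegral_mono_set hEQ
  have hsE : ∫⁻ x in E, u x ^ (1 - p.conjExponent) ≤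
    ∫⁻ x in dyadicCube k m, u x ^ (1 - p.conjExponent) := lintegral_mono_set hEQ
  have hV0 := volume_dyadicCube_ne_zero k m
  have hVt := volume_dyadicCube_ne_top k m
  have hvV : volume E ≤ volume (dyadicCube k m) := measure_mono hEQ
  have hB := hw.apConst_lt_top.ne
  have hconj : 1 / p.conjExponent = 1 - 1 / p := by
    rw [one_div, one_div, ← hq.inv_add_inv_eq_one]; ring
  rw [hconj] at hH
  have hp1 : 0 < 1 - 1 / p := by rw [← hconj]; exact one_div_pos.2 hq.symm.pos
  generalize ∫⁻ x in E, u x = wE at *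
  generalize ∫⁻ x in E, u x ^ (1 - p.conjExponent) = sE at *
  generalize ∫⁻ x in dyadicCube k m, u x = WQ at *
  generalize ∫⁻ x in dyadicCube k m, u x ^ (1 - p.conjExponent) = SQ at *
  generalize volume (dyadicCube k m) = V at *
  generalize volume E = v at *
  generalize apConst p w = B at *
  have hv0 : v ≠ 0 := fun h => hV0 (by simpa [h] using hvol)
  have hvt : v ≠ ∞ := ne_top_of_le_ne_top hVt hvV
  have hwE0 : wE ≠ 0 := fun h => by
    rw [h, ENNReal.zero_rpow_of_pos (by positivity), zero_mul] at hH
    exact hv0 (le_antisymm hH zero_le)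
  have hsE0 : sE ≠ 0 := fun h => by
    rw [h, ENNReal.zero_rpow_of_pos hp1, mul_zero] at hH
    exact hv0 (le_antisymm hH zero_le)
  have hwEt := ne_top_of_le_ne_top huQ huE
  have hsEt := ne_top_of_le_ne_top hsQ hsE
  have hWQ0 : WQ ≠ 0 := fun h => hwE0 (le_antisymm (h ▸ huE) zero_le)
  have hSQ0 : SQ ≠ 0 := fun h => hsE0 (le_antisymm (h ▸ hsE) zero_le)
  have hB0 : B ≠ 0 := fun h => by
    rw [h, nonpos_iff_eq_zero, mul_eq_zero, ENNReal.div_eq_zero_iff, ENNReal.rpow_eq_zero_iff,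
      ENNReal.div_eq_zero_iff, ENNReal.div_eq_top] at hA
    rcases hA with (h1 | h1) | ⟨h1 | h1, -⟩ | ⟨-, h1⟩
    · exact hWQ0 h1
    · exact hVt h1
    · exact hSQ0 h1
    · exact hVt h1
    · linarith
  refine ⟨pos_iff_ne_zero.2 hB0, ?_⟩
  lift wE to ℝ≥0 using hwEt
  lift sE to ℝ≥0 using hsEt
  lift WQ to ℝ≥0 using huQ
  lift SQ to ℝ≥0 using hsQ
  lift V to ℝ≥0 using hVt
  lift v to ℝ≥0 using hvt
  lift B to ℝ≥0 using hB
  have pos : ∀ {z : ℝ≥0}, (z : ℝ≥0∞) ≠ 0 → (0 : ℝ) < z := fun {z} hz =>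
    NNReal.coe_pos.2 (pos_iff_ne_zero.2 (by simpa using hz))
  have hne : ∀ {z : ℝ≥0}, (z : ℝ≥0∞) ≠ 0 → z ≠ 0 := fun {z} hz => by simpa using hz
  have hH' : (v : ℝ) ≤ (wE : ℝ) ^ (1 / p) * (sE : ℝ) ^ (1 - 1 / p) := by
    rw [← ENNReal.coe_rpow_of_ne_zero (hne hwE0), ← ENNReal.coe_rpow_of_ne_zero (hne hsE0)] at hH
    exact_mod_cast hH
  have hA' : (WQ : ℝ) / V * ((SQ : ℝ) / V) ^ (p - 1) ≤ B := by
    rw [← ENNReal.coe_div (hne hV0), ← ENNReal.coe_div (hne hV0),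
      ← ENNReal.coe_rpow_of_nonneg _ (by linarith)] at hA
    exact_mod_cast hA
  have key := testing_arithmetic hp hr ha (pos hwE0) (pos hsE0) (pos hv0) (pos hV0) (pos hB0)
    (by exact_mod_cast huE) (by exact_mod_cast hsE) (by exact_mod_cast hvol) hH' hA'
  rw [← ENNReal.coe_rpow_of_nonneg _ hr.le, ← ENNReal.coe_rpow_of_nonneg _ hr.le,
    ← ENNReal.coe_rpow_of_nonneg _ ha0.le, ← ENNReal.coe_rpow_of_nonneg _ (by positivity),
    ← ENNReal.coe_rpow_of_nonneg _ hrp', ENNReal.ofReal]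
  have h2 : (2 : ℝ) ^ (p * a) = (Real.toNNReal (2 ^ (p * a)) : ℝ) :=
    (Real.coe_toNNReal _ (by positivity)).symm
  rw [h2] at key
  exact_mod_cast key

/-- The weighted bound with an auxiliary exponent `r`. -/
theorem IsApWeight.eLpNorm_dyadicSquare_le (hp : 1 < p) (hw : IsApWeight p w) {r a : ℝ}
    (hr : 0 < r) (hr2 : r ≤ 2) (hrp : r < p) (ha : a = max 1 (r / (p - 1)))
    {f : (Fin n → ℝ) → ℝ} (hf : MemLp f (ENNReal.ofReal p) (weightMeasure w)) :
    eLpNorm (dyadicSquare f) (ENNReal.ofReal p) (weightMeasure w) ≤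
      ENNReal.ofReal ((2 * domConst n * 2 ^ (p * a) * (p / r)) ^ (1 / r) * p.conjExponent) *
        apConst p w ^ (a / r) * eLpNorm f (ENNReal.ofReal p) (weightMeasure w) := by
  obtain ⟨u, hu, hut, hwu⟩ := hw.exists_density
  have hq := Real.HolderConjugate.conjExponent hp
  have hp0 := hq.pos
  have ha0 : 0 < a := ha ▸ lt_max_of_lt_left one_pos
  have hu0 := hw.ae_ne_zero hp hu hwu
  have hwm : weightMeasure w = volume.withDensity u := withDensity_congr_ae hwu
  rw [hwm] at hf ⊢
  -- Since `u > 0` almost everywhere, measurability with respect to `w dx` passes to Lebesgue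
  -- measure.
  have hac : volume ≪ volume.withDensity u := withDensity_absolutelyContinuous' hu.aemeasurable hu0
  have hfm : AEStronglyMeasurable f volume := hf.1.mono_ac hac
  set g := hfm.mk f with hg
  have hfg : f =ᵐ[volume] g := hfm.ae_eq_mk
  have hgm : Measurable g := hfm.stronglyMeasurable_mk.measurable
  have hfg' : f =ᵐ[volume.withDensity u] g := (withDensity_absolutelyContinuous _ _).ae_eq hfg
  set σ : (Fin n → ℝ) → ℝ≥0∞ := fun x => u x ^ (1 - p.conjExponent) with hσ
  have hσm : Measurable σ := hu.pow_const _
  have hσ0 : ∀ᵐ x, σ x ≠ 0 ∧ σ x ≠ ∞ := hu0.mono fun x hx => by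
    simp [hσ, ENNReal.rpow_eq_zero_iff, ENNReal.rpow_eq_top_iff, hx, hut x]
  -- Writing `|f| = φσ` turns the norm of `f` in `L^p(w)` into that of `φ` in `L^p(σ)`, because `(1
  -- - p')(1 - p) = 1`.
  set φ : (Fin n → ℝ) → ℝ≥0∞ := fun x => ENNReal.ofReal |g x| * (σ x)⁻¹ with hφ
  have hφm : Measurable φ := by fun_prop
  have hφp : ∫⁻ x, φ x ^ p ∂volume.withDensity σ =
      ∫⁻ x, ENNReal.ofReal |g x| ^ p ∂volume.withDensity u := by
    rw [lintegral_withDensity_eq_lintegral_mul _ hσm (hφm.pow_const _),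
      lintegral_withDensity_eq_lintegral_mul _ hu (by fun_prop)]
    refine lintegral_congr_ae (hu0.mono fun x hx => ?_)
    simp only [Pi.mul_apply, hφ]
    rw [ENNReal.mul_rpow_of_nonneg _ _ hp0.le, mul_left_comm, mul_comm]
    congr 1
    rw [hσ, ← ENNReal.rpow_neg, ← ENNReal.rpow_mul, ← ENNReal.rpow_add _ _ hx (hut x)]
    conv_rhs => rw [← ENNReal.rpow_one (u x)]
    congr 1
    have := hq.mul_eq_add
    linarith
  have hs : (p / r).HolderConjugate (p / r).conjExponent :=
    Real.HolderConjugate.conjExponent ((one_lt_div hr).2 hrp)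
  have e1 : 1 / (p / r) = r / p := one_div_div _ _
  have e2 : 1 / (p / r).conjExponent = 1 - r / p := by
    rw [← e1, one_div, one_div, ← hs.inv_add_inv_eq_one]; ring
  have hN := eLpNorm_real_eq g hp0 (volume.withDensity u)
  have hfin : ∫⁻ x, φ x ^ p ∂volume.withDensity σ ≠ ∞ := by
    have := (eLpNorm_congr_ae hfg').symm.trans_lt hf.2
    rw [hN] at this
    intro htop
    rw [← hφp, htop, ENNReal.top_rpow_of_pos (by positivity)] at this
    exact lt_irrefl _ this
  have hpos : 0 < apConst p w :=
    (hw.testing hp hu hut hwu hr hrp.le ha (k := 0) (m := 0) subset_rfl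
      (le_mul_of_one_le_left zero_le one_le_two)).1
  have h := eLpNorm_dyadicSquare_le_of_testing hr hr2 hq hs rfl hu hσm hφm
    (hw.lintegral_dyadicCube_ne_top hwu) (hw.lintegral_conj_dyadicCube_ne_top hp hu hwu)
    (K := ENNReal.ofReal (2 ^ (p * a)) * apConst p w ^ a) (f := g)
    (mul_ne_zero (by simp; positivity) (by
      simp [ENNReal.rpow_eq_zero_iff, hpos.ne', ha0.not_gt]))
    (ENNReal.mul_ne_top (by simp) (ENNReal.rpow_ne_top_of_nonneg ha0.le hw.apConst_lt_top.ne))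
    hgm.aestronglyMeasurable
    (hσ0.mono fun x hx => by
      simp only [hφ]
      rw [mul_assoc, ENNReal.inv_mul_cancel hx.1 hx.2, mul_one])
    hfin fun k m E _ hEQ hvol => by
      rw [e1, e2]
      exact (hw.testing hp hu hut hwu hr hrp.le ha hEQ hvol).2
  rw [dyadicSquare_congr hfg, eLpNorm_congr_ae hfg', hN, ← hφp]
  refine h.trans (le_of_eq ?_)
  have hdom := one_le_domConst n
  have e3 : 2 * (ENNReal.ofReal (domConst n) * (ENNReal.ofReal (2 ^ (p * a)) * apConst p w ^ a)) *
      ENNReal.ofReal (p / r) =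
      ENNReal.ofReal (2 * domConst n * 2 ^ (p * a) * (p / r)) * apConst p w ^ a := by
    rw [ENNReal.ofReal_mul (by positivity), ENNReal.ofReal_mul (by positivity),
      ENNReal.ofReal_mul (by positivity), ENNReal.ofReal_ofNat]
    ring
  rw [e3, ENNReal.mul_rpow_of_nonneg _ _ (by positivity), ← ENNReal.rpow_mul, mul_one_div,
    ENNReal.ofReal_rpow_of_nonneg (by positivity) (by positivity), ENNReal.ofReal_mul (by positivity),
    mul_right_comm (ENNReal.ofReal _)]

end

theorem weightedBound_dyadicSquare {p : ℝ} (hp : 1 < p) :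
    WeightedBound (dyadicSquare (n := n)) p (max (1 / 2) (1 / (p - 1))) := by
  have hp1 : 0 < p - 1 := by linarith
  -- The exponent produced is `max(1/r, 1/(p - 1))` subject to `r ≤ 2` and `r < p`. For `p ≤ 2` one
  -- takes `r = 1`, as `1/(p - 1) ≥ 1` dominates anyway; for `p > 2` one takes `r = 2`.
  obtain ⟨r, hr, hr2, hrp, hmax⟩ : ∃ r : ℝ, 0 < r ∧ r ≤ 2 ∧ r < p ∧
      max 1 (r / (p - 1)) / r = max (1 / 2) (1 / (p - 1)) := by
    rcases le_or_gt p 2 with h | h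
    · have h1 : 1 ≤ 1 / (p - 1) := (one_le_div hp1).2 (by linarith)
      exact ⟨1, one_pos, one_le_two, hp, by
        rw [max_eq_right h1, max_eq_right (by linarith), div_one]⟩
    · refine ⟨2, two_pos, le_rfl, h, ?_⟩
      rw [← max_div_div_right (by norm_num : (0 : ℝ) ≤ 2)]
      congr 1
      field_simp
  refine ⟨Real.toNNReal ((2 * domConst n * 2 ^ (p * max 1 (r / (p - 1))) * (p / r)) ^ (1 / r) *
    p.conjExponent), fun w hw f hf => ?_⟩
  rw [← hmax]
  exact hw.eLpNorm_dyadicSquare_le hp hr hr2 hrp rfl hf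

end SquareDyadic

namespace SquareDyadic

/-! ### Power weights in one coordinate -/

variable {n : ℕ}

theorem map_eval_restrict_pi (i : Fin n) (s : Fin n → Set ℝ) :
    ((volume : Measure (Fin n → ℝ)).restrict (Set.univ.pi s)).map (Function.eval i) =
      (∏ j ∈ Finset.univ.erase i, volume (s j)) • volume.restrict (s i) := by
  rw [volume_pi, Measure.restrict_pi_pi, Measure.pi_map_eval]
  simp only [Measure.restrict_apply_univ]

theorem setLIntegral_pi_eval (i : Fin n) (s : Fin n → Set ℝ) {F : ℝ → ℝ≥0∞} (hF : Measurable F) :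
    ∫⁻ x in Set.univ.pi s, F (x i) =
      (∏ j ∈ Finset.univ.erase i, volume (s j)) * ∫⁻ t in s i, F t := by
  rw [← smul_eq_mul, ← lintegral_smul_measure, ← map_eval_restrict_pi,
    lintegral_map hF (measurable_pi_apply i)]

theorem setLIntegral_cube_div (i : Fin n) (a : Fin n → ℝ) {h : ℝ} (hh : 0 < h) {F : ℝ → ℝ≥0∞}
    (hF : Measurable F) :
    (∫⁻ x in cube a h, F (x i)) / volume (cube a h) =
      (∫⁻ t in Set.Icc (a i) (a i + h), F t) / ENNReal.ofReal h := by
  have hc : cube a h = Set.univ.pi fun j => Set.Icc (a j) (a j + h) := (Set.pi_univ_Icc _ _).symm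
  have h1 := setLIntegral_pi_eval i (fun j => Set.Icc (a j) (a j + h)) (F := 1) measurable_const
  simp only [Pi.one_apply, setLIntegral_one] at h1
  rw [hc, h1, setLIntegral_pi_eval i _ hF, Real.volume_Icc, add_sub_cancel_left]
  refine ENNReal.mul_div_mul_left _ _ ?_ ?_
  · simp [hh]
  · exact (ENNReal.prod_lt_top fun j _ => by simp).ne

theorem setLIntegral_unitCube (i : Fin n) {F : ℝ → ℝ≥0∞} (hF : Measurable F) :
    ∫⁻ x in dyadicCube 0 0, F (x i) = ∫⁻ t in Set.Ico 0 1, F t := by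
  rw [dyadicCube_eq_pi, setLIntegral_pi_eval i _ hF]
  simp

theorem setAverage_pi_eval (i : Fin n) {s : Fin n → Set ℝ} (h0 : ∀ j, volume (s j) ≠ 0)
    (ht : ∀ j, volume (s j) ≠ ∞) {F : ℝ → ℝ} (hF : Measurable F) :
    ⨍ x in Set.univ.pi s, F (x i) = ⨍ t in s i, F t := by
  have hc0 : ∏ j ∈ Finset.univ.erase i, volume (s j) ≠ 0 := by
    simp [Finset.prod_eq_zero_iff, h0]
  have hct : ∏ j ∈ Finset.univ.erase i, volume (s j) ≠ ∞ :=
    (ENNReal.prod_lt_top fun j _ => (ht j).lt_top).ne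
  have hvol : volume (Set.univ.pi s) = (∏ j ∈ Finset.univ.erase i, volume (s j)) * volume (s i) := by
    have := setLIntegral_pi_eval i s (F := 1) measurable_const
    simpa using this
  have hint : ∫ x in Set.univ.pi s, F (x i) =
      (∏ j ∈ Finset.univ.erase i, volume (s j)).toReal * ∫ t in s i, F t := by
    rw [← smul_eq_mul, ← integral_smul_measure, ← map_eval_restrict_pi]
    exact (integral_map (measurable_pi_apply i).aemeasurable hF.aestronglyMeasurable).symm
  rw [setAverage_eq, setAverage_eq, hint, Measure.real, hvol, ENNReal.toReal_mul, Measure.real,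
    smul_eq_mul, smul_eq_mul]
  have h1 := (ENNReal.toReal_pos hc0 hct).ne'
  have h2 := (ENNReal.toReal_pos (h0 i) (ht i)).ne'
  field_simp

theorem setLIntegral_Ioc_rpow {c : ℝ} (hc : -1 < c) {R : ℝ} (hR : 0 ≤ R) :
    ∫⁻ t in Set.Ioc 0 R, ‖t‖ₑ ^ c = ENNReal.ofReal (R ^ (c + 1) / (c + 1)) := by
  have h1 := intervalIntegral.intervalIntegrable_rpow' (a := 0) (b := R) hc
  have h2 : ∫⁻ t in Set.Ioc 0 R, ‖t‖ₑ ^ c = ∫⁻ t in Set.Ioc 0 R, ENNReal.ofReal (t ^ c) :=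
    setLIntegral_congr_fun measurableSet_Ioc fun t ht => by
      rw [Real.enorm_of_nonneg ht.1.le, ENNReal.ofReal_rpow_of_pos ht.1]
  rw [h2, ← ofReal_integral_eq_lintegral_ofReal, ← intervalIntegral.integral_of_le hR,
    integral_rpow (Or.inl hc), Real.zero_rpow (by linarith), sub_zero]
  · rwa [intervalIntegrable_iff_integrableOn_Ioc_of_le hR] at h1
  · exact (ae_restrict_iff' measurableSet_Ioc).2 (ae_of_all _ fun t ht => Real.rpow_nonneg ht.1.le _)

theorem setLIntegral_Icc_neg_rpow {c : ℝ} (hc : -1 < c) {R : ℝ} (hR : 0 ≤ R) :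
    ∫⁻ t in Set.Icc (-R) R, ‖t‖ₑ ^ c ≤ ENNReal.ofReal (2 * (R ^ (c + 1) / (c + 1))) := by
  have h1 : ∫⁻ t in Set.Ico (-R) 0, ‖t‖ₑ ^ c = ∫⁻ t in Set.Ioc 0 R, ‖t‖ₑ ^ c := by
    have := (Measure.measurePreserving_neg (volume : Measure ℝ)).setLIntegral_comp_preimage
      (s := Set.Ioc 0 R) (f := fun t => ‖t‖ₑ ^ c) measurableSet_Ioc (by fun_prop)
    simpa using this
  calc _ ≤ ∫⁻ t in Set.Ico (-R) 0 ∪ ({0} ∪ Set.Ioc 0 R), ‖t‖ₑ ^ c := by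
        refine lintegral_mono_set fun t ht => ?_
        rcases lt_trichotomy t 0 with h | h | h
        · exact Or.inl ⟨ht.1, h⟩
        · exact Or.inr (Or.inl h)
        · exact Or.inr (Or.inr ⟨h, ht.2⟩)
    _ ≤ (∫⁻ t in Set.Ico (-R) 0, ‖t‖ₑ ^ c) + ((∫⁻ t in ({0} : Set ℝ), ‖t‖ₑ ^ c) +
        ∫⁻ t in Set.Ioc 0 R, ‖t‖ₑ ^ c) :=
      (lintegral_union_le _ _ _).trans (add_le_add le_rfl (lintegral_union_le _ _ _))
    _ = _ := by
      have h2 : 0 ≤ R ^ (c + 1) / (c + 1) := div_nonneg (Real.rpow_nonneg hR _) (by linarith)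
      rw [h1, setLIntegral_Ioc_rpow hc hR, two_mul, ENNReal.ofReal_add h2 h2,
        Measure.restrict_eq_zero.2 (by simp : volume ({0} : Set ℝ) = 0), lintegral_zero_measure,
        zero_add]

theorem setLIntegral_div_le {I : Set ℝ} (hI : MeasurableSet I) {h : ℝ}
    (hvol : volume I = ENNReal.ofReal h) {F : ℝ → ℝ≥0∞} {C : ℝ≥0∞} (hF : ∀ t ∈ I, F t ≤ C) :
    (∫⁻ t in I, F t) / ENNReal.ofReal h ≤ C := by
  refine ENNReal.div_le_of_le_mul ?_
  rw [← hvol, ← setLIntegral_const]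
  exact setLIntegral_mono' hI hF

/-- The Muckenhoupt type bound for the powers of `|t|` over intervals. -/
theorem powerWeight_interval_le {b t : ℝ} (hb0 : 0 ≤ b) (hb1 : b < 1) (ht : 0 < t) (v : ℝ) {h : ℝ}
    (hh : 0 < h) :
    (∫⁻ x in Set.Icc v (v + h), ‖x‖ₑ ^ (-b)) / ENNReal.ofReal h *
      ((∫⁻ x in Set.Icc v (v + h), ‖x‖ₑ ^ (b / t)) / ENNReal.ofReal h) ^ t ≤
      ENNReal.ofReal (4 / (1 - b)) := by
  have hvol : volume (Set.Icc v (v + h)) = ENNReal.ofReal h := by simp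
  have hb' : 0 < 1 - b := by linarith
  have hbt : 0 ≤ b / t := by positivity
  have upper : ∀ {ρ : ℝ}, 0 < ρ → (∀ x ∈ Set.Icc v (v + h), |x| ≤ ρ) →
      ((∫⁻ x in Set.Icc v (v + h), ‖x‖ₑ ^ (b / t)) / ENNReal.ofReal h) ^ t ≤
        ENNReal.ofReal ρ ^ b := by
    intro ρ hρ hle
    calc _ ≤ (ENNReal.ofReal ρ ^ (b / t)) ^ t := by
          gcongr
          refine setLIntegral_div_le measurableSet_Icc hvol fun x hx => ?_
          rw [Real.enorm_eq_ofReal_abs]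
          gcongr
          exact hle x hx
      _ = _ := by rw [← ENNReal.rpow_mul, div_mul_cancel₀ _ ht.ne']
  have far : ∀ {ρ : ℝ}, 0 < ρ → (∀ x ∈ Set.Icc v (v + h), ρ ≤ |x| ∧ |x| ≤ 2 * ρ) →
      (∫⁻ x in Set.Icc v (v + h), ‖x‖ₑ ^ (-b)) / ENNReal.ofReal h *
        ((∫⁻ x in Set.Icc v (v + h), ‖x‖ₑ ^ (b / t)) / ENNReal.ofReal h) ^ t ≤
        ENNReal.ofReal (4 / (1 - b)) := by
    intro ρ hρ hle
    calc _ ≤ ENNReal.ofReal ρ ^ (-b) * ENNReal.ofReal (2 * ρ) ^ b := by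
          refine mul_le_mul' (setLIntegral_div_le measurableSet_Icc hvol fun x hx => ?_)
            (upper (by positivity) fun x hx => (hle x hx).2)
          rw [Real.enorm_eq_ofReal_abs, ENNReal.rpow_neg, ENNReal.rpow_neg, ENNReal.inv_le_inv]
          gcongr
          exact (hle x hx).1
      _ = ENNReal.ofReal (2 ^ b) := by
          rw [ENNReal.ofReal_rpow_of_pos hρ, ENNReal.ofReal_rpow_of_pos (by positivity),
            ← ENNReal.ofReal_mul (by positivity), Real.mul_rpow (by norm_num) hρ.le,
            mul_left_comm, ← Real.rpow_add hρ, neg_add_cancel, Real.rpow_zero, mul_one]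
      _ ≤ _ := by
          gcongr
          calc (2 : ℝ) ^ b ≤ 2 ^ (1 : ℝ) := by gcongr; norm_num
            _ ≤ 4 / (1 - b) := by
              rw [Real.rpow_one, le_div_iff₀ hb']; linarith
  -- Either `|x|` varies by at most a factor 2 on the interval, or the interval lies in `[-2h, 2h]`,
  -- where the singular power is integrated and produces `1/(1 - b)`.
  rcases lt_or_ge h v with h1 | h1
  · refine far (ρ := v) (hh.trans h1) fun x hx => ?_
    rw [abs_of_pos (by linarith [hx.1])]
    exact ⟨hx.1, by linarith [hx.2]⟩
  rcases lt_or_ge v (-(2 * h)) with h2 | h2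
  · refine far (ρ := -(v + h)) (by linarith) fun x hx => ?_
    rw [abs_of_neg (by linarith [hx.2])]
    exact ⟨by linarith [hx.2], by linarith [hx.1]⟩
  · have hsub : Set.Icc v (v + h) ⊆ Set.Icc (-(2 * h)) (2 * h) :=
      Set.Icc_subset_Icc h2 (by linarith)
    have h3 := (lintegral_mono_set (μ := volume) (f := fun x : ℝ => ‖x‖ₑ ^ (-b)) hsub).trans
      (setLIntegral_Icc_neg_rpow (c := -b) (by linarith) (by positivity : 0 ≤ 2 * h))
    calc _ ≤ ENNReal.ofReal (2 * ((2 * h) ^ (-b + 1) / (-b + 1))) / ENNReal.ofReal h *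
          ENNReal.ofReal (2 * h) ^ b := by
          gcongr
          exact upper (by positivity) fun x hx => abs_le.2 (hsub hx)
      _ = _ := by
          rw [← ENNReal.ofReal_div_of_pos hh, ENNReal.ofReal_rpow_of_pos (by positivity),
            ← ENNReal.ofReal_mul (by
              have : 0 < -b + 1 := by linarith
              positivity)]
          congr 1
          rw [Real.rpow_add (by positivity), Real.rpow_neg (by positivity), Real.rpow_one]
          have h4 : (2 * h) ^ b ≠ 0 := (Real.rpow_pos_of_pos (by positivity) b).ne'
          have h5 : -b + 1 ≠ 0 := by linarith
          have h6 : 1 - b ≠ 0 := hb'.ne'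
          field_simp
          ring

/-- The weight `|x i| ^ c`. -/
noncomputable def powerWeight (i : Fin n) (c : ℝ) (x : Fin n → ℝ) : ℝ := |x i| ^ c

theorem powerWeight_nonneg (i : Fin n) (c : ℝ) (x : Fin n → ℝ) : 0 ≤ powerWeight i c x :=
  Real.rpow_nonneg (abs_nonneg _) _

theorem ae_eval_ne_zero (i : Fin n) : ∀ᵐ x : Fin n → ℝ, x i ≠ 0 :=
  Measure.ae_eval_ne (fun _ => volume) i 0

theorem ofReal_powerWeight (i : Fin n) (c : ℝ) :
    (fun x => ENNReal.ofReal (powerWeight i c x)) =ᵐ[volume] fun x => ‖x i‖ₑ ^ c := by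
  filter_upwards [ae_eval_ne_zero i] with x hx
  rw [powerWeight, Real.enorm_eq_ofReal_abs, ENNReal.ofReal_rpow_of_pos (abs_pos.2 hx)]

theorem apConst_powerWeight_le {p c : ℝ} (i : Fin n) {C : ℝ≥0∞}
    (h : ∀ (v : ℝ) {h : ℝ}, 0 < h →
      (∫⁻ x in Set.Icc v (v + h), ‖x‖ₑ ^ c) / ENNReal.ofReal h *
        ((∫⁻ x in Set.Icc v (v + h), ‖x‖ₑ ^ (c * (1 - p.conjExponent))) / ENNReal.ofReal h) ^
          (p - 1) ≤ C) : apConst p (powerWeight i c) ≤ C := by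
  refine iSup_le fun a => iSup₂_le fun l hl => ?_
  have hw := ofReal_powerWeight i c
  have hw' : (fun x => ENNReal.ofReal (powerWeight i c x) ^ (1 - p.conjExponent)) =ᵐ[volume]
      fun x => ‖x i‖ₑ ^ (c * (1 - p.conjExponent)) := hw.mono fun x hx => by
    simp only at hx ⊢
    rw [hx, ENNReal.rpow_mul]
  rw [setLAverage_eq, setLAverage_eq, lintegral_congr_ae (ae_restrict_of_ae hw),
    lintegral_congr_ae (ae_restrict_of_ae hw'),
    setLIntegral_cube_div i a hl (F := fun t => ‖t‖ₑ ^ c) (by fun_prop),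
    setLIntegral_cube_div i a hl (F := fun t => ‖t‖ₑ ^ (c * (1 - p.conjExponent))) (by fun_prop)]
  exact h (a i) hl

theorem isApWeight_powerWeight {p c : ℝ} (i : Fin n) (hc : -1 < c)
    (h : apConst p (powerWeight i c) < ∞) : IsApWeight p (powerWeight i c) where
  nonneg := powerWeight_nonneg i c
  apConst_lt_top := h
  not_ae_zero h0 := by
    obtain ⟨x, hx, hx0⟩ := (h0.and (ae_eval_ne_zero i)).exists
    exact (Real.rpow_pos_of_pos (abs_pos.2 hx0) c).ne' hx
  locallyIntegrable x := by
    obtain ⟨N, hN⟩ := exists_nat_gt ‖x‖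
    refine ⟨centredCube n N, ?_, ?_, ?_⟩
    · refine mem_of_superset (Metric.ball_mem_nhds (x := x) (ε := N - ‖x‖) (by linarith))
        fun y hy => ?_
      have h1 := norm_le_norm_add_norm_sub' y x
      rw [Metric.mem_ball, dist_eq_norm] at hy
      exact mem_centredCube.2 (by linarith)
    · have : Measurable (powerWeight i c) := by unfold powerWeight; fun_prop
      exact this.aestronglyMeasurable
    · rw [hasFiniteIntegral_iff_ofReal (ae_of_all _ (powerWeight_nonneg i c)),
        lintegral_congr_ae (ae_restrict_of_ae (ofReal_powerWeight i c)), centredCube, cube,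
        ← Set.pi_univ_Icc, setLIntegral_pi_eval i _ (F := fun t => ‖t‖ₑ ^ c) (by fun_prop)]
      refine ENNReal.mul_lt_top (ENNReal.prod_lt_top fun j _ => by
        rw [Real.volume_Icc]; exact ENNReal.ofReal_lt_top) ?_
      have h1 : -(N : ℝ) + 2 * N = N := by ring
      rw [h1]
      exact (setLIntegral_Icc_neg_rpow hc N.cast_nonneg).trans_lt ENNReal.ofReal_lt_top

theorem apConst_powerWeight_neg_le {p b : ℝ} (hp : 1 < p) (i : Fin n) (hb0 : 0 ≤ b) (hb1 : b < 1) :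
    apConst p (powerWeight i (-b)) ≤ ENNReal.ofReal (4 / (1 - b)) := by
  refine apConst_powerWeight_le i fun v h hh => ?_
  have hp1 : p - 1 ≠ 0 := by linarith
  have h1 : -b * (1 - p.conjExponent) = b / (p - 1) := by
    rw [Real.conjExponent]; field_simp; ring
  rw [h1]
  exact powerWeight_interval_le hb0 hb1 (by linarith) v hh

/-- The dual weight is `|x_i|^{-b}`, so this is the interval estimate with `t = 1/(p - 1)`, raised
to the power `p - 1`. -/
theorem apConst_powerWeight_pos_le {p b : ℝ} (hp : 1 < p) (i : Fin n) (hb0 : 0 ≤ b) (hb1 : b < 1) :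
    apConst p (powerWeight i (b * (p - 1))) ≤ ENNReal.ofReal (4 / (1 - b)) ^ (p - 1) := by
  refine apConst_powerWeight_le i fun v h hh => ?_
  have hp1 : 0 < p - 1 := by linarith
  have h1 : b * (p - 1) * (1 - p.conjExponent) = -b := by
    rw [Real.conjExponent]; field_simp; ring
  have h2 := ENNReal.rpow_le_rpow (powerWeight_interval_le hb0 hb1 (one_div_pos.2 hp1) v hh) hp1.le
  rw [ENNReal.mul_rpow_of_nonneg _ _ hp1.le, ← ENNReal.rpow_mul, one_div_mul_cancel hp1.ne',
    ENNReal.rpow_one, div_div_eq_mul_div, div_one, mul_comm] at h2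
  rwa [h1]

end SquareDyadic

namespace SquareDyadic

/-! ### Lower bounds for the square function of functions of one coordinate -/

variable {n : ℕ}

/-- The function `F (x i)` cut off to the unit cube. -/
noncomputable def cutoff (i : Fin n) (F : ℝ → ℝ) : (Fin n → ℝ) → ℝ :=
  (dyadicCube 0 0).indicator fun x => F (x i)

/-- The mean of `F` over the dyadic interval of length `2 ^ k` at position `j`. -/
noncomputable def intervalMean (F : ℝ → ℝ) (k j : ℤ) : ℝ :=
  ⨍ t in Set.Ico ((2 : ℝ) ^ k * j) ((2 : ℝ) ^ k * (j + 1)), F t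

theorem dyadicCube_subset_unitCube {x : Fin n → ℝ} (hx : x ∈ dyadicCube 0 0) (k : ℕ) :
    dyadicCube (-k) (cubeIndex (-k) x) ⊆ dyadicCube 0 0 := by
  induction k with
  | zero =>
    rw [Nat.cast_zero, neg_zero, mem_dyadicCube_iff.1 hx]
  | succ k ih =>
    refine subset_trans ?_ ih
    have := dyadicCube_subset_dyadicParent (-((k + 1 : ℕ) : ℤ)) (cubeIndex (-((k + 1 : ℕ) : ℤ)) x)
    rw [dyadicParent, ← cubeIndex_succ] at this
    rwa [show (-((k + 1 : ℕ) : ℤ)) + 1 = -k by push_cast; ring] at this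

/-- A dyadic cube of level at most zero through a point of the unit cube lies inside it, so the
cutoff is invisible and the problem becomes one-dimensional. -/
theorem cubeMean_cutoff (i : Fin n) {F : ℝ → ℝ} (hF : Measurable F) {x : Fin n → ℝ}
    (hx : x ∈ dyadicCube 0 0) (k : ℕ) :
    cubeMean (cutoff i F) (-k) (cubeIndex (-k) x) = intervalMean F (-k) (cubeIndex (-k) x i) := by
  have hk : (0 : ℝ) < 2 ^ (-(k : ℤ)) := by positivity
  have h1 : cubeMean (cutoff i F) (-k) (cubeIndex (-k) x) =
      ⨍ y in dyadicCube (-k) (cubeIndex (-k) x), F (y i) :=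
    setAverage_congr_fun (measurableSet_dyadicCube _ _) (ae_of_all _ fun y hy =>
      Set.indicator_of_mem (dyadicCube_subset_unitCube hx k hy) _)
  rw [h1, dyadicCube_eq_pi, setAverage_pi_eval i ?_ ?_ hF, intervalMean]
  · intro j
    simp [Real.volume_Ico, mul_add]
  · intro j
    simp [Real.volume_Ico]

theorem sqIncrement_cutoff (i : Fin n) {F : ℝ → ℝ} (hF : Measurable F) {x : Fin n → ℝ}
    (hx : x ∈ dyadicCube 0 0) (k : ℕ) :
    sqIncrement (cubeMean (cutoff i F)) (-k) x =
      (intervalMean F (-(k + 1 : ℕ)) (cubeIndex (-(k + 1 : ℕ)) x i) -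
        intervalMean F (-k) (cubeIndex (-k) x i)) ^ 2 := by
  rw [sqIncrement, ← cubeMean_cutoff i hF hx k, ← cubeMean_cutoff i hF hx (k + 1)]
  have : -(k : ℤ) - 1 = -((k + 1 : ℕ) : ℤ) := by push_cast; ring
  rw [this]

theorem cubeIndex_eq_zero {i : Fin n} {x : Fin n → ℝ} {k : ℤ} (h0 : 0 ≤ x i) (h : x i < 2 ^ k) :
    cubeIndex k x i = 0 := by
  have hk : (0 : ℝ) < 2 ^ k := by positivity
  rw [cubeIndex, Int.floor_eq_zero_iff]
  exact ⟨by positivity, (div_lt_one hk).2 h⟩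

theorem cubeIndex_eq_one {i : Fin n} {x : Fin n → ℝ} {k : ℤ} (h0 : 2 ^ k ≤ x i)
    (h : x i < 2 ^ k * 2) : cubeIndex k x i = 1 := by
  have hk : (0 : ℝ) < 2 ^ k := by positivity
  rw [cubeIndex, Int.floor_eq_iff]
  constructor
  · rw [Int.cast_one, one_le_div hk]; exact h0
  · rw [div_lt_iff₀ hk]; push_cast; linarith

theorem rpow_sum_le_dyadicSquare (f : (Fin n → ℝ) → ℝ) (x : Fin n → ℝ) (s : Finset ℤ) {c : ℝ}
    (hc : c ≤ ∑ k ∈ s, sqIncrement (cubeMean f) k x) :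
    ENNReal.ofReal c ^ (1 / 2 : ℝ) ≤ dyadicSquare f x := by
  rw [dyadicSquare_eq_tsum]
  gcongr
  refine (ENNReal.ofReal_le_ofReal hc).trans ?_
  rw [ENNReal.ofReal_sum_of_nonneg fun k _ => sqIncrement_nonneg k x]
  exact ENNReal.sum_le_tsum s

theorem intervalMean_eq (F : ℝ → ℝ) (k j : ℤ) :
    intervalMean F k j = (2 ^ k)⁻¹ * ∫ t in (2 : ℝ) ^ k * j..2 ^ k * (j + 1), F t := by
  have hk : (0 : ℝ) < 2 ^ k := by positivity
  have h1 : (2 : ℝ) ^ k * j ≤ 2 ^ k * (j + 1) := by nlinarith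
  rw [intervalMean, setAverage_eq, integral_Ico_eq_integral_Ioo, ← integral_Ioc_eq_integral_Ioo,
    intervalIntegral.integral_of_le h1, Real.volume_real_Ico_of_le h1, smul_eq_mul]
  congr 2; ring

/-! #### The power function -/

theorem intervalMean_rpow_sub {δ : ℝ} (hδ : 0 < δ) (k : ℕ) :
    intervalMean (fun t => |t| ^ (δ - 1)) (-(k + 1 : ℕ)) 1 -
      intervalMean (fun t => |t| ^ (δ - 1)) (-k) 0 =
      -(((2 : ℝ) ^ (-(k : ℤ))) ^ (δ - 1) / δ * (2 ^ (1 - δ) - 1)) := by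
  set y : ℝ := 2 ^ (-(k : ℤ)) with hy
  have hy0 : 0 < y := by positivity
  have hy2 : (2 : ℝ) ^ (-((k + 1 : ℕ) : ℤ)) = y / 2 := by
    rw [Nat.cast_succ, neg_add, ← sub_eq_add_neg, zpow_sub_one₀ (by norm_num), div_eq_mul_inv]
  have hI : ∀ a b : ℝ, 0 ≤ a → a ≤ b →
      ∫ t in a..b, |t| ^ (δ - 1) = (b ^ δ - a ^ δ) / δ := by
    intro a b ha hab
    have h1 : ∫ t in a..b, |t| ^ (δ - 1) = ∫ t in a..b, t ^ (δ - 1) := by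
      refine intervalIntegral.integral_congr fun t ht => ?_
      rw [Set.uIcc_of_le hab] at ht
      simp only [abs_of_nonneg (ha.trans ht.1)]
    rw [h1, integral_rpow (Or.inl (by linarith)), sub_add_cancel]
  rw [intervalMean_eq, intervalMean_eq, hy2, ← hy]
  simp only [Int.cast_one, Int.cast_zero, mul_zero, mul_one, zero_add]
  rw [hI _ _ (by positivity) (by linarith), hI _ _ le_rfl hy0.le, Real.zero_rpow hδ.ne',
    show y / 2 * (1 + 1) = y by ring, Real.div_rpow hy0.le (by norm_num), Real.rpow_sub hy0,
    Real.rpow_sub (by norm_num), Real.rpow_one, Real.rpow_one]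
  have h2 : (2 : ℝ) ^ δ ≠ 0 := (Real.rpow_pos_of_pos (by norm_num) δ).ne'
  field_simp
  ring

/-- For `x i` in `[y/2, y)` with `y` dyadic, a single jump suffices: the mean over `[0, y)` carries
the factor `1/δ` and beats the mean over `[y/2, y)`. -/
theorem ofReal_mul_le_dyadicSquare_rpow (i : Fin n) {δ : ℝ} (hδ : 0 < δ) (hδ2 : δ ≤ 1 / 2) :
    ∀ᵐ x : Fin n → ℝ, ENNReal.ofReal (1 / (5 * δ)) *
      ENNReal.ofReal |cutoff i (fun t => |t| ^ (δ - 1)) x| ≤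
        dyadicSquare (cutoff i fun t => |t| ^ (δ - 1)) x := by
  filter_upwards [ae_eval_ne_zero i] with x hx0
  by_cases hx : x ∈ dyadicCube 0 0
  swap
  · rw [cutoff, Set.indicator_of_notMem hx]; simp
  have hxi : 0 < x i ∧ x i < 1 := by
    have := hx i
    simp only [zpow_zero, one_mul, Pi.zero_apply, Int.cast_zero, zero_add] at this
    exact ⟨lt_of_le_of_ne this.1 hx0.symm, this.2⟩
  obtain ⟨k, hk⟩ : ∃ k : ℕ, Int.log 2 (x i) = -((k + 1 : ℕ) : ℤ) := by
    have h1 : Int.log 2 (x i) < 0 := by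
      by_contra! h
      have h2 : (1 : ℝ) ≤ x i := by
        have h3 := (Int.zpow_le_iff_le_log (by norm_num : 1 < 2) hxi.1).2 h
        simpa using h3
      linarith
    exact ⟨(-Int.log 2 (x i) - 1).toNat, by omega⟩
  have hlow := Int.zpow_log_le_self (b := 2) (by norm_num) hxi.1
  have hupp := Int.lt_zpow_succ_log_self (b := 2) (by norm_num) (x i)
  rw [hk] at hlow hupp
  push_cast at hlow
  have hk1 : -((k + 1 : ℕ) : ℤ) + 1 = -(k : ℤ) := by push_cast; ring
  rw [hk1] at hupp
  push_cast at hupp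
  have hy2 : (2 : ℝ) ^ (-((k + 1 : ℕ) : ℤ)) = 2 ^ (-(k : ℤ)) / 2 := by
    rw [Nat.cast_succ, neg_add, ← sub_eq_add_neg, zpow_sub_one₀ (by norm_num), div_eq_mul_inv]
  have hlow' : (2 : ℝ) ^ (-((k + 1 : ℕ) : ℤ)) ≤ x i := by push_cast; exact hlow
  have hF : Measurable fun t : ℝ => |t| ^ (δ - 1) := by fun_prop
  have hinc := sqIncrement_cutoff i hF hx k
  rw [cubeIndex_eq_one hlow' (by rw [hy2]; linarith), cubeIndex_eq_zero hxi.1.le hupp,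
    intervalMean_rpow_sub hδ, neg_sq] at hinc
  set y : ℝ := 2 ^ (-(k : ℤ)) with hy
  have hy0 : 0 < y := by positivity
  -- Hence the jump is at least `(2/5) y^{δ-1}/δ`. As `f ≤ 2 y^{δ-1}`, the ratio is at least
  -- `1/(5δ)`.
  have h14 : (7 / 5 : ℝ) ≤ 2 ^ (1 - δ) := by
    calc (7 / 5 : ℝ) ≤ √2 := Real.le_sqrt_of_sq_le (by norm_num)
      _ = 2 ^ (1 / 2 : ℝ) := Real.sqrt_eq_rpow 2
      _ ≤ _ := Real.rpow_le_rpow_of_exponent_le (by norm_num) (by linarith)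
  have hyp : 0 < y ^ (δ - 1) := Real.rpow_pos_of_pos hy0 _
  have hxy : |x i| ^ (δ - 1) ≤ 2 * y ^ (δ - 1) := by
    rw [abs_of_pos hxi.1]
    calc x i ^ (δ - 1) ≤ (y / 2) ^ (δ - 1) :=
          Real.rpow_le_rpow_of_nonpos (by positivity) (hy2 ▸ hlow') (by linarith)
      _ = 2 ^ (1 - δ) * y ^ (δ - 1) := by
          rw [Real.div_rpow hy0.le (by norm_num), show 1 - δ = -(δ - 1) by ring,
            Real.rpow_neg (by norm_num)]
          field_simp
      _ ≤ 2 ^ (1 : ℝ) * y ^ (δ - 1) := by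
          gcongr
          · norm_num
          · linarith
      _ = _ := by rw [Real.rpow_one]
  have h3 := rpow_sum_le_dyadicSquare (cutoff i fun t => |t| ^ (δ - 1)) x {-(k : ℤ)}
    (c := (1 / (5 * δ) * |x i| ^ (δ - 1)) ^ 2) (by
      rw [Finset.sum_singleton, hinc]
      refine pow_le_pow_left₀ (by positivity) ?_ 2
      calc 1 / (5 * δ) * |x i| ^ (δ - 1) ≤ 1 / (5 * δ) * (2 * y ^ (δ - 1)) := by gcongr
        _ = y ^ (δ - 1) / δ * (2 / 5) := by field_simp
        _ ≤ _ := by gcongr; linarith)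
  have hnn : 0 ≤ 1 / (5 * δ) * |x i| ^ (δ - 1) := by positivity
  rw [ENNReal.ofReal_rpow_of_nonneg (by positivity) (by norm_num), ← Real.sqrt_eq_rpow,
    Real.sqrt_sq hnn, ENNReal.ofReal_mul (by positivity)] at h3
  rw [cutoff, Set.indicator_of_mem hx, abs_of_nonneg (by positivity)]
  exact h3

/-! #### The alternating function -/

/-- The function equal to `(-1) ^ k` on `[2 ^ k, 2 ^ (k + 1))`. -/
noncomputable def alternating (t : ℝ) : ℝ := (-1) ^ Int.log 2 t

theorem alternating_half {t : ℝ} (ht : 0 < t) : alternating (t / 2) = -alternating t := by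
  have h : Int.log 2 (t / 2) = Int.log 2 t - 1 := by
    have h1 := Int.zpow_log_le_self (b := 2) (by norm_num) ht
    have h2 := Int.lt_zpow_succ_log_self (b := 2) (by norm_num) t
    push_cast at h1 h2
    have h3 : Int.log 2 t - 1 ≤ Int.log 2 (t / 2) := by
      refine (Int.zpow_le_iff_le_log (by norm_num : 1 < 2) (by positivity)).1 ?_
      rw [zpow_sub_one₀ (by norm_num)]; push_cast; linarith
    have h4 : Int.log 2 (t / 2) < Int.log 2 t := by
      refine (Int.lt_zpow_iff_log_lt (by norm_num : 1 < 2) (by positivity)).1 ?_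
      rw [zpow_add_one₀ (by norm_num)] at h2; push_cast; linarith
    omega
  rw [alternating, alternating, h, zpow_sub_one₀ (by norm_num)]
  norm_num

theorem abs_alternating (t : ℝ) : |alternating t| = 1 := by
  rw [alternating, abs_zpow, abs_neg, abs_one, one_zpow]

theorem measurable_alternating : Measurable alternating := by
  have h : Measurable (Int.log 2 : ℝ → ℤ) := by
    refine measurable_to_countable' fun k => ?_
    have hk : Int.log 2 ⁻¹' {k} =
        Set.Ico ((2 : ℝ) ^ k) (2 ^ (k + 1)) ∪ (Set.Iic 0 ∩ {_t | 0 = k}) := by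
      ext t
      simp only [Set.mem_preimage, Set.mem_singleton_iff, Set.mem_union, Set.mem_Ico, Set.mem_inter_iff,
        Set.mem_Iic, Set.mem_ofPred_eq]
      rcases le_or_gt t 0 with ht | ht
      · have h1 : ¬ (2 : ℝ) ^ k ≤ t := not_le.2 (ht.trans_lt (by positivity))
        simp [Int.log_of_right_le_zero 2 ht, ht, h1]
      · have h1 := Int.zpow_le_iff_le_log (b := 2) (by norm_num) ht (x := k)
        have h2 := Int.lt_zpow_iff_log_lt (b := 2) (by norm_num) ht (x := k + 1)
        push_cast at h1 h2
        rw [h1, h2]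
        simp only [not_le.2 ht, false_and, or_false]
        omega
    rw [hk]
    exact measurableSet_Ico.union (measurableSet_Iic.inter (.const _))
  exact (measurable_of_countable fun k : ℤ => (-1 : ℝ) ^ k).comp h

theorem intervalIntegrable_alternating (a b : ℝ) :
    IntervalIntegrable alternating volume a b := by
  refine (intervalIntegrable_const (c := (1 : ℝ))).mono_fun
    measurable_alternating.aestronglyMeasurable (ae_of_all _ fun t => ?_)
  simp only [Real.norm_eq_abs, abs_alternating, abs_one, le_refl]

theorem integral_alternating_half (y : ℝ) (hy : 0 < y) :
    ∫ t in (0 : ℝ)..y / 2, alternating t = -(1 / 2) * ∫ t in (0 : ℝ)..y, alternating t := by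
  have h1 := intervalIntegral.integral_comp_div (a := 0) (b := y) alternating
    (by norm_num : (2 : ℝ) ≠ 0)
  rw [zero_div, smul_eq_mul] at h1
  have h2 : ∫ t in (0 : ℝ)..y, alternating (t / 2) = ∫ t in (0 : ℝ)..y, -alternating t := by
    refine intervalIntegral.integral_congr_ae (ae_of_all _ fun t ht => ?_)
    rw [Set.uIoc_of_le hy.le] at ht
    exact alternating_half ht.1
  rw [h2, intervalIntegral.integral_neg] at h1
  linarith

theorem integral_alternating_one : ∫ t in (0 : ℝ)..1, alternating t = -(1 / 3) := by
  have h1 := integral_alternating_half 1 one_pos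
  have h2 : ∫ t in (1 / 2 : ℝ)..1, alternating t = ∫ t in (1 / 2 : ℝ)..1, (-1 : ℝ) := by
    rw [intervalIntegral.integral_of_le (by norm_num), intervalIntegral.integral_of_le (by norm_num),
      integral_Ioc_eq_integral_Ioo, integral_Ioc_eq_integral_Ioo]
    refine setIntegral_congr_fun measurableSet_Ioo fun t ht => ?_
    have h0 : 0 < t := by linarith [ht.1]
    have h3 : Int.log 2 t = -1 := by
      have h4 : -1 ≤ Int.log 2 t :=
        (Int.zpow_le_iff_le_log (by norm_num : 1 < 2) h0).1 (by norm_num; linarith [ht.1])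
      have h5 : Int.log 2 t < 0 :=
        (Int.lt_zpow_iff_log_lt (by norm_num : 1 < 2) h0).1 (by norm_num; exact ht.2)
      omega
    simp [alternating, h3]
  have h3 := intervalIntegral.integral_add_adjacent_intervals
    (intervalIntegrable_alternating 0 (1 / 2)) (intervalIntegrable_alternating (1 / 2) 1)
  rw [h2, intervalIntegral.integral_const, smul_eq_mul] at h3
  linarith

theorem intervalMean_alternating (k : ℕ) :
    intervalMean alternating (-k) 0 = (-1) ^ (k + 1) / 3 := by
  rw [intervalMean_eq]
  simp only [Int.cast_zero, mul_zero, zero_add, mul_one]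
  induction k with
  | zero => simp [integral_alternating_one]; norm_num
  | succ k ih =>
    have hy2 : (2 : ℝ) ^ (-((k + 1 : ℕ) : ℤ)) = 2 ^ (-(k : ℤ)) / 2 := by
      rw [Nat.cast_succ, neg_add, ← sub_eq_add_neg, zpow_sub_one₀ (by norm_num), div_eq_mul_inv]
    rw [hy2, integral_alternating_half _ (by positivity), pow_succ, mul_neg_one, neg_div, ← ih]
    have : (2 : ℝ) ^ (-(k : ℤ)) ≠ 0 := by positivity
    field_simp

/-- The means over `[0, 2^{-j})` alternate between `-1/3` and `1/3`, so each of the `k` jumps seen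
by `x` contributes `(2/3)²`. -/
theorem rpow_le_dyadicSquare_alternating (i : Fin n) {x : Fin n → ℝ} (hx : x ∈ dyadicCube 0 0)
    {k : ℕ} (hk : x i < 2 ^ (-(k : ℤ))) :
    ENNReal.ofReal (4 * k / 9) ^ (1 / 2 : ℝ) ≤ dyadicSquare (cutoff i alternating) x := by
  have h0 : 0 ≤ x i := by
    have := (hx i).1
    simpa using this
  refine rpow_sum_le_dyadicSquare _ _ ((Finset.range k).map
    ⟨fun j : ℕ => -(j : ℤ), fun a b h => by simpa using h⟩) ?_
  rw [Finset.sum_map, Finset.sum_congr rfl (g := fun _ => (4 / 9 : ℝ))]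
  · simp; linarith
  · intro j hj
    rw [Finset.mem_range] at hj
    have hlt : ∀ l : ℕ, l ≤ k → x i < 2 ^ (-(l : ℤ)) := fun l hl =>
      hk.trans_le (zpow_le_zpow_right₀ (by norm_num) (by omega))
    change sqIncrement _ (-(j : ℤ)) x = _
    rw [sqIncrement_cutoff i measurable_alternating hx,
      cubeIndex_eq_zero h0 (hlt _ hj), cubeIndex_eq_zero h0 (hlt _ hj.le),
      intervalMean_alternating, intervalMean_alternating]
    rcases neg_one_pow_eq_or ℝ (j + 1) with h | h <;> rw [pow_succ _ (j + 1), h] <;> norm_num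

end SquareDyadic

namespace SquareDyadic

/-! ### Sharpness -/

variable {n : ℕ}

theorem IsApWeight.one_le_apConst {p : ℝ} {w : (Fin n → ℝ) → ℝ} (hp : 1 < p)
    (hw : IsApWeight p w) : 1 ≤ apConst p w := by
  obtain ⟨u, hu, hut, hwu⟩ := hw.exists_density
  have hq := Real.HolderConjugate.conjExponent hp
  have hp0 := hq.pos
  have hV : volume (dyadicCube (n := n) 0 0) = 1 := by simp [volume_dyadicCube, cubeVol]
  have h1 := volume_le_rpow_mul_rpow hp hu (hw.ae_ne_zero hp hu hwu) hut (dyadicCube 0 0)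
  have h2 := mul_rpow_le_apConst_dyadicCube (p := p) hwu 0 0
  rw [hV] at h1
  rw [hV, div_one, div_one] at h2
  refine le_trans ?_ h2
  have h3 := ENNReal.rpow_le_rpow h1 hp0.le
  rw [ENNReal.one_rpow, ENNReal.mul_rpow_of_nonneg _ _ hp0.le, ← ENNReal.rpow_mul,
    ← ENNReal.rpow_mul, one_div_mul_cancel hp0.ne', ENNReal.rpow_one] at h3
  have h4 : 1 / p.conjExponent * p = p - 1 := by
    have := hq.mul_eq_add
    have h0 := hq.symm.pos
    field_simp
    linarith
  rwa [h4] at h3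

theorem WeightedBound.mono {T : ((Fin n → ℝ) → ℝ) → (Fin n → ℝ) → ℝ≥0∞} {p β β' : ℝ} (hp : 1 < p)
    (h : WeightedBound T p β) (hβ : β ≤ β') : WeightedBound T p β' := by
  obtain ⟨c, hc⟩ := h
  refine ⟨c, fun w hw f hf => (hc w hw f hf).trans ?_⟩
  gcongr
  exact hw.one_le_apConst hp

theorem measurable_dyadicSquare (f : (Fin n → ℝ) → ℝ) : Measurable (dyadicSquare f) := by
  rw [funext (dyadicSquare_eq_tsum f)]
  exact (Measurable.tsum fun k =>
    (measurable_sqIncrement k).ennreal_ofReal).pow_const _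

theorem weightMeasure_powerWeight (i : Fin n) (c : ℝ) :
    weightMeasure (powerWeight i c) = volume.withDensity fun x => ‖x i‖ₑ ^ c :=
  withDensity_congr_ae (ofReal_powerWeight i c)

theorem weightMeasure_powerWeight_zero (i : Fin n) :
    weightMeasure (powerWeight i 0) = (volume : Measure (Fin n → ℝ)) := by
  rw [weightMeasure_powerWeight]
  simp only [ENNReal.rpow_zero]
  exact withDensity_one

theorem measurable_cutoff (i : Fin n) {F : ℝ → ℝ} (hF : Measurable F) : Measurable (cutoff i F) :=
  (hF.comp (measurable_pi_apply i)).indicator (measurableSet_dyadicCube 0 0)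

theorem lintegral_cutoff_rpow (i : Fin n) {F : ℝ → ℝ} (hF : Measurable F) {p : ℝ} (hp : 0 < p)
    (c : ℝ) : ∫⁻ x, ENNReal.ofReal |cutoff i F x| ^ p ∂weightMeasure (powerWeight i c) =
      ∫⁻ t in Set.Ioc 0 1, ‖t‖ₑ ^ c * ENNReal.ofReal |F t| ^ p := by
  have hm := measurable_cutoff i hF
  rw [weightMeasure_powerWeight, lintegral_withDensity_eq_lintegral_mul _ (by fun_prop) (by fun_prop),
    ← Measure.restrict_congr_set Ico_ae_eq_Ioc, ← setLIntegral_unitCube i (by fun_prop),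
    ← lintegral_indicator (measurableSet_dyadicCube 0 0)]
  congr 1
  funext x
  by_cases hx : x ∈ dyadicCube 0 0
  · simp only [Pi.mul_apply, cutoff, Set.indicator_of_mem hx]
  · simp [cutoff, Set.indicator_of_notMem hx, hp]

theorem eLpNorm_cutoff_rpow (i : Fin n) {p c δ : ℝ} (hp : 0 < p) (h : -1 < c + (δ - 1) * p) :
    eLpNorm (cutoff i fun t => |t| ^ (δ - 1)) (ENNReal.ofReal p) (weightMeasure (powerWeight i c)) =
      ENNReal.ofReal (1 / (c + (δ - 1) * p + 1)) ^ (1 / p) := by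
  rw [eLpNorm_real_eq _ hp, lintegral_cutoff_rpow i (by fun_prop) hp]
  have h1 : ∫⁻ t in Set.Ioc (0 : ℝ) 1, ‖t‖ₑ ^ c * ENNReal.ofReal |(|t| ^ (δ - 1))| ^ p =
      ∫⁻ t in Set.Ioc (0 : ℝ) 1, ‖t‖ₑ ^ (c + (δ - 1) * p) := by
    refine setLIntegral_congr_fun measurableSet_Ioc fun t ht => ?_
    have ht0 : ‖t‖ₑ ≠ 0 := by simpa using ht.1.ne'
    rw [abs_of_nonneg (Real.rpow_nonneg (abs_nonneg t) _), ENNReal.rpow_add _ _ ht0 (by simp),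
      ENNReal.rpow_mul, Real.enorm_eq_ofReal_abs, ← ENNReal.ofReal_rpow_of_pos (abs_pos.2 ht.1.ne')]
  rw [h1, setLIntegral_Ioc_rpow h zero_le_one, Real.one_rpow]

theorem eLpNorm_cutoff_alternating (i : Fin n) {p b : ℝ} (hp : 0 < p) (hb : b < 1) :
    eLpNorm (cutoff i alternating) (ENNReal.ofReal p) (weightMeasure (powerWeight i (-b))) =
      ENNReal.ofReal (1 / (1 - b)) ^ (1 / p) := by
  rw [eLpNorm_real_eq _ hp, lintegral_cutoff_rpow i measurable_alternating hp]
  simp only [abs_alternating, ENNReal.ofReal_one, ENNReal.one_rpow, mul_one]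
  rw [setLIntegral_Ioc_rpow (by linarith) zero_le_one, Real.one_rpow, neg_add_eq_sub]

theorem memLp_cutoff (i : Fin n) {F : ℝ → ℝ} (hF : Measurable F) {p c : ℝ}
    (h : eLpNorm (cutoff i F) (ENNReal.ofReal p) (weightMeasure (powerWeight i c)) ≠ ∞) :
    MemLp (cutoff i F) (ENNReal.ofReal p) (weightMeasure (powerWeight i c)) :=
  ⟨(measurable_cutoff i hF).aestronglyMeasurable, h.lt_top⟩

theorem mul_eLpNorm_cutoff_rpow_le (i : Fin n) {p c δ : ℝ} (hp : 0 < p) (hδ : 0 < δ)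
    (hδ2 : δ ≤ 1 / 2) :
    ENNReal.ofReal (1 / (5 * δ)) * eLpNorm (cutoff i fun t => |t| ^ (δ - 1)) (ENNReal.ofReal p)
        (weightMeasure (powerWeight i c)) ≤
      eLpNorm (dyadicSquare (cutoff i fun t => |t| ^ (δ - 1))) (ENNReal.ofReal p)
        (weightMeasure (powerWeight i c)) := by
  have hm := measurable_cutoff i (F := fun t => |t| ^ (δ - 1)) (by fun_prop)
  rw [eLpNorm_real_eq _ hp, eLpNorm_dyadicSquare_eq _ hp,
    show ENNReal.ofReal (1 / (5 * δ)) = (ENNReal.ofReal (1 / (5 * δ)) ^ p) ^ (1 / p) by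
      rw [← ENNReal.rpow_mul, mul_one_div_cancel hp.ne', ENNReal.rpow_one],
    ← ENNReal.mul_rpow_of_nonneg _ _ (by positivity), ← lintegral_const_mul _ (by fun_prop)]
  gcongr ?_ ^ (1 / p)
  refine lintegral_mono_ae ((withDensity_absolutelyContinuous _ _).ae_le
    ((ofReal_mul_le_dyadicSquare_rpow i hδ hδ2).mono fun x hx => ?_))
  rw [← ENNReal.mul_rpow_of_nonneg _ _ hp.le]
  exact ENNReal.rpow_le_rpow hx hp.le

/-- Only the slab `x i < 2^{-k}` is kept. Its share of the mass of the unit cube is `2^{-k(1-b)}`,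
and the root of order `p` of that share is the loss. -/
theorem mul_eLpNorm_cutoff_alternating_le (i : Fin n) {p b : ℝ} (hp : 0 < p) (hb : b < 1) (k : ℕ) :
    ENNReal.ofReal ((4 * k / 9) ^ (1 / 2 : ℝ) * 2 ^ (-(k * (1 - b) / p))) *
      eLpNorm (cutoff i alternating) (ENNReal.ofReal p) (weightMeasure (powerWeight i (-b))) ≤
      eLpNorm (dyadicSquare (cutoff i alternating)) (ENNReal.ofReal p)
        (weightMeasure (powerWeight i (-b))) := by
  have hb' : 0 < 1 - b := by linarith
  set y : ℝ := 2 ^ (-(k : ℤ)) with hy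
  have hy0 : 0 < y := by positivity
  have hy1 : y ≤ 1 := zpow_le_one_of_nonpos₀ (by norm_num) (by simp)
  have hyb : (y ^ (1 - b)) ^ (1 / p) = 2 ^ (-(k * (1 - b) / p)) := by
    rw [hy, ← Real.rpow_intCast, ← Real.rpow_mul (by norm_num), ← Real.rpow_mul (by norm_num)]
    congr 1; push_cast; field_simp
  have hint : ∫⁻ t in Set.Ico (0 : ℝ) 1, (Set.Iio y).indicator (fun t => ‖t‖ₑ ^ (-b)) t =
      ENNReal.ofReal (y ^ (1 - b) / (1 - b)) := by
    rw [lintegral_indicator measurableSet_Iio, Measure.restrict_restrict measurableSet_Iio]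
    have : Set.Iio y ∩ Set.Ico 0 1 = Set.Ico 0 y := by
      ext t
      simp only [Set.mem_inter_iff, Set.mem_Iio, Set.mem_Ico]
      exact ⟨fun h => ⟨h.2.1, h.1⟩, fun h => ⟨h.2, h.1, h.2.trans_le hy1⟩⟩
    rw [this, Measure.restrict_congr_set Ico_ae_eq_Ioc, setLIntegral_Ioc_rpow (by linarith) hy0.le,
      neg_add_eq_sub]
  have hmF : Measurable ((Set.Iio y).indicator fun t : ℝ => ‖t‖ₑ ^ (-b)) :=
    Measurable.indicator (by fun_prop) measurableSet_Iio
  have hmF' : Measurable fun x : Fin n → ℝ => (Set.Iio y).indicator (fun t => ‖t‖ₑ ^ (-b)) (x i) :=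
    hmF.comp (measurable_pi_apply i)
  have hmain : ENNReal.ofReal (4 * k / 9) ^ (p / 2) * ENNReal.ofReal (y ^ (1 - b) / (1 - b)) ≤
      ∫⁻ x, dyadicSquare (cutoff i alternating) x ^ p ∂weightMeasure (powerWeight i (-b)) := by
    rw [← hint, ← setLIntegral_unitCube i hmF, ← lintegral_const_mul _ hmF', weightMeasure_powerWeight,
      lintegral_withDensity_eq_lintegral_mul _ (by fun_prop)
        ((measurable_dyadicSquare _).pow_const p)]
    refine (setLIntegral_mono' (measurableSet_dyadicCube 0 0) fun x hx => ?_).trans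
      (setLIntegral_le_lintegral _ _)
    by_cases hxy : x i < y
    · rw [Set.indicator_of_mem (show x i ∈ Set.Iio y from hxy), mul_comm]
      refine mul_le_mul_right ?_ _
      refine le_trans (le_of_eq ?_)
        (ENNReal.rpow_le_rpow (rpow_le_dyadicSquare_alternating i hx hxy) hp.le)
      rw [← ENNReal.rpow_mul]
      congr 1; ring
    · rw [Set.indicator_of_notMem (show x i ∉ Set.Iio y from hxy), mul_zero]
      exact zero_le
  rw [eLpNorm_cutoff_alternating i hp hb, eLpNorm_dyadicSquare_eq _ hp]
  refine le_trans (le_of_eq ?_) (ENNReal.rpow_le_rpow hmain (by positivity : 0 ≤ 1 / p))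
  have h4 : (0 : ℝ) ≤ 4 * k / 9 := by positivity
  rw [← hyb, ENNReal.mul_rpow_of_nonneg _ _ (by positivity), ← ENNReal.rpow_mul,
    ENNReal.ofReal_mul (by positivity), mul_assoc, ENNReal.ofReal_rpow_of_nonneg h4 (by positivity),
    ENNReal.ofReal_rpow_of_nonneg (by positivity) (by positivity),
    ENNReal.ofReal_rpow_of_nonneg (by positivity) (by positivity),
    ← ENNReal.ofReal_mul (by positivity), ← Real.mul_rpow (by positivity) (by positivity),
    mul_one_div, show p / 2 * (1 / p) = 1 / 2 by field_simp]

end SquareDyadic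

/-! ### Failure of smaller exponents -/

namespace SquareDyadic

variable {n : ℕ}

theorem not_forall_mul_rpow_le {A C x y : ℝ} (hA : 0 < A) (hxy : y < x)
    (h : ∀ k : ℕ, 2 ≤ k → A * (k : ℝ) ^ x ≤ C * (4 * k : ℝ) ^ y) : False := by
  have hlim : Tendsto (fun k : ℕ => (k : ℝ) ^ (x - y)) atTop atTop :=
    (tendsto_rpow_atTop (sub_pos.2 hxy)).comp tendsto_natCast_atTop_atTop
  obtain ⟨k, hk2, hk⟩ := ((eventually_ge_atTop 2).and
    (hlim.eventually_gt_atTop (C * 4 ^ y / A))).exists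
  have hk0 : (0 : ℝ) < k := by exact_mod_cast (by omega : 0 < k)
  have h1 := h k hk2
  rw [Real.mul_rpow (by norm_num) hk0.le] at h1
  rw [Real.rpow_sub hk0, div_lt_div_iff₀ hA (Real.rpow_pos_of_pos hk0 y)] at hk
  linarith

theorem WeightedBound.le_of_eLpNorm {T : ((Fin n → ℝ) → ℝ) → (Fin n → ℝ) → ℝ≥0∞} {p β : ℝ}
    {c : ℝ≥0} (hβ : 0 ≤ β)
    (hc : ∀ w : (Fin n → ℝ) → ℝ, IsApWeight p w →
      ∀ f : (Fin n → ℝ) → ℝ, MemLp f (ENNReal.ofReal p) (weightMeasure w) →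
      eLpNorm (T f) (ENNReal.ofReal p) (weightMeasure w) ≤
        c * apConst p w ^ β * eLpNorm f (ENNReal.ofReal p) (weightMeasure w))
    {i : Fin n} {b B X : ℝ} (hb : -1 < b) {F : ℝ → ℝ} (hF : Measurable F) (hB0 : 0 < B)
    (hB : apConst p (powerWeight i b) ≤ ENNReal.ofReal B)
    (h0 : eLpNorm (cutoff i F) (ENNReal.ofReal p) (weightMeasure (powerWeight i b)) ≠ 0)
    (ht : eLpNorm (cutoff i F) (ENNReal.ofReal p) (weightMeasure (powerWeight i b)) ≠ ∞)
    (hX : ENNReal.ofReal X *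
      eLpNorm (cutoff i F) (ENNReal.ofReal p) (weightMeasure (powerWeight i b)) ≤
      eLpNorm (T (cutoff i F)) (ENNReal.ofReal p) (weightMeasure (powerWeight i b))) :
    X ≤ c * B ^ β := by
  have hw := isApWeight_powerWeight (p := p) i hb (hB.trans_lt ENNReal.ofReal_lt_top)
  have h1 := (ENNReal.mul_le_mul_iff_left h0 ht).1
    (hX.trans (hc _ hw _ (memLp_cutoff i hF ht)))
  have h2 : ENNReal.ofReal X ≤ ENNReal.ofReal (c * B ^ β) := by
    refine h1.trans ?_
    rw [ENNReal.ofReal_mul c.coe_nonneg, ← ENNReal.ofReal_rpow_of_pos hB0, ENNReal.ofReal_coe_nnreal]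
    gcongr
  exact (ENNReal.ofReal_le_ofReal_iff (by positivity)).1 h2

theorem ofReal_rpow_ne_zero_ne_top {z y : ℝ} (hz : 0 < z) :
    ENNReal.ofReal z ^ y ≠ 0 ∧ ENNReal.ofReal z ^ y ≠ ∞ := by
  rw [ENNReal.ofReal_rpow_of_pos hz]
  exact ⟨by simpa using Real.rpow_pos_of_pos hz y, ENNReal.ofReal_ne_top⟩

/-- With `δ = 1/k`, weight `|x_i|^{(1-δ)(p-1)}` and function `|x_i|^{δ-1}`, a bound would give `k/5
≤ c (4k)^{(p-1)β}` for all `k ≥ 2`. The weighted integrand is `|x_i|^{δ-1}`, hence integrable. -/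
theorem not_weightedBound_of_lt_one_div {p β : ℝ} (hp : 1 < p) (i : Fin n) (hβ0 : 0 ≤ β)
    (hβ : β < 1 / (p - 1)) : ¬ WeightedBound (dyadicSquare (n := n)) p β := by
  rintro ⟨c, hc⟩
  have hp1 : 0 < p - 1 := by linarith
  refine not_forall_mul_rpow_le (A := 1 / 5) (C := c) (x := 1) (y := (p - 1) * β) (by norm_num)
    (by rw [lt_div_iff₀ hp1] at hβ; linarith) fun k hk => ?_
  have hk2 : (2 : ℝ) ≤ k := by exact_mod_cast hk
  have hk0 : (0 : ℝ) < k := by linarith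
  have hδ0 : (0 : ℝ) < 1 / k := by positivity
  have hδ2 : (1 : ℝ) / k ≤ 1 / 2 := one_div_le_one_div_of_le (by norm_num) hk2
  have hexp : (1 - 1 / k) * (p - 1) + (1 / k - 1) * p = 1 / k - 1 := by ring
  have hap := apConst_powerWeight_pos_le hp i (b := 1 - 1 / k) (by linarith) (by linarith)
  have h4k : 4 / (1 - (1 - 1 / k)) = 4 * (k : ℝ) := by field_simp; ring
  rw [h4k, ENNReal.ofReal_rpow_of_pos (by positivity)] at hap
  have hN := eLpNorm_cutoff_rpow i (p := p) (c := (1 - 1 / k) * (p - 1)) (δ := 1 / k) (by linarith)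
    (by rw [hexp]; linarith)
  rw [hexp, sub_add_cancel] at hN
  have h := WeightedBound.le_of_eLpNorm hβ0 hc (i := i) (b := (1 - 1 / k) * (p - 1))
    (B := (4 * k) ^ (p - 1)) (X := 1 / 5 * k) (F := fun t => |t| ^ ((1 : ℝ) / k - 1))
    (by nlinarith [mul_nonneg (by linarith : (0 : ℝ) ≤ 1 - 1 / k) hp1.le]) (by fun_prop)
    (by positivity) hap (by rw [hN]; exact (ofReal_rpow_ne_zero_ne_top (by positivity)).1)
    (by rw [hN]; exact (ofReal_rpow_ne_zero_ne_top (by positivity)).2) (by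
      have := mul_eLpNorm_cutoff_rpow_le i (p := p) (c := (1 - 1 / k) * (p - 1)) (by linarith)
        hδ0 hδ2
      rwa [show 1 / (5 * (1 / (k : ℝ))) = 1 / 5 * k by field_simp] at this)
  rw [Real.rpow_one, Real.rpow_mul (by positivity)]
  exact h

/-- The weight `|x_i|^{-(1-1/k)}` has constant at most `4k`, and the slab `x_i < 2^{-k}` keeps half
of the unit-cube mass. A bound would force `k^{1/2}` to be at most a multiple of `(4k)^β`. -/
theorem not_weightedBound_of_lt_half {p β : ℝ} (hp : 1 < p) (i : Fin n) (hβ0 : 0 ≤ β)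
    (hβ : β < 1 / 2) : ¬ WeightedBound (dyadicSquare (n := n)) p β := by
  rintro ⟨c, hc⟩
  have hp0 : 0 < p := by linarith
  refine not_forall_mul_rpow_le (A := (4 / 9) ^ (1 / 2 : ℝ) * 2 ^ (-(1 / p))) (C := c)
    (by positivity) hβ fun k hk => ?_
  have hk2 : (2 : ℝ) ≤ k := by exact_mod_cast hk
  have hk0 : (0 : ℝ) < k := by linarith
  have hδ0 : (0 : ℝ) < 1 / k := by positivity
  have hδ1 : (1 : ℝ) / k ≤ 1 := by rw [div_le_one hk0]; linarith
  have hap := apConst_powerWeight_neg_le hp i (b := 1 - 1 / k) (by linarith) (by linarith)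
  have h4k : 4 / (1 - (1 - 1 / k)) = 4 * (k : ℝ) := by field_simp; ring
  rw [h4k] at hap
  have hN := eLpNorm_cutoff_alternating i hp0 (b := 1 - 1 / k) (by linarith)
  rw [sub_sub_cancel] at hN
  have h := WeightedBound.le_of_eLpNorm hβ0 hc (i := i) (b := -(1 - 1 / k)) (B := 4 * k)
    (X := (4 / 9) ^ (1 / 2 : ℝ) * 2 ^ (-(1 / p)) * (k : ℝ) ^ (1 / 2 : ℝ)) (F := alternating)
    (by linarith) measurable_alternating (by positivity) hap
    (by rw [hN]; exact (ofReal_rpow_ne_zero_ne_top (by positivity)).1)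
    (by rw [hN]; exact (ofReal_rpow_ne_zero_ne_top (by positivity)).2) (by
      have := mul_eLpNorm_cutoff_alternating_le i hp0 (b := 1 - 1 / k) (by linarith) k
      rwa [sub_sub_cancel, mul_one_div_cancel hk0.ne', mul_div_right_comm,
        Real.mul_rpow (by norm_num) hk0.le, mul_right_comm] at this)
  exact h

theorem not_weightedBound {p β : ℝ} (hp : 1 < p) (i : Fin n)
    (hβ : β < max (1 / 2) (1 / (p - 1))) : ¬ WeightedBound (dyadicSquare (n := n)) p β := by
  intro h
  -- Only upper bounds for the constants of the test weights are available, so `β` is first raised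
  -- to be non-negative.
  have h1 := h.mono hp (le_max_left β 0)
  rcases lt_max_iff.1 hβ with h2 | h2
  · exact not_weightedBound_of_lt_half hp i (le_max_right _ _) (max_lt h2 (by norm_num)) h1
  · exact not_weightedBound_of_lt_one_div hp i (le_max_right _ _)
      (max_lt h2 (one_div_pos.2 (by linarith))) h1

/-! ### Endpoint orders -/

theorem le_lpOpNorm {T : ((Fin n → ℝ) → ℝ) → (Fin n → ℝ) → ℝ≥0∞} {p : ℝ} {X : ℝ≥0∞}
    {f : (Fin n → ℝ) → ℝ} (hf : MemLp f (ENNReal.ofReal p) volume)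
    (h0 : eLpNorm f (ENNReal.ofReal p) volume ≠ 0)
    (hX : X * eLpNorm f (ENNReal.ofReal p) volume ≤ eLpNorm (T f) (ENNReal.ofReal p) volume) :
    X ≤ lpOpNorm T p :=
  le_sInf fun _ hC => (ENNReal.mul_le_mul_iff_left h0 hf.2.ne).1 (hX.trans (hC f hf))

theorem lpOpNorm_dyadicSquare_le {p p' r s s' : ℝ} (hr : 0 < r) (hr2 : r ≤ 2)
    (hp : p.HolderConjugate p') (hs : s.HolderConjugate s') (hsr : s = p / r) :
    lpOpNorm (dyadicSquare (n := n)) p ≤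
      ENNReal.ofReal ((4 * domConst n * s) ^ (1 / r) * p') := by
  have h1 := one_le_domConst n
  have h2 := hs.pos
  refine sInf_le fun f hf => (eLpNorm_dyadicSquare_le_volume hr hr2 hp hs hsr hf).trans ?_
  rw [ENNReal.ofReal_mul (p := (4 * domConst n * s) ^ (1 / r)) (by positivity),
    ENNReal.ofReal_rpow_of_nonneg (by positivity) (by positivity)]

theorem lpOpNorm_dyadicSquare_le_near_one {p : ℝ} (hp : 1 < p) (hp2 : p ≤ 2) :
    lpOpNorm (dyadicSquare (n := n)) p ≤ ENNReal.ofReal (16 * domConst n / (p - 1)) := by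
  have hq := Real.HolderConjugate.conjExponent hp
  have h1 := one_le_domConst n
  refine (lpOpNorm_dyadicSquare_le one_pos one_le_two hq hq (div_one p).symm).trans ?_
  refine ENNReal.ofReal_le_ofReal ?_
  have hp1 : 0 < p - 1 := by linarith
  rw [div_one, Real.rpow_one, Real.conjExponent, ← mul_div_assoc]
  refine div_le_div_of_nonneg_right ?_ hp1.le
  have h2 : p * p ≤ 4 := by nlinarith
  have h3 := mul_le_mul_of_nonneg_left h2 (by linarith : 0 ≤ 4 * domConst n)
  linarith

theorem lpOpNorm_dyadicSquare_le_near_top {p : ℝ} (hp : 3 ≤ p) :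
    lpOpNorm (dyadicSquare (n := n)) p ≤
      ENNReal.ofReal (2 * (2 * domConst n) ^ (1 / 2 : ℝ) * p ^ (1 / 2 : ℝ)) := by
  have hq := Real.HolderConjugate.conjExponent (by linarith : 1 < p)
  have hs := Real.HolderConjugate.conjExponent (by linarith : 1 < p / 2)
  have h1 := one_le_domConst n
  refine (lpOpNorm_dyadicSquare_le two_pos le_rfl hq hs rfl).trans ?_
  refine ENNReal.ofReal_le_ofReal ?_
  have h2 : p.conjExponent ≤ 2 := by
    rw [Real.conjExponent, div_le_iff₀ (by linarith)]; linarith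
  rw [show 4 * domConst n * (p / 2) = 2 * domConst n * p by ring,
    Real.mul_rpow (by positivity) (by linarith), mul_comm, ← mul_assoc]
  gcongr

theorem le_lpOpNorm_dyadicSquare_near_one (i : Fin n) {p : ℝ} (hp : 1 < p) (hp2 : p ≤ 4 / 3) :
    ENNReal.ofReal (1 / (10 * (p - 1))) ≤ lpOpNorm (dyadicSquare (n := n)) p := by
  have hp0 : 0 < p := by linarith
  have hp1 : 0 < p - 1 := by linarith
  -- Then `(δ - 1)p = p - 2 > -1`, so the test function lies in `L^p`, while `δ` is still comparable
  -- to `p - 1`.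
  set δ := 2 * (1 - 1 / p) with hδ
  have hδp : δ * p = 2 * (p - 1) := by rw [hδ]; field_simp
  have hδ0 : 0 < δ := pos_of_mul_pos_left (by rw [hδp]; linarith) hp0.le
  have hδ2 : δ ≤ 1 / 2 := by
    refine le_of_mul_le_mul_right ?_ hp0
    rw [hδp]; linarith
  have hδle : δ ≤ 2 * (p - 1) := by nlinarith
  have hexp : 0 + (δ - 1) * p = p - 2 := by rw [sub_mul, hδp]; ring
  have hN := eLpNorm_cutoff_rpow i (p := p) (c := 0) (δ := δ) hp0 (by rw [hexp]; linarith)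
  have h := mul_eLpNorm_cutoff_rpow_le i (p := p) (c := 0) hp0 hδ0 hδ2
  rw [hexp] at hN
  have hne := ofReal_rpow_ne_zero_ne_top (z := 1 / (p - 2 + 1)) (y := 1 / p)
    (one_div_pos.2 (by linarith))
  have hm := memLp_cutoff i (F := fun t => |t| ^ (δ - 1)) (by fun_prop) (p := p) (c := 0)
    (by rw [hN]; exact hne.2)
  rw [weightMeasure_powerWeight_zero] at h hm hN
  refine le_trans (ENNReal.ofReal_le_ofReal ?_) (le_lpOpNorm hm (by rw [hN]; exact hne.1) h)
  exact one_div_le_one_div_of_le (by positivity) (by linarith)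

/-- Taking about `p` jumps makes the slab so thin that its volume is of order `2^{-p}`, whose root
of order `p` stays bounded below. -/
theorem le_lpOpNorm_dyadicSquare_near_top (i : Fin n) {p : ℝ} (hp : 1 < p) :
    ENNReal.ofReal (p ^ (1 / 2 : ℝ) / 6) ≤ lpOpNorm (dyadicSquare (n := n)) p := by
  have hp0 : 0 < p := by linarith
  have hN := eLpNorm_cutoff_alternating i (p := p) (b := 0) hp0 one_pos
  have h := mul_eLpNorm_cutoff_alternating_le i (p := p) (b := 0) hp0 one_pos ⌈p⌉₊
  have hne := ofReal_rpow_ne_zero_ne_top (z := 1 / (1 - 0)) (y := 1 / p) (by norm_num)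
  have hm := memLp_cutoff i measurable_alternating (p := p) (c := -0)
    (by rw [hN]; exact hne.2)
  rw [neg_zero, weightMeasure_powerWeight_zero] at h hm hN
  refine le_trans (ENNReal.ofReal_le_ofReal ?_) (le_lpOpNorm hm (by rw [hN]; exact hne.1) h)
  have hk : p ≤ ⌈p⌉₊ := Nat.le_ceil p
  have hk' : (⌈p⌉₊ : ℝ) < p + 1 := Nat.ceil_lt_add_one hp0.le
  have h1 : (4 * p / 9) ^ (1 / 2 : ℝ) = 2 / 3 * p ^ (1 / 2 : ℝ) := by
    rw [mul_div_right_comm, Real.mul_rpow (by norm_num) hp0.le,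
      show (4 / 9 : ℝ) = (2 / 3) ^ (2 : ℝ) by norm_num, ← Real.rpow_mul (by norm_num)]
    norm_num
  have h2 : (1 / 4 : ℝ) ≤ 2 ^ (-(⌈p⌉₊ * (1 - 0) / p)) := by
    calc (1 / 4 : ℝ) = 2 ^ (-2 : ℝ) := by rw [Real.rpow_neg (by norm_num)]; norm_num
      _ ≤ _ := by
        refine Real.rpow_le_rpow_of_exponent_le (by norm_num) ?_
        rw [neg_le_neg_iff, sub_zero, mul_one, div_le_iff₀ hp0]
        linarith
  calc p ^ (1 / 2 : ℝ) / 6 = (4 * p / 9) ^ (1 / 2 : ℝ) * (1 / 4) := by rw [h1]; ring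
    _ ≤ _ := by gcongr

theorem endpointOrderOne_dyadicSquare (i : Fin n) :
    endpointOrderOne (dyadicSquare (n := n)) = 1 := by
  have hC := one_le_domConst n
  refine le_antisymm (iSup₂_le fun α hα => ?_) ?_
  · by_contra! hlt
    have hα1 : (1 : ℝ) < α := by exact_mod_cast hlt
    -- This `ε` leaves the exponent `(α + 1)/2`, still above 1, so the bound of order `1/(p - 1)`
    -- keeps the upper limit finite.
    have h := hα ((α - 1) / 2) (by linarith)
    have hle : limsup (fun p : ℝ => ENNReal.ofReal ((p - 1) ^ ((α : ℝ) - (α - 1) / 2)) *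
        lpOpNorm (dyadicSquare (n := n)) p) (𝓝[>] 1) ≤ ENNReal.ofReal (16 * domConst n) := by
      refine limsup_le_of_le (by isBoundedDefault) ?_
      filter_upwards [Ioc_mem_nhdsGT (by norm_num : (1 : ℝ) < 2)] with p hp
      have hp1 : 0 < p - 1 := by linarith [hp.1]
      refine (mul_le_mul_right (lpOpNorm_dyadicSquare_le_near_one hp.1 hp.2) _).trans ?_
      rw [← ENNReal.ofReal_mul (by positivity)]
      refine ENNReal.ofReal_le_ofReal ?_
      have h1 : (p - 1) ^ ((α : ℝ) - (α - 1) / 2) ≤ p - 1 := by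
        conv_rhs => rw [← Real.rpow_one (p - 1)]
        exact Real.rpow_le_rpow_of_exponent_ge hp1 (by linarith [hp.2]) (by linarith)
      calc _ ≤ (p - 1) * (16 * domConst n / (p - 1)) := by gcongr
        _ = _ := by field_simp
    rw [h] at hle
    exact ENNReal.ofReal_ne_top (top_le_iff.1 hle)
  · refine le_iSup₂_of_le (1 : ℝ≥0) (fun ε hε => ?_) (by simp)
    refine Tendsto.limsup_eq (ENNReal.tendsto_nhds_top_iff_nnreal.2 fun M => ?_)
    have hlim : Tendsto (fun p : ℝ => (p - 1) ^ (-ε)) (𝓝[>] 1) atTop := by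
      have h1 := tendsto_rpow_neg_nhdsGT_zero (neg_neg_of_pos hε)
      refine h1.comp (tendsto_nhdsWithin_iff.2 ⟨?_, ?_⟩)
      · have : Tendsto (fun p : ℝ => p - 1) (𝓝 1) (𝓝 (1 - 1)) := tendsto_id.sub_const 1
        rw [sub_self] at this
        exact this.mono_left nhdsWithin_le_nhds
      · filter_upwards [self_mem_nhdsWithin] with p hp using sub_pos.2 (Set.mem_Ioi.1 hp)
    filter_upwards [Ioc_mem_nhdsGT (by norm_num : (1 : ℝ) < 4 / 3),
      hlim.eventually_gt_atTop (10 * M)] with p hp hM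
    have hp1 : 0 < p - 1 := by linarith [hp.1]
    refine lt_of_lt_of_le ?_ (mul_le_mul_right (le_lpOpNorm_dyadicSquare_near_one i hp.1 hp.2) _)
    rw [← ENNReal.ofReal_mul (by positivity), ENNReal.coe_nnreal_eq]
    refine (ENNReal.ofReal_lt_ofReal_iff_of_nonneg M.coe_nonneg).2 ?_
    rw [NNReal.coe_one, sub_eq_add_neg 1 ε, Real.rpow_add hp1, Real.rpow_one]
    have : (p - 1) * (p - 1) ^ (-ε) * (1 / (10 * (p - 1))) = (p - 1) ^ (-ε) / 10 := by field_simp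
    rw [this]
    linarith

theorem endpointOrderTop_dyadicSquare (i : Fin n) :
    endpointOrderTop (dyadicSquare (n := n)) = 1 / 2 := by
  have hC := one_le_domConst n
  have hhalf : ((1 / 2 : ℝ≥0) : ℝ≥0∞) = 1 / 2 := by
    rw [ENNReal.coe_div two_ne_zero, ENNReal.coe_one, ENNReal.coe_ofNat]
  rw [← hhalf]
  refine le_antisymm (iSup₂_le fun γ hγ => ?_) ?_
  · by_contra! hlt
    have hγ1 : (1 / 2 : ℝ) < γ := by
      have := ENNReal.coe_lt_coe.1 hlt
      have h2 := NNReal.coe_lt_coe.2 this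
      simpa using h2
    -- The remaining exponent `(γ + 1/2)/2` still exceeds `1/2`, so the quotient stays bounded.
    have h := hγ ((γ - 1 / 2) / 2) (by linarith)
    have hle : limsup (fun p : ℝ => lpOpNorm (dyadicSquare (n := n)) p /
        ENNReal.ofReal (p ^ ((γ : ℝ) - (γ - 1 / 2) / 2))) atTop ≤
        ENNReal.ofReal (2 * (2 * domConst n) ^ (1 / 2 : ℝ)) := by
      refine limsup_le_of_le (by isBoundedDefault) ?_
      filter_upwards [eventually_ge_atTop 3] with p hp
      have hp0 : 0 < p := by linarith
      refine ENNReal.div_le_of_le_mul ((lpOpNorm_dyadicSquare_le_near_top hp).trans ?_)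
      rw [← ENNReal.ofReal_mul (by positivity)]
      refine ENNReal.ofReal_le_ofReal (mul_le_mul_of_nonneg_left ?_ (by positivity))
      exact Real.rpow_le_rpow_of_exponent_le (by linarith) (by linarith)
    rw [h] at hle
    exact ENNReal.ofReal_ne_top (top_le_iff.1 hle)
  · refine le_iSup₂_of_le (1 / 2 : ℝ≥0) (fun ε hε => ?_) le_rfl
    refine Tendsto.limsup_eq (ENNReal.tendsto_nhds_top_iff_nnreal.2 fun M => ?_)
    filter_upwards [eventually_gt_atTop 1, (tendsto_rpow_atTop hε).eventually_gt_atTop (6 * M)]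
      with p hp hM
    have hp0 : 0 < p := by linarith
    have hpos : 0 < p ^ (((1 / 2 : ℝ≥0) : ℝ) - ε) := by positivity
    refine lt_of_lt_of_le ?_ (ENNReal.div_le_div_right (le_lpOpNorm_dyadicSquare_near_top i hp) _)
    rw [← ENNReal.ofReal_div_of_pos hpos, ENNReal.coe_nnreal_eq]
    refine (ENNReal.ofReal_lt_ofReal_iff_of_nonneg M.coe_nonneg).2 ?_
    have h1 : (((1 / 2 : ℝ≥0) : ℝ)) = 1 / 2 := by simp
    have h2 : p ^ (1 / 2 : ℝ) / 6 / p ^ ((1 / 2 : ℝ) - ε) = p ^ ε / 6 := by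
      rw [Real.rpow_sub hp0]
      have := (Real.rpow_pos_of_pos hp0 (1 / 2)).ne'
      have := (Real.rpow_pos_of_pos hp0 ε).ne'
      field_simp
    rw [h1, h2]
    linarith

end SquareDyadic

theorem corollary4p4 (n : ℕ) (hn : 0 < n) :
    (∀ p : ℝ, 1 < p →
      SquareDyadic.WeightedBound (SquareDyadic.dyadicSquare (n := n)) p (max (1 / 2) (1 / (p - 1))) ∧
      ∀ β : ℝ, β < max (1 / 2) (1 / (p - 1)) →
        ¬ SquareDyadic.WeightedBound (SquareDyadic.dyadicSquare (n := n)) p β) ∧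
    SquareDyadic.endpointOrderOne (SquareDyadic.dyadicSquare (n := n)) = 1 ∧
    SquareDyadic.endpointOrderTop (SquareDyadic.dyadicSquare (n := n)) = 1 / 2 :=
  ⟨fun _ hp => ⟨SquareDyadic.weightedBound_dyadicSquare hp,
    fun _ hβ => SquareDyadic.not_weightedBound hp ⟨0, hn⟩ hβ⟩,
    SquareDyadic.endpointOrderOne_dyadicSquare ⟨0, hn⟩,
    SquareDyadic.endpointOrderTop_dyadicSquare ⟨0, hn⟩⟩
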